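/- **Setting.** Let $\Omega\subset\mathbb R^2$ be a polygonal connected open bounded set, $u_0\in L^2(\Omega)$ with $u_0\ge 0$ and $M^1=\int_\Omega u_0>0$, $V\in C^1(\overline\Omega,\mathbb R)$, $0<\lambda_m\le\lambda^M$, and let $\Lambda\in L^\infty(\Omega)^{2\times2}$ be symmetric with $\lambda_m|v|^2\le\Lambda(x)v\cdot v\le\lambda^M|v|^2$ for all $v\in\mathbb R^2$ and a.e. $x\in\Omega$. **Mesh.** The primal mesh consists of a finite partition $\mathfrak M$ of $\Omega$ into open polygonal cells $K$, with a center $x_K\in K$ each, and of the set $\partial\mathfrak M$ of boundary edges, seen as degenerate cells whose center is their midpoint. The boundary of each cell is the union of its edges; distinct edges meet at most at end points; an interior edge $\sigma=K|L$ equals $\partial K\cap\partial L$ and its relative interior lies in $\Omega$; a boundary edge $\sigma\subset\partial\Omega$ of the cell $K$ is itself the cell $L$. To an edge $\sigma$ with end points $x_{K^*},x_{L^*}$ one associates the dual edge $\sigma^*=[x_K,x_L]$ and the diamond $D$, the convex quadrilateral (a triangle if $\sigma\subset\partial\Omega$) with diagonals $\sigma$ and $\sigma^*$, which cross each other; the diamonds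 $D\in\mathfrak D$ form a partition of $\Omega$. The dual cell $K^*$ of a vertex $x_{K^*}$ of the primal mesh is the union of the triangles with apex $x_{K^*}$ and base $\sigma^*$, over the edges $\sigma$ ending at $x_{K^*}$; $\overline{\mathfrak M^*}$ is the set of dual cells and $\mathfrak M^*$ the set of those with $x_{K^*}\in\Omega$. Let $m_K,m_{K^*},m_D$ be areas, $m_\sigma,m_{\sigma^*}$ lengths, $\alpha_D$ the angle between $x_L-x_K$ and $x_{L^*}-x_{K^*}$, $n_{\sigma K}$ the unit normal to $\sigma$ pointing from $K$ to $L$, and $n_{\sigma^*K^*}$ the unit normal to $\sigma^*$ pointing from $K^*$ to $L^*$. The mesh has regularity $\Theta\ge1$ if, for all $D\in\mathfrak D$, $$\frac1{2\sin\alpha_D}\Big(\frac{m_\sigma}{m_{\sigma^*}}+\frac{m_{\sigma^*}}{m_\sigma}\Big)\le\Theta,\qquad \frac{m_D}{m(D\cap K)}\le\Theta,\qquad \frac{m_D}{m(D\cap K^*)}\le\Theta$$ for all $K\in\mathfrak M$ with $m(D\cap K)>0$ and all $K^*\in\mathfrak M^*$ with $m(D\cap K^*)>0$. **Scheme.** A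 vector $u_{\mathcal T}\in\mathbb R^{\mathcal T}$ has one component for each cell of $\overline{\mathfrak M}=\mathfrak M\cup\partial\mathfrak M$ and of $\overline{\mathfrak M^*}$. Put $$[\![v,u]\!]=\frac12\Big(\sum_{K\in\mathfrak M}m_Ku_Kv_K+\sum_{K^*\in\overline{\mathfrak M^*}}m_{K^*}u_{K^*}v_{K^*}\Big),\qquad \delta^Du=\begin{pmatrix}u_K-u_L\\u_{K^*}-u_{L^*}\end{pmatrix},$$ $\Lambda^D=\frac1{m_D}\int_D\Lambda$, and let $\mathbb A^D$ be the symmetric $2\times2$ matrix with entries $$\mathbb A^D=\frac1{4m_D}\begin{pmatrix}m_\sigma^2\,\Lambda^Dn_{\sigma K}\cdot n_{\sigma K}&m_\sigma m_{\sigma^*}\,\Lambda^Dn_{\sigma K}\cdot n_{\sigma^*K^*}\\ m_\sigma m_{\sigma^*}\,\Lambda^Dn_{\sigma K}\cdot n_{\sigma^*K^*}&m_{\sigma^*}^2\,\Lambda^Dn_{\sigma^*K^*}\cdot n_{\sigma^*K^*}\end{pmatrix}.$$ Let $r:(0,\infty)^2\to(0,\infty)$ be nondecreasing in each variable, symmetric,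 positively homogeneous of degree one, with $r(x,x)=x$ and $\frac{x-y}{\log x-\log y}\le r(x,y)\le\max(x,y)$ for $x\ne y$; let $f(x,y)=\max(x,y)$ or $f(x,y)=\frac{x+y}2$; put $r^D(u)=f\big(r(u_K,u_L),r(u_{K^*},u_{L^*})\big)$. The vector $u^0$ is given by the means of $u_0$ on the cells of $\mathfrak M$ and $\overline{\mathfrak M^*}$ and by $0$ on $\partial\mathfrak M$, and $V_K=V(x_K)$, $V_{K^*}=V(x_{K^*})$. For a time step $\Delta t>0$, a solution of the nonlinear DDFV scheme with no-flux boundary conditions is a sequence $(u^n)_{n\ge0}$ such that, for all $n\ge0$, $u^{n+1}$ has positive components and $$\Big[\!\Big[\frac{u^{n+1}-u^n}{\Delta t},\psi\Big]\!\Big]+\sum_{D\in\mathfrak D}r^D(u^{n+1})\,\delta^Dg^{n+1}\cdot\mathbb A^D\delta^D\psi=0\quad\forall\psi\in\mathbb R^{\mathcal T},\qquad g^{n+1}=\log u^{n+1}+V_{\mathcal T}.$$ The discrete steady state is $u_K^\infty=\rho e^{-V_K}$, $u_{K^*}^\infty=\rho^*e^{-V_{K^*}}$, with $\rho=M^1\big(\sum_{K\in\mathfrak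 M}m_Ke^{-V_K}\big)^{-1}$ and $\rho^*=M^1\big(\sum_{K^*\in\overline{\mathfrak M^*}}m_{K^*}e^{-V_{K^*}}\big)^{-1}$, and the discrete relative Boltzmann entropy is $\mathbb E^n_{1,\mathcal T}=[\![u^\infty\Phi_1(u^n/u^\infty),1]\!]$ with $\Phi_1(s)=s\log s-s+1$ and $\Phi_1(0)=1$. **Theorem.** Given $\Omega$, $\Theta\ge1$, $u_0$, $V$, $\lambda_m$ and $\lambda^M$, there exists $\nu>0$, depending only on these data, such that for every $\Lambda$ as above, every DDFV mesh of $\Omega$ of regularity $\Theta$, every $r$ and $f$ as above, every $\Delta t>0$ and every solution $(u^n)_{n\ge0}$ of the scheme, $$\mathbb E^n_{1,\mathcal T}\le(1+\nu\Delta t)^{-n}\,\mathbb E^0_{1,\mathcal T}\qquad\forall n\ge0.$$ Thus for any $k>0$, if $\Delta t\le k$, then for all $n\ge0$, $\mathbb E^n_{1,\mathcal T}\le e^{-\tilde\nu\,n\Delta t}\,\mathbb E^0_{1,\mathcal T}$ with $\tilde\nu=\log(1+\nu k)/k$. -/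

import Mathlib

open MeasureTheory Set

noncomputable section

/-- The Euclidean plane. -/
abbrev Plane : Type := EuclideanSpace ℝ (Fin 2)

/-- Rotation by `+π/2`. -/
def perp (v : Plane) : Plane := !₂[-(v 1), v 0]

/-- `(A v) · w`. -/
def matForm (A : Matrix (Fin 2) (Fin 2) ℝ) (v w : Plane) : ℝ :=
  ∑ i, ∑ j, w i * A i j * v j

/-! ### The data of the continuous problem -/

/-- Polygonal connected open bounded (nonempty) subsets of the plane. -/
structure IsPolygonalDomain (Ω : Set Plane) : Prop where
  isOpen : IsOpen Ω
  isConnected : IsConnected Ω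
  isBounded : Bornology.IsBounded Ω
  polygonal : ∃ S : Finset (Plane × Plane), frontier Ω = ⋃ s ∈ S, segment ℝ s.1 s.2

/-- `u₀ ∈ L²(Ω)`, `u₀ ≥ 0`, `∫_Ω u₀ > 0`. -/
structure IsInitialDatum (Ω : Set Plane) (u₀ : Plane → ℝ) : Prop where
  memLp : MemLp u₀ 2 (volume.restrict Ω)
  nonneg : ∀ᵐ x ∂(volume.restrict Ω), 0 ≤ u₀ x
  mass_pos : 0 < ∫ x in Ω, u₀ x

/-- `V ∈ C¹(closure Ω)`: `V` is `C¹` in `Ω`, and `V` and its differential extend continuously to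
the closure. Only the values of `V` on the closure of `Ω` are ever used. -/
structure IsC1OnClosure (Ω : Set Plane) (V : Plane → ℝ) : Prop where
  continuousOn : ContinuousOn V (closure Ω)
  contDiffOn : ContDiffOn ℝ 1 V Ω
  extends_fderiv : ∃ G : Plane → (Plane →L[ℝ] ℝ),
    ContinuousOn G (closure Ω) ∧ ∀ x ∈ Ω, G x = fderiv ℝ V x

/-- `Λ ∈ L^∞(Ω)^{2×2}` is symmetric and
`λm |v|² ≤ Λ(x) v · v ≤ λM |v|²` for all `v` and almost all `x ∈ Ω`. -/
structure IsAnisotropyTensor (Ω : Set Plane) (lamm lamM : ℝ)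
    (Lam : Plane → Matrix (Fin 2) (Fin 2) ℝ) : Prop where
  memLp : ∀ i j, MemLp (fun x => Lam x i j) ⊤ (volume.restrict Ω)
  symm : ∀ᵐ x ∂(volume.restrict Ω), (Lam x).IsSymm
  elliptic : ∀ᵐ x ∂(volume.restrict Ω), ∀ v : Plane,
    lamm * ‖v‖ ^ 2 ≤ matForm (Lam x) v v ∧ matForm (Lam x) v v ≤ lamM * ‖v‖ ^ 2

/-! ### DDFV meshes -/

/-- The raw data of a DDFV mesh. The primal edges `σ` (hence also the diamonds) are indexed by
`IntEdge ⊕ BdEdge`. The interior primal cells are indexed by `PCell`, the degenerate boundary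
primal cells by `BdEdge`, and the dual cells by the vertices `Vtx` of the primal mesh. To the
edge `σ` are attached its end points `x_{K*}` (`src σ`) and `x_{L*}` (`tgt σ`), a cell `K`
(`left σ`), and a cell `L`, which is `right σ` for an interior edge and the degenerate
cell `σ` itself for a boundary edge. -/
structure DDFVData where
  PCell : Type
  Vtx : Type
  IntEdge : Type
  BdEdge : Type
  [fintypePCell : Fintype PCell]
  [fintypeVtx : Fintype Vtx]
  [fintypeIntEdge : Fintype IntEdge]
  [fintypeBdEdge : Fintype BdEdge]
  /-- the interior primal control volumes -/
  cell : PCell → Set Plane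
  center : PCell → Plane
  vertex : Vtx → Plane
  src : IntEdge ⊕ BdEdge → Vtx
  tgt : IntEdge ⊕ BdEdge → Vtx
  left : IntEdge ⊕ BdEdge → PCell
  right : IntEdge → PCell

attribute [instance] DDFVData.fintypePCell
attribute [instance] DDFVData.fintypeVtx
attribute [instance] DDFVData.fintypeIntEdge
attribute [instance] DDFVData.fintypeBdEdge

namespace DDFVData

variable (M : DDFVData)

/-- Edges of the primal mesh. -/
abbrev Edge : Type := M.IntEdge ⊕ M.BdEdge

/-- Index set of all the primal cells, degenerate boundary cells included. -/
abbrev Primal : Type := M.PCell ⊕ M.BdEdge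

/-- Index set of the discrete unknowns; `M.Unk → ℝ` is the space `ℝ^𝒯`. -/
abbrev Unk : Type := M.Primal ⊕ M.Vtx

/-- `x_{K*}` -/
def xa (e : M.Edge) : Plane := M.vertex (M.src e)

/-- `x_{L*}` -/
def xb (e : M.Edge) : Plane := M.vertex (M.tgt e)

/-- The center of a primal cell: the midpoint for a boundary edge. -/
def primalCenter : M.Primal → Plane
  | .inl K => M.center K
  | .inr b => midpoint ℝ (M.xa (.inr b)) (M.xb (.inr b))

/-- The cell `K` of a diamond. -/
def cellK (e : M.Edge) : M.Primal := .inl (M.left e)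

/-- The cell `L` of a diamond. -/
def cellL : M.Edge → M.Primal
  | .inl i => .inl (M.right i)
  | .inr b => .inr b

/-- `x_K` -/
def xK (e : M.Edge) : Plane := M.primalCenter (M.cellK e)

/-- `x_L` -/
def xL (e : M.Edge) : Plane := M.primalCenter (M.cellL e)

/-- The primal edge `σ`. -/
def seg (e : M.Edge) : Set Plane := segment ℝ (M.xa e) (M.xb e)

/-- The dual edge `σ*`. -/
def dualSeg (e : M.Edge) : Set Plane := segment ℝ (M.xK e) (M.xL e)

/-- `σ ∈ 𝓔_K`. -/
def IsEdgeOf (K : M.PCell) (e : M.Edge) : Prop := M.cellK e = .inl K ∨ M.cellL e = .inl K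

/-- The (closed) diamond with diagonals `σ` and `σ*`; a triangle for a boundary edge. -/
def diamond (e : M.Edge) : Set Plane := convexHull ℝ {M.xK e, M.xa e, M.xL e, M.xb e}

/-- The (closed) dual cell `K*`: the polygon around `x_{K*}` bounded by the dual edges `σ*` of the
edges `σ` issued from `x_{K*}` (and, for a boundary vertex, by halves of boundary edges). It is made
of the triangles with apex `x_{K*}` and bases these dual edges. -/
def dualCell (v : M.Vtx) : Set Plane :=
  ⋃ e : {e : M.Edge // M.src e = v ∨ M.tgt e = v},
    convexHull ℝ {M.vertex v, M.xK e.1, M.xL e.1}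

/-- The data form a DDFV mesh of `Ω`. -/
structure IsMesh (Ω : Set Plane) : Prop where
  /- the interior primal cells form a partition of `Ω` into open polygons -/
  cell_open : ∀ K, IsOpen (M.cell K)
  cell_subset : ∀ K, M.cell K ⊆ Ω
  cell_disjoint : Pairwise fun K L => Disjoint (M.cell K) (M.cell L)
  cell_cover : Ω ⊆ ⋃ K, closure (M.cell K)
  cell_frontier : ∀ K, frontier (M.cell K) = ⋃ e : {e : M.Edge // M.IsEdgeOf K e}, M.seg e.1
  center_mem : ∀ K, M.center K ∈ M.cell K
  /- vertices and edges -/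
  vertex_injective : Function.Injective M.vertex
  vertex_used : ∀ v, ∃ e, M.src e = v ∨ M.tgt e = v
  src_ne_tgt : ∀ e, M.src e ≠ M.tgt e
  edge_inter : ∀ e e', e ≠ e' → Disjoint (openSegment ℝ (M.xa e) (M.xb e)) (M.seg e')
  intEdge_subset : ∀ i, openSegment ℝ (M.xa (.inl i)) (M.xb (.inl i)) ⊆ Ω
  intEdge_ne : ∀ i, M.left (.inl i) ≠ M.right i
  intEdge_eq : ∀ i,
    frontier (M.cell (M.left (.inl i))) ∩ frontier (M.cell (M.right i)) = M.seg (.inl i)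
  bdEdge_subset : ∀ b, M.seg (.inr b) ⊆ frontier Ω
  /- the two diagonals of a diamond cross each other, and `K`, `L`, `K*`, `L*` are named in such
  a way that the rotation by `+π/2` of the direction from `x_{K*}` to `x_{L*}` points from `K`
  to `L` -/
  diag_cross : ∀ e, (openSegment ℝ (M.xa e) (M.xb e) ∩ M.dualSeg e).Nonempty
  orient : ∀ e, 0 < inner ℝ (perp (M.xb e - M.xa e)) (M.xL e - M.xK e)
  /- the diamonds form a partition of `Ω` -/
  diamond_subset : ∀ e, M.diamond e ⊆ closure Ω
  diamond_disjoint : Pairwise fun e e' => Disjoint (interior (M.diamond e)) (interior (M.diamond e'))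
  diamond_cover : Ω ⊆ ⋃ e, M.diamond e

/-- `m_σ` -/
def mσ (e : M.Edge) : ℝ := dist (M.xa e) (M.xb e)

/-- `m_{σ*}` -/
def mσs (e : M.Edge) : ℝ := dist (M.xK e) (M.xL e)

/-- `m_D` -/
def mD (e : M.Edge) : ℝ := volume.real (M.diamond e)

/-- `α_D` -/
def angleD (e : M.Edge) : ℝ :=
  InnerProductGeometry.angle (M.xL e - M.xK e) (M.xb e - M.xa e)

/-- `n_{σK}`, the unit normal to `σ` outward `K`. -/
def nσK (e : M.Edge) : Plane := (M.mσ e)⁻¹ • perp (M.xb e - M.xa e)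

/-- `n_{σ*K*}`, the unit normal to `σ*` outward `K*`. -/
def nσsKs (e : M.Edge) : Plane := -((M.mσs e)⁻¹ • perp (M.xL e - M.xK e))

/-- `θ_D` -/
def thetaD (e : M.Edge) : ℝ :=
  1 / (2 * Real.sin (M.angleD e)) * (M.mσ e / M.mσs e + M.mσs e / M.mσ e)

/-- The regularity assumption `θ_D ≤ Θ` and `θ̃_D ≤ Θ` for all diamonds `D`, where `θ̃_D` is the
largest of the quotients `m_D / m_{D ∩ K}` and `m_D / m_{D ∩ K*}`, for the interior primal cells `K`
and the interior dual cells `K*` that meet `D` in a set of positive measure. -/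
structure IsRegular (Ω : Set Plane) (Θ : ℝ) : Prop where
  theta_le : ∀ e, M.thetaD e ≤ Θ
  primal_le : ∀ e K, 0 < volume.real (M.diamond e ∩ M.cell K) →
    M.mD e / volume.real (M.diamond e ∩ M.cell K) ≤ Θ
  dual_le : ∀ e v, M.vertex v ∈ Ω → 0 < volume.real (M.diamond e ∩ M.dualCell v) →
    M.mD e / volume.real (M.diamond e ∩ M.dualCell v) ≤ Θ

/-! ### The nonlinear DDFV scheme -/

/-- The bilinear form `⟦·,·⟧` on `ℝ^𝒯`. -/
def bracket (v u : M.Unk → ℝ) : ℝ :=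
  1 / 2 * (∑ K : M.PCell, volume.real (M.cell K) * u (.inl (.inl K)) * v (.inl (.inl K))
    + ∑ w : M.Vtx, volume.real (M.dualCell w) * u (.inr w) * v (.inr w))

/-- `Λ^D`, the mean value of `Λ` on the diamond. -/
def LamD (Lam : Plane → Matrix (Fin 2) (Fin 2) ℝ) (e : M.Edge) : Matrix (Fin 2) (Fin 2) ℝ :=
  Matrix.of fun i j => (M.mD e)⁻¹ * ∫ x in M.diamond e, Lam x i j

/-- The local matrix `𝔸^D`. -/
def AD (Lam : Plane → Matrix (Fin 2) (Fin 2) ℝ) (e : M.Edge) : Matrix (Fin 2) (Fin 2) ℝ :=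
  let L := M.LamD Lam e
  let s := M.mσ e
  let t := M.mσs e
  let n := M.nσK e
  let ns := M.nσsKs e
  (1 / (4 * M.mD e)) •
    !![s ^ 2 * matForm L n n, s * t * matForm L n ns;
       s * t * matForm L n ns, t ^ 2 * matForm L ns ns]

/-- `δ^D u = (u_K - u_L, u_{K*} - u_{L*})`. -/
def deltaD (u : M.Unk → ℝ) (e : M.Edge) : Plane :=
  !₂[u (.inl (M.cellK e)) - u (.inl (M.cellL e)), u (.inr (M.src e)) - u (.inr (M.tgt e))]

/-- The reconstruction `r^D(u) = f(r(u_K,u_L), r(u_{K*},u_{L*}))`. -/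
def recD (f r : ℝ → ℝ → ℝ) (u : M.Unk → ℝ) (e : M.Edge) : ℝ :=
  f (r (u (.inl (M.cellK e))) (u (.inl (M.cellL e)))) (r (u (.inr (M.src e))) (u (.inr (M.tgt e))))

/-- `T_𝔇(u; g, ψ)`. -/
def TD (Lam : Plane → Matrix (Fin 2) (Fin 2) ℝ) (f r : ℝ → ℝ → ℝ) (u g ψ : M.Unk → ℝ) : ℝ :=
  ∑ e : M.Edge, M.recD f r u e * matForm (M.AD Lam e) (M.deltaD ψ e) (M.deltaD g e)

/-- The point where the potential is evaluated: the center of a primal cell, the vertex of a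
dual cell. -/
def node : M.Unk → Plane
  | .inl K => M.primalCenter K
  | .inr v => M.vertex v

/-- The discrete initial condition. -/
def init (u₀ : Plane → ℝ) : M.Unk → ℝ
  | .inl (.inl K) => (volume.real (M.cell K))⁻¹ * ∫ x in M.cell K, u₀ x
  | .inl (.inr _) => 0
  | .inr v => (volume.real (M.dualCell v))⁻¹ * ∫ x in M.dualCell v, u₀ x

/-- The discrete steady state, of mass `M¹ = ∫_Ω u₀` on the primal mesh and on the dual mesh. -/
def steady (Ω : Set Plane) (u₀ V : Plane → ℝ) : M.Unk → ℝ
  | .inl K => (∫ x in Ω, u₀ x)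
      * (∑ K' : M.PCell, volume.real (M.cell K') * Real.exp (-V (M.center K')))⁻¹
      * Real.exp (-V (M.primalCenter K))
  | .inr v => (∫ x in Ω, u₀ x)
      * (∑ w : M.Vtx, volume.real (M.dualCell w) * Real.exp (-V (M.vertex w)))⁻¹
      * Real.exp (-V (M.vertex v))

end DDFVData

/-- The admissible mean functions `r : (0,∞)² → (0,∞)`. -/
structure IsMeanFunction (r : ℝ → ℝ → ℝ) : Prop where
  pos : ∀ x y, 0 < x → 0 < y → 0 < r x y
  mono : ∀ x x' y y', 0 < x → 0 < y → x ≤ x' → y ≤ y' → r x y ≤ r x' y'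
  diag : ∀ x, 0 < x → r x x = x
  symm : ∀ x y, 0 < x → 0 < y → r x y = r y x
  homog : ∀ c x y, 0 < c → 0 < x → 0 < y → r (c * x) (c * y) = c * r x y
  lower : ∀ x y, 0 < x → 0 < y → x ≠ y → (x - y) / (Real.log x - Real.log y) ≤ r x y
  upper : ∀ x y, 0 < x → 0 < y → x ≠ y → r x y ≤ max x y

/-- The two admissible choices of `f`. -/
def IsAdmissibleCombination (f : ℝ → ℝ → ℝ) : Prop :=
  (f = fun x y => max x y) ∨ (f = fun x y => (x + y) / 2)

/-- `Φ₁(s) = s log s - s + 1` -/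
def Phi1 (s : ℝ) : ℝ := s * Real.log s - s + 1

/-- `(uⁿ)` is a (positive) solution of the nonlinear DDFV scheme with no-flux boundary conditions
and time step `dt`. -/
structure IsDDFVSolution (M : DDFVData) (u₀ V : Plane → ℝ)
    (Lam : Plane → Matrix (Fin 2) (Fin 2) ℝ) (f r : ℝ → ℝ → ℝ) (dt : ℝ)
    (u : ℕ → M.Unk → ℝ) : Prop where
  initial : u 0 = M.init u₀
  pos : ∀ n i, 0 < u (n + 1) i
  scheme : ∀ n (ψ : M.Unk → ℝ),
    M.bracket (fun i => (u (n + 1) i - u n i) / dt) ψ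
      + M.TD Lam f r (u (n + 1)) (fun i => Real.log (u (n + 1) i) + V (M.node i)) ψ = 0

/-- The discrete relative Boltzmann entropy `⟦u^∞ Φ₁(u/u^∞), 1⟧` of `u ∈ ℝ^𝒯`. -/
def relEntropy (M : DDFVData) (Ω : Set Plane) (u₀ V : Plane → ℝ) (u : M.Unk → ℝ) : ℝ :=
  M.bracket (fun i => M.steady Ω u₀ V i * Phi1 (u i / M.steady Ω u₀ V i)) (fun _ => 1)

end

/-!
The entropy `E` decays because it is dissipated and because its dissipation controls it.

*Dissipation.* Let `c` be the discrete steady state and `w = u / c`. The functions `log w` and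
`log u + V` have the same differences through the diamonds (`DDFVData.deltaD_log_steady`), so testing
the scheme with `log w` and using the convexity of `Φ₁` (`Phi1_sub_le`) shows that over a time step
the entropy drops by at least `dt` times `∑ r^D(u) δ^D(log w) · 𝔸^D δ^D(log w)`. On a regular mesh the
diagonals of a diamond have comparable lengths and their angle is bounded away from zero, so the
matrices `𝔸^D` are uniformly coercive (`DDFVData.AD_coercive`). As `r` dominates the logarithmic mean,
the dissipation is at least a multiple of the Dirichlet energy of `√w`, that is, of the sum of its
squared jumps through the diamonds, on the primal and on the dual mesh
(`DDFVData.dissipation_lower_bound`).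

*Logarithmic Sobolev inequality.* The primal and the dual mesh are treated separately: the scheme
conserves the mass of each (`DDFVData.primal_mass`, `DDFVData.dual_mass`), and each mass is that of the
steady state. Given equality of masses, the elementary bound `log s ≤ s - 1` controls the entropy by
`∑ m (w - t)² / t` for every `t > 0` (`sum_Phi1_le`). Writing `w = h²` and choosing `t` close to `c₀²`
for a suitable constant `c₀`, this is controlled by the `L⁴` norm of `h - c₀`, so a Poincaré-Sobolev
inequality in `L⁴` for piecewise constant functions is enough
(`DDFVData.exists_discrete_chi_square_bound`).

*Poincaré-Sobolev inequality.* Along almost every segment in `Ω`, a discrete function varies by at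
most the sum of its jumps through the diamonds that the segment meets. The set of the points that are
hidden from `x` by a diamond of diameter about `d` at distance `ℓ` from `x` has area at most of order `d / ℓ`
(`exists_shadow_bound`), so averaging over the end point of the segment bounds the distance of `h` to
its mean value over a convex set by the Riesz potential of the jumps. The Cauchy-Schwarz inequality
and the integrability of `|z|^(-4/3)` in the plane bound this potential in `L⁴`
(`exists_potential_bound`). A polygonal domain is, up to a null set, a finite union of convex sets,
which can be linked by small balls centered in `Ω`; transferring the bound along a chain gives the
inequality on `Ω` (`IsPolygonalDomain.exists_poincare_sobolev`), with a constant that depends on the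
mesh only through its regularity.

*Geometry of the mesh.* For the jumps along a segment to be those of the diamonds it meets, cells with
a common point, apart from finitely many nodes, must share a diamond that contains this point. On the
primal mesh this is immediate. On the dual mesh it relies on the fact that a cell contains the open
segments from its center to its vertices: otherwise the cell would have to reach beyond one of its
edges, which is incompatible with the partition of `Ω` into triangles with apex the center of a cell
and base one of its edges (`DDFVData.IsMesh.openSegment_subset_cell`, `DDFVData.IsMesh.dualCell_inter`).
-/

noncomputable section

/-! ### Plane geometry -/

/-- The cross product (signed area of the parallelogram) of two plane vectors. -/
def pcross (v w : Plane) : ℝ := v 0 * w 1 - v 1 * w 0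

theorem plane_inner (v w : Plane) : inner ℝ v w = v 0 * w 0 + v 1 * w 1 := by
  simp [PiLp.inner_apply, Fin.sum_univ_two, mul_comm]

theorem plane_norm_sq (v : Plane) : ‖v‖ ^ 2 = v 0 ^ 2 + v 1 ^ 2 := by
  rw [← real_inner_self_eq_norm_sq, plane_inner]; ring

theorem plane_ext {v w : Plane} (h0 : v 0 = w 0) (h1 : v 1 = w 1) : v = w := by
  ext i; fin_cases i <;> assumption

@[simp] theorem perp_zero_apply (v : Plane) : perp v 0 = -(v 1) := by simp [perp]

@[simp] theorem perp_one_apply (v : Plane) : perp v 1 = v 0 := by simp [perp]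

theorem inner_perp (v w : Plane) : inner ℝ (perp v) w = pcross v w := by
  simp only [plane_inner, pcross, perp_zero_apply, perp_one_apply]; ring

theorem pcross_perp_self (v : Plane) : pcross v (perp v) = ‖v‖ ^ 2 := by
  simp only [plane_norm_sq, pcross, perp_zero_apply, perp_one_apply]; ring

theorem pcross_sub_right (u v w : Plane) : pcross u (v - w) = pcross u v - pcross u w := by
  simp [pcross]; ring

theorem pcross_smul_right (t : ℝ) (v w : Plane) : pcross v (t • w) = t * pcross v w := by
  simp [pcross]; ring

theorem pcross_self (v : Plane) : pcross v v = 0 := by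
  simp [pcross]; ring

theorem pcross_sq_add_inner_sq (v w : Plane) :
    pcross v w ^ 2 + inner ℝ v w ^ 2 = ‖v‖ ^ 2 * ‖w‖ ^ 2 := by
  rw [plane_norm_sq, plane_norm_sq, plane_inner, pcross]; ring

theorem abs_pcross_le (v w : Plane) : |pcross v w| ≤ ‖v‖ * ‖w‖ := by
  apply abs_le_of_sq_le_sq _ (by positivity)
  nlinarith [pcross_sq_add_inner_sq v w, sq_nonneg (inner ℝ v w)]

/-- Cramer's rule. -/
theorem pcross_smul_eq (u v w : Plane) :
    pcross u v • w = pcross w v • u + pcross u w • v := by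
  apply plane_ext <;> simp [pcross] <;> ring

theorem volume_line_eq_zero {n : Plane} (hn : n ≠ 0) (c : ℝ) :
    volume {y : Plane | inner ℝ n y = c} = 0 := by
  by_cases h : ∃ p : Plane, inner ℝ n p = c
  · obtain ⟨p, hp⟩ := h
    have hs : {y : Plane | inner ℝ n y = c}
        = (AffineSubspace.mk' p (LinearMap.ker (innerₛₗ ℝ n)) : Set Plane) := by
      ext y
      simp [AffineSubspace.mem_mk', inner_sub_right, hp, sub_eq_zero]
    rw [hs]
    apply Measure.addHaar_affineSubspace
    intro htop
    have : p + n ∈ (AffineSubspace.mk' p (LinearMap.ker (innerₛₗ ℝ n)) : Set Plane) := by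
      rw [htop]; trivial
    rw [← hs] at this
    simp only [mem_ofPred_eq, inner_add_right, hp] at this
    exact hn (inner_self_eq_zero (𝕜 := ℝ).1 (by linarith))
  · have hs : {y : Plane | inner ℝ n y = c} = ∅ := by
      ext y
      simp only [mem_ofPred_eq, mem_empty_iff_false, iff_false]
      exact fun hy => h ⟨y, hy⟩
    rw [hs, measure_empty]

theorem perp_ne_zero {v : Plane} (hv : v ≠ 0) : perp v ≠ 0 := by
  intro h
  apply hv
  have h0 := congrArg (fun z : Plane => z 0) h
  have h1 := congrArg (fun z : Plane => z 1) h
  simp at h0 h1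
  exact plane_ext (by simpa using h1) (by simpa using h0)

theorem volume_pcross_eq_zero {w : Plane} (hw : w ≠ 0) (x : Plane) :
    volume {y : Plane | pcross w (y - x) = 0} = 0 := by
  convert volume_line_eq_zero (perp_ne_zero hw) (pcross w x) using 3
  ext y
  rw [inner_perp, pcross_sub_right, sub_eq_zero]

/-- Every segment lies on a line; a degenerate one is put on a line too. -/
theorem exists_line_of_segment (p q : Plane) :
    ∃ n : Plane, n ≠ 0 ∧ ∀ z ∈ segment ℝ p q, inner ℝ n z = inner ℝ n p := by
  by_cases h : q - p = 0
  · have : q = p := sub_eq_zero.1 h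
    subst this
    refine ⟨!₂[1, 0], ?_, ?_⟩
    · intro h0
      simpa using congrArg (fun z : Plane => z 0) h0
    · intro z hz
      rw [segment_same] at hz
      rw [mem_singleton_iff.1 hz]
  · refine ⟨perp (q - p), perp_ne_zero h, ?_⟩
    intro z hz
    rw [segment_eq_image'] at hz
    obtain ⟨t, -, rfl⟩ := hz
    rw [inner_add_right, inner_smul_right, inner_perp (q - p) (q - p), pcross_self]
    ring

theorem volume_segment_eq_zero (p q : Plane) : volume (segment ℝ p q) = 0 := by
  obtain ⟨n, hn, h⟩ := exists_line_of_segment p q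
  exact measure_mono_null h (volume_line_eq_zero hn _)

/-- The linear map sending the canonical basis to `v, w`. -/
def frame (v w : Plane) : Plane →ₗ[ℝ] Plane where
  toFun z := z 0 • v + z 1 • w
  map_add' a b := by simp [add_smul]; abel
  map_smul' a b := by simp [mul_smul]

theorem frame_apply (v w z : Plane) : frame v w z = z 0 • v + z 1 • w := rfl

theorem det_frame (v w : Plane) : LinearMap.det (frame v w) = pcross v w := by
  rw [← LinearMap.det_toMatrix (EuclideanSpace.basisFun (Fin 2) ℝ).toBasis]
  rw [Matrix.det_fin_two]
  simp [LinearMap.toMatrix_apply, frame_apply, pcross]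
  ring

theorem volume_box (a b c d : ℝ) :
    volume {z : Plane | z 0 ∈ Icc a b ∧ z 1 ∈ Icc c d}
      = ENNReal.ofReal (b - a) * ENNReal.ofReal (d - c) := by
  have h := (PiLp.volume_preserving_ofLp (Fin 2)).measure_preimage
    (s := Icc ![a, c] ![b, d]) measurableSet_Icc.nullMeasurableSet
  rw [Real.volume_Icc_pi] at h
  simp only [Fin.prod_univ_two] at h
  have hs : {z : Plane | z 0 ∈ Icc a b ∧ z 1 ∈ Icc c d}
      = WithLp.ofLp ⁻¹' (Icc ![a, c] ![b, d] : Set (Fin 2 → ℝ)) := by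
    ext z
    simp [Pi.le_def, Fin.forall_fin_two]
    tauto
  rw [hs, h]; simp

theorem volume_frame_box (v w x : Plane) (a b c d : ℝ) :
    volume ((fun z => x + frame v w z) '' {z : Plane | z 0 ∈ Icc a b ∧ z 1 ∈ Icc c d})
      = ENNReal.ofReal |pcross v w| * (ENNReal.ofReal (b - a) * ENNReal.ofReal (d - c)) := by
  have : (fun z => x + frame v w z) '' {z : Plane | z 0 ∈ Icc a b ∧ z 1 ∈ Icc c d}
      = (fun y => x + y) '' (frame v w '' {z : Plane | z 0 ∈ Icc a b ∧ z 1 ∈ Icc c d}) := by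
    rw [image_image]
  rw [this, image_add_left, measure_preimage_add, Measure.addHaar_image_linearMap, det_frame,
    volume_box]

/-- A truncated strip around the line through `x` with direction `w` lies in a rectangle with axes
`w` and `perp w`. -/
theorem volume_strip_le {w : Plane} (hw : w ≠ 0) (x : Plane) {a b : ℝ} (ha : 0 ≤ a) :
    volume {y : Plane | ‖y - x‖ ≤ a ∧ |pcross w (y - x)| ≤ b}
      ≤ ENNReal.ofReal (4 * a * b / ‖w‖) := by
  have hw' : 0 < ‖w‖ := norm_pos_iff.2 hw
  have hsub : {y : Plane | ‖y - x‖ ≤ a ∧ |pcross w (y - x)| ≤ b} ⊆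
      (fun z => x + frame w (perp w) z) '' {z : Plane |
        z 0 ∈ Icc (-(a / ‖w‖)) (a / ‖w‖) ∧ z 1 ∈ Icc (-(b / ‖w‖ ^ 2)) (b / ‖w‖ ^ 2)} := by
    rintro y ⟨h1, h2⟩
    refine ⟨!₂[inner ℝ w (y - x) / ‖w‖ ^ 2, pcross w (y - x) / ‖w‖ ^ 2], ⟨?_, ?_⟩, ?_⟩
    · have : |inner ℝ w (y - x)| ≤ ‖w‖ * a :=
        (abs_real_inner_le_norm _ _).trans (by gcongr)
      rw [mem_Icc, ← abs_le]
      simp only [Matrix.cons_val_zero, abs_div, abs_pow, abs_norm]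
      rw [div_le_div_iff₀ (by positivity) hw']
      nlinarith
    · rw [mem_Icc, ← abs_le]
      simp only [Matrix.cons_val_one, abs_div, abs_pow, abs_norm,
        Matrix.cons_val_fin_one]
      gcongr
    · have h3 : ‖w‖ ^ 2 ≠ 0 := by positivity
      have h4 := plane_norm_sq w
      simp only [frame_apply]
      apply plane_ext <;> simp only [PiLp.add_apply, PiLp.smul_apply, smul_eq_mul,
        Matrix.cons_val_zero, Matrix.cons_val_one, plane_inner, pcross, PiLp.sub_apply,
        perp_zero_apply, perp_one_apply] <;> field_simp <;> rw [h4] <;> ring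
  refine (measure_mono hsub).trans ?_
  rw [volume_frame_box, pcross_perp_self, ← ENNReal.ofReal_mul (by simp; positivity),
    ← ENNReal.ofReal_mul (by positivity), abs_of_nonneg (by positivity)]
  apply le_of_eq
  congr 1
  field_simp
  ring

/-- The convex hull of two segments contains the parallelogram on the midpoints of the sides, hence
its area is at least a quarter of the cross product of the segments. -/
theorem pcross_le_volume_of_convex {D : Set Plane} (hD : Convex ℝ D) (hfin : volume D ≠ ⊤)
    {k l a b : Plane} (hk : k ∈ D) (hl : l ∈ D) (ha : a ∈ D) (hb : b ∈ D) :
    |pcross (l - k) (b - a)| ≤ 4 * volume.real D := by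
  have hsub : (fun z => midpoint ℝ k a + frame (l - k) (b - a) z) ''
      {z : Plane | z 0 ∈ Icc 0 (1 / 2) ∧ z 1 ∈ Icc 0 (1 / 2)} ⊆ D := by
    rintro _ ⟨z, ⟨⟨h0, h0'⟩, h1, h1'⟩, rfl⟩
    have hx : (1 - 2 * z 0) • k + (2 * z 0) • l ∈ D :=
      hD hk hl (by linarith) (by linarith) (by ring)
    have hy : (1 - 2 * z 1) • a + (2 * z 1) • b ∈ D :=
      hD ha hb (by linarith) (by linarith) (by ring)
    have := hD hx hy (a := 1 / 2) (b := 1 / 2) (by norm_num) (by norm_num) (by norm_num)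
    convert this using 1
    rw [midpoint_eq_smul_add]
    apply plane_ext <;> simp [frame_apply] <;> ring
  have h := measure_mono (μ := volume) hsub
  rw [volume_frame_box, ← ENNReal.ofReal_mul (by norm_num),
    ← ENNReal.ofReal_mul (by positivity)] at h
  have := (ENNReal.ofReal_le_iff_le_toReal hfin).1 h
  rw [← measureReal_def] at this
  linarith

/-! ### Functions with controlled jumps and their Riesz potential -/

/-- The truncated Riesz kernel `1 / max d |x - c|` attached to a set of size `d` around `c`. -/
def riesz (c : Plane) (d : ℝ) (x : Plane) : ℝ := (max d (dist x c))⁻¹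

/-- The cube root of the truncated Riesz kernel. -/
def rieszRoot (c : Plane) (d : ℝ) (x : Plane) : ℝ := riesz c d x ^ (1 / 3 : ℝ)

theorem riesz_pos {d : ℝ} (hd : 0 < d) (c x : Plane) : 0 < riesz c d x :=
  inv_pos.2 (lt_max_of_lt_left hd)

theorem continuous_riesz {d : ℝ} (hd : 0 < d) (c : Plane) : Continuous (riesz c d) := by
  unfold riesz
  exact Continuous.inv₀ (by fun_prop) fun x => (lt_max_of_lt_left hd).ne'

theorem rieszRoot_nonneg {d : ℝ} (hd : 0 < d) (c x : Plane) : 0 ≤ rieszRoot c d x :=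
  Real.rpow_nonneg (riesz_pos hd c x).le _

theorem continuous_rieszRoot {d : ℝ} (hd : 0 < d) (c : Plane) : Continuous (rieszRoot c d) :=
  (continuous_riesz hd c).rpow_const fun x => Or.inl (riesz_pos hd c x).ne'

theorem rieszRoot_pow_three {d : ℝ} (hd : 0 < d) (c x : Plane) :
    rieszRoot c d x ^ 3 = riesz c d x := by
  rw [rieszRoot, ← Real.rpow_natCast, ← Real.rpow_mul (riesz_pos hd c x).le]
  norm_num

theorem rieszRoot_pow_four {d : ℝ} (hd : 0 < d) (c x : Plane) :
    rieszRoot c d x ^ 4 = (max d (dist x c)) ^ (-(4 / 3) : ℝ) := by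
  have h : 0 ≤ max d (dist x c) := le_max_of_le_left hd.le
  rw [rieszRoot, ← Real.rpow_natCast, ← Real.rpow_mul (riesz_pos hd c x).le, riesz,
    Real.inv_rpow h, ← Real.rpow_neg h]
  norm_num

theorem integrableOn_norm_rpow (R : ℝ) :
    IntegrableOn (fun z : Plane => ‖z‖ ^ (-(4 / 3) : ℝ)) (Metric.ball 0 R) := by
  have h := integrableOn_fun_norm_addHaar (volume : Measure Plane)
    (f := fun t : ℝ => t ^ (-(4 / 3) : ℝ)) (r := R)
  rw [h]
  rcases le_or_gt R 0 with hR | hR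
  · rw [Ioo_eq_empty (not_lt.2 hR)]; exact integrableOn_empty
  · have h2 := (intervalIntegral.integrableOn_Ioo_rpow_iff (s := (-(1 / 3) : ℝ)) hR).2 (by norm_num)
    refine h2.congr_fun (fun t ht => ?_) measurableSet_Ioo
    have hf : Module.finrank ℝ Plane - 1 = 1 := by simp
    simp only [hf, pow_one, smul_eq_mul]
    nth_rewrite 2 [← Real.rpow_one t]
    rw [← Real.rpow_add ht.1]
    norm_num

theorem integrableOn_dist_rpow (c : Plane) (R : ℝ) :
    IntegrableOn (fun x : Plane => dist x c ^ (-(4 / 3) : ℝ)) (Metric.ball c R) ∧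
      ∫ x in Metric.ball c R, dist x c ^ (-(4 / 3) : ℝ)
        = ∫ z in Metric.ball (0 : Plane) R, ‖z‖ ^ (-(4 / 3) : ℝ) := by
  have hpre : (fun x : Plane => x - c) ⁻¹' Metric.ball 0 R = Metric.ball c R := by
    ext x; simp [dist_eq_norm]
  have hmp := measurePreserving_sub_right (volume : Measure Plane) c
  have hemb : MeasurableEmbedding (fun x : Plane => x - c) :=
    (MeasurableEquiv.subRight c).measurableEmbedding
  constructor
  · have := (hmp.integrableOn_comp_preimage hemb).2 (integrableOn_norm_rpow R)
    rw [hpre] at this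
    refine this.congr_fun (fun x _ => ?_) measurableSet_ball
    simp [dist_eq_norm]
  · have := hmp.setIntegral_preimage_emb hemb (fun z => ‖z‖ ^ (-(4 / 3) : ℝ)) (Metric.ball 0 R)
    rw [← this, hpre]
    simp [dist_eq_norm]

/-- A bounded measurable function `f` on `Ω`, together with finitely many sets `D e`, comparable
with the balls `B(c e, d e)`, which carry the jumps of `f`: along almost every segment contained in
`Ω`, the variation of `f` is at most the sum of the `jump e` over the sets `D e` that the segment
meets. -/
structure JumpSystem (Ω : Set Plane) (κ : ℝ) where
  ι : Type
  [fintype : Fintype ι]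
  D : ι → Set Plane
  c : ι → Plane
  d : ι → ℝ
  d_pos : ∀ e, 0 < d e
  c_mem : ∀ e, c e ∈ closure Ω
  subset_ball : ∀ e, D e ⊆ Metric.closedBall (c e) (d e)
  subset_closure : ∀ e, D e ⊆ closure Ω
  measurableSet : ∀ e, MeasurableSet (D e)
  aedisjoint : Pairwise fun e e' => AEDisjoint volume (D e) (D e')
  area : ∀ e, d e ^ 2 ≤ κ * volume.real (D e)
  f : Plane → ℝ
  measurable : Measurable f
  bounded : ∃ B, ∀ x, |f x| ≤ B
  jump : ι → ℝ
  jump_nonneg : ∀ e, 0 ≤ jump e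
  jump_bound : ∀ᵐ x ∂(volume.restrict Ω), ∀ᵐ y ∂(volume.restrict Ω), segment ℝ x y ⊆ Ω →
    |f x - f y| ≤ ∑ e, {z : Plane | (segment ℝ x z ∩ D e).Nonempty}.indicator (fun _ => jump e) y

attribute [instance] JumpSystem.fintype

namespace JumpSystem

variable {Ω : Set Plane} {κ : ℝ} (J : JumpSystem Ω κ)

/-- The energy, sum of the squares of the jumps. -/
def energy : ℝ := ∑ e, J.jump e ^ 2

/-- The Riesz potential of the jumps. -/
def potential (x : Plane) : ℝ := ∑ e, J.jump e * J.d e * riesz (J.c e) (J.d e) x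

/-- The part of `Ω` seen from `x` through `D e`. -/
def shadow (x : Plane) (e : J.ι) : Set Plane := {y ∈ Ω | (segment ℝ x y ∩ J.D e).Nonempty}

theorem energy_nonneg : 0 ≤ J.energy := Finset.sum_nonneg fun _ _ => sq_nonneg _

theorem potential_nonneg (x : Plane) : 0 ≤ J.potential x :=
  Finset.sum_nonneg fun e _ => mul_nonneg (mul_nonneg (J.jump_nonneg e) (J.d_pos e).le)
    (riesz_pos (J.d_pos e) _ _).le

theorem continuous_potential : Continuous J.potential := by
  unfold potential
  exact continuous_finsetSum _ fun e _ => (continuous_riesz (J.d_pos e) _).const_mul _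

theorem integrableOn_f (hΩ : Bornology.IsBounded Ω) : IntegrableOn J.f Ω := by
  obtain ⟨B, hB⟩ := J.bounded
  exact Measure.integrableOn_of_bounded (M := B) hΩ.measure_lt_top.ne
    J.measurable.aestronglyMeasurable (Filter.Eventually.of_forall hB)

end JumpSystem

theorem Continuous.integrableOn_of_isBounded {g : Plane → ℝ} (hg : Continuous g)
    {s : Set Plane} (hs : Bornology.IsBounded s) : IntegrableOn g s :=
  (hg.continuousOn.integrableOn_compact hs.isCompact_closure).mono_set subset_closure

theorem exists_dist_bound {Ω : Set Plane} (hΩ : Bornology.IsBounded Ω) :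
    ∃ R : ℝ, 0 < R ∧ ∀ x ∈ closure Ω, ∀ y ∈ closure Ω, dist x y < R := by
  obtain ⟨C, hC⟩ := Metric.isBounded_iff.1 hΩ.closure
  exact ⟨|C| + 1, by positivity, fun x hx y hy =>
    (hC hx hy).trans_lt (lt_of_le_of_lt (le_abs_self C) (lt_add_one _))⟩

/-- The shadow of `D e` seen from `x` lies in a strip of width comparable with `d e / |x - c e|`. -/
theorem exists_shadow_bound {Ω : Set Plane} (hΩ : Bornology.IsBounded Ω) (κ : ℝ) :
    ∃ A : ℝ, 0 < A ∧ ∀ J : JumpSystem Ω κ, ∀ x ∈ Ω, ∀ e,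
      volume (J.shadow x e) ≤ ENNReal.ofReal (A * (J.d e * riesz (J.c e) (J.d e) x)) := by
  obtain ⟨R, hR, hdist⟩ := exists_dist_bound hΩ
  refine ⟨2 * volume.real Ω + 8 * R ^ 2, by positivity, fun J x hx e => ?_⟩
  set c := J.c e
  set d := J.d e
  have hd : 0 < d := J.d_pos e
  rcases le_or_gt (dist x c) (2 * d) with h | h
  · have h1 : volume (J.shadow x e) ≤ ENNReal.ofReal (volume.real Ω) := by
      rw [ofReal_measureReal hΩ.measure_lt_top.ne]
      exact measure_mono fun y hy => hy.1
    refine h1.trans (ENNReal.ofReal_le_ofReal ?_)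
    have h2 : 1 / 2 ≤ d * riesz c d x := by
      rw [riesz, ← div_eq_mul_inv, div_le_div_iff₀ (by norm_num) (lt_max_of_lt_left hd)]
      have : max d (dist x c) ≤ 2 * d := max_le (by linarith) h
      linarith
    have h3 : 0 ≤ volume.real Ω := measureReal_nonneg
    nlinarith [sq_nonneg R]
  · have hcx : 0 < ‖c - x‖ := by
      rw [← dist_eq_norm, dist_comm]; linarith
    have hw : c - x ≠ 0 := norm_pos_iff.1 hcx
    have hsub : J.shadow x e ⊆ {y | ‖y - x‖ ≤ R ∧ |pcross (c - x) (y - x)| ≤ 2 * R * d} := by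
      rintro y ⟨hy, z, hz, hzD⟩
      have hyx : ‖y - x‖ ≤ R := by
        rw [← dist_eq_norm]; exact (hdist y (subset_closure hy) x (subset_closure hx)).le
      refine ⟨hyx, ?_⟩
      rw [segment_eq_image'] at hz
      obtain ⟨t, ⟨ht0, ht1⟩, rfl⟩ := hz
      have hzc : ‖t • (y - x) - (c - x)‖ ≤ d := by
        have := J.subset_ball e hzD
        rw [Metric.mem_closedBall, dist_eq_norm] at this
        rwa [show t • (y - x) - (c - x) = x + t • (y - x) - c by abel]
      have hxc : dist x c = ‖c - x‖ := by rw [dist_comm, dist_eq_norm]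
      rw [hxc] at h
      -- the hit point is at distance at least `|x - c| / 2` from `x`
      have ht : ‖c - x‖ / 2 ≤ t * R := by
        have h1 : ‖c - x‖ ≤ ‖t • (y - x)‖ + d := by
          calc ‖c - x‖ = ‖t • (y - x) - (t • (y - x) - (c - x))‖ := by congr 1; abel
            _ ≤ _ := (norm_sub_le _ _).trans (by gcongr)
        rw [norm_smul, Real.norm_of_nonneg ht0] at h1
        nlinarith
      have hcr : t * |pcross (c - x) (y - x)| ≤ ‖c - x‖ * d := by
        have h1 : t * pcross (c - x) (y - x) = pcross (c - x) (t • (y - x) - (c - x)) := by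
          rw [pcross_sub_right _ (t • (y - x)), pcross_smul_right, pcross_self, sub_zero]
        rw [show t * |pcross (c - x) (y - x)| = |t * pcross (c - x) (y - x)| by
          rw [abs_mul, abs_of_nonneg ht0], h1]
        exact (abs_pcross_le _ _).trans (by gcongr)
      have h5 : ‖c - x‖ / 2 * |pcross (c - x) (y - x)| ≤ R * (‖c - x‖ * d) :=
        calc ‖c - x‖ / 2 * |pcross (c - x) (y - x)|
            ≤ t * R * |pcross (c - x) (y - x)| := by gcongr
          _ = R * (t * |pcross (c - x) (y - x)|) := by ring
          _ ≤ _ := by gcongr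
      by_contra hlt
      push Not at hlt
      nlinarith
    refine (measure_mono hsub).trans ((volume_strip_le hw x hR.le).trans
      (ENNReal.ofReal_le_ofReal ?_))
    have : riesz c d x = ‖c - x‖⁻¹ := by
      rw [riesz, dist_comm x c, dist_eq_norm, max_eq_right]
      rw [dist_comm, dist_eq_norm] at h; linarith
    rw [this]
    have h3 : 0 ≤ volume.real Ω := measureReal_nonneg
    have : 4 * R * (2 * R * d) / ‖c - x‖ = 8 * R ^ 2 * (d * ‖c - x‖⁻¹) := by
      field_simp; ring
    rw [this]
    gcongr
    linarith

/-- The Riesz potential of the jumps is bounded in `L¹` and in `L⁴` by the energy: this is the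
embedding `H¹ ⊂ L⁴` in dimension two, proved with the Cauchy-Schwarz inequality and the
integrability of `|z|^(-4/3)` near the origin. -/
theorem exists_potential_bound {Ω : Set Plane} (hΩ : Bornology.IsBounded Ω)
    (hm : MeasurableSet Ω) {κ : ℝ} (hκ : 0 < κ) :
    ∃ A : ℝ, 0 < A ∧ ∀ J : JumpSystem Ω κ,
      ∫ x in Ω, J.potential x ≤ A * √J.energy ∧
      ∫ x in Ω, J.potential x ^ 4 ≤ A * J.energy ^ 2 := by
  obtain ⟨R, hR, hdist⟩ := exists_dist_bound hΩ
  set K := ∫ z in Metric.ball (0 : Plane) R, ‖z‖ ^ (-(4 / 3) : ℝ) with hK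
  have hK0 : 0 ≤ K := setIntegral_nonneg measurableSet_ball fun z _ => by positivity
  set V := volume.real (closure Ω)
  have hV0 : 0 ≤ V := measureReal_nonneg
  have hVfin : volume (closure Ω) ≠ ⊤ := hΩ.closure.measure_lt_top.ne
  refine ⟨(volume.real Ω + K) * √(κ * V) + 16 * κ ^ 2 * K ^ 3 + 1, by positivity, fun J => ?_⟩
  set E := J.energy with hE
  have hE0 : 0 ≤ E := J.energy_nonneg
  set η : J.ι → Plane → ℝ := fun e => rieszRoot (J.c e) (J.d e) with hη
  have hη0 : ∀ e x, 0 ≤ η e x := fun e x => rieszRoot_nonneg (J.d_pos e) _ _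
  have hηc : ∀ e, Continuous (η e) := fun e => continuous_rieszRoot (J.d_pos e) _
  have hpot : ∀ x, J.potential x = ∑ e, J.jump e * J.d e * η e x ^ 3 := fun x => by
    simp only [JumpSystem.potential, hη, rieszRoot_pow_three (J.d_pos _)]
  -- the integral of the kernel with respect to `x`
  have hint4 : ∀ e, ∫ x in Ω, η e x ^ 4 ≤ K := fun e => by
    obtain ⟨h1, h2⟩ := integrableOn_dist_rpow (J.c e) R
    have hsub : Ω ⊆ Metric.ball (J.c e) R := fun x hx =>
      hdist x (subset_closure hx) _ (J.c_mem e)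
    calc ∫ x in Ω, η e x ^ 4 ≤ ∫ x in Ω, dist x (J.c e) ^ (-(4 / 3) : ℝ) := by
          refine setIntegral_mono_ae (((hηc e).pow 4).integrableOn_of_isBounded hΩ)
            (h1.mono_set hsub) ?_
          have : ∀ᵐ x : Plane, x ≠ J.c e := by
            simp [ae_iff]
          filter_upwards [this] with x hx
          have hx' : 0 < dist x (J.c e) := dist_pos.2 hx
          simp only [hη, rieszRoot_pow_four (J.d_pos e)]
          exact Real.rpow_le_rpow_of_nonpos hx' (le_max_right _ _) (by norm_num)
      _ ≤ ∫ x in Metric.ball (J.c e) R, dist x (J.c e) ^ (-(4 / 3) : ℝ) :=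
          setIntegral_mono_set h1 (Filter.Eventually.of_forall fun x => by positivity)
            hsub.eventuallyLE
      _ = K := h2
  have hDfin : ∀ e, volume (J.D e) ≠ ⊤ := fun e =>
    ne_top_of_le_ne_top hVfin (measure_mono (J.subset_closure e))
  have hUnion : (⋃ e, J.D e) ⊆ closure Ω := iUnion_subset J.subset_closure
  -- the integral of the kernel with respect to the measure on the sets `D e`
  have hsum4 : ∀ x ∈ Ω, ∑ e, J.d e ^ 2 * η e x ^ 4 ≤ 4 * κ * K := fun x hx => by
    obtain ⟨h1, h2⟩ := integrableOn_dist_rpow x R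
    have hsub : closure Ω ⊆ Metric.ball x R := fun y hy => hdist y hy x (subset_closure hx)
    have hstep : ∀ e, J.d e ^ 2 * η e x ^ 4
        ≤ 4 * κ * ∫ y in J.D e, dist y x ^ (-(4 / 3) : ℝ) := fun e => by
      have hlow : volume.real (J.D e) * η e x ^ 4
          ≤ 4 * ∫ y in J.D e, dist y x ^ (-(4 / 3) : ℝ) := by
        rw [← integral_const_mul, ← smul_eq_mul, ← setIntegral_const]
        refine setIntegral_mono_on_ae (integrableOn_const (hDfin e))
          ((h1.mono_set ((J.subset_closure e).trans hsub)).const_mul _) (J.measurableSet e) ?_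
        have : ∀ᵐ y : Plane, y ≠ x := by simp [ae_iff]
        filter_upwards [this] with y hy hyD
        have hy' : 0 < dist y x := dist_pos.2 hy
        have hle : dist y x / 2 ≤ max (J.d e) (dist x (J.c e)) := by
          have h3 := J.subset_ball e hyD
          rw [Metric.mem_closedBall] at h3
          have h4 := dist_triangle y (J.c e) x
          rw [dist_comm (J.c e) x] at h4
          have h5 := le_max_left (J.d e) (dist x (J.c e))
          have h6 := le_max_right (J.d e) (dist x (J.c e))
          linarith
        simp only [hη, rieszRoot_pow_four (J.d_pos e)]
        calc (max (J.d e) (dist x (J.c e))) ^ (-(4 / 3) : ℝ)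
            ≤ (dist y x / 2) ^ (-(4 / 3) : ℝ) :=
              Real.rpow_le_rpow_of_nonpos (by positivity) hle (by norm_num)
          _ = 2 ^ (4 / 3 : ℝ) * dist y x ^ (-(4 / 3) : ℝ) := by
              rw [Real.div_rpow hy'.le (by norm_num), Real.rpow_neg (by norm_num : (0 : ℝ) ≤ 2)]
              field_simp
          _ ≤ 4 * dist y x ^ (-(4 / 3) : ℝ) := by
              gcongr
              calc (2 : ℝ) ^ (4 / 3 : ℝ) ≤ 2 ^ (2 : ℝ) :=
                    Real.rpow_le_rpow_of_exponent_le (by norm_num) (by norm_num)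
                _ = 4 := by norm_num
      have h0 := hη0 e x
      calc J.d e ^ 2 * η e x ^ 4 ≤ κ * volume.real (J.D e) * η e x ^ 4 := by
            gcongr; exact J.area e
        _ = κ * (volume.real (J.D e) * η e x ^ 4) := by ring
        _ ≤ κ * (4 * ∫ y in J.D e, dist y x ^ (-(4 / 3) : ℝ)) := by gcongr
        _ = _ := by ring
    refine (Finset.sum_le_sum fun e _ => hstep e).trans ?_
    rw [← Finset.mul_sum]
    gcongr
    have hU := integral_iUnion_ae (μ := volume) (f := fun y => dist y x ^ (-(4 / 3) : ℝ))
      (fun e => (J.measurableSet e).nullMeasurableSet) J.aedisjoint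
      (h1.mono_set (hUnion.trans hsub))
    rw [tsum_fintype] at hU
    rw [← hU, hK, ← h2]
    exact setIntegral_mono_set h1 (Filter.Eventually.of_forall fun x => by positivity)
      (hUnion.trans hsub).eventuallyLE
  have hd2 : ∑ e, J.d e ^ 2 ≤ κ * V := by
    refine (Finset.sum_le_sum fun e _ => J.area e).trans ?_
    rw [← Finset.mul_sum]
    gcongr
    have := measure_iUnion₀ (μ := volume) J.aedisjoint
      fun e => (J.measurableSet e).nullMeasurableSet
    have h2 : ∑ e, volume (J.D e) ≤ volume (closure Ω) := by
      rw [tsum_fintype] at this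
      rw [← this]; exact measure_mono hUnion
    simp only [measureReal_def, V]
    rw [← ENNReal.toReal_sum fun e _ => hDfin e]
    exact ENNReal.toReal_mono hVfin h2
  have hint3 : ∀ e, ∫ x in Ω, η e x ^ 3 ≤ volume.real Ω + K := fun e => by
    have h1 : IntegrableOn (fun _ : Plane => (1 : ℝ)) Ω :=
      integrableOn_const hΩ.measure_lt_top.ne
    have h2 : IntegrableOn (fun x => η e x ^ 4) Ω :=
      ((hηc e).pow 4).integrableOn_of_isBounded hΩ
    calc ∫ x in Ω, η e x ^ 3 ≤ ∫ x in Ω, (1 + η e x ^ 4) := by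
          refine setIntegral_mono (((hηc e).pow 3).integrableOn_of_isBounded hΩ)
            (h1.add h2) fun x => ?_
          change η e x ^ 3 ≤ 1 + η e x ^ 4
          nlinarith [sq_nonneg (η e x ^ 2 - η e x), sq_nonneg (η e x - 1), sq_nonneg (η e x ^ 2 - 1)]
      _ = volume.real Ω + ∫ x in Ω, η e x ^ 4 := by
          rw [integral_add h1 h2, setIntegral_const]; simp
      _ ≤ _ := by gcongr; exact hint4 e
  constructor
  · have h1 : ∫ x in Ω, J.potential x = ∑ e, J.jump e * J.d e * ∫ x in Ω, η e x ^ 3 := by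
      simp only [hpot]
      rw [integral_finsetSum]
      · simp only [integral_const_mul]
      · intro e _
        exact (((hηc e).pow 3).integrableOn_of_isBounded hΩ).const_mul _
    rw [h1]
    have h2 : ∑ e, J.jump e * J.d e ≤ √E * √(κ * V) := by
      rw [← Real.sqrt_mul hE0]
      apply Real.le_sqrt_of_sq_le
      refine (Finset.sum_mul_sq_le_sq_mul_sq _ _ _).trans ?_
      gcongr
      exact le_of_eq hE.symm
    calc ∑ e, J.jump e * J.d e * ∫ x in Ω, η e x ^ 3
        ≤ ∑ e, J.jump e * J.d e * (volume.real Ω + K) := by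
          gcongr with e
          · exact mul_nonneg (J.jump_nonneg e) (J.d_pos e).le
          · exact hint3 e
      _ = (∑ e, J.jump e * J.d e) * (volume.real Ω + K) := by rw [Finset.sum_mul]
      _ ≤ √E * √(κ * V) * (volume.real Ω + K) := by
          gcongr
      _ = (volume.real Ω + K) * √(κ * V) * √E := by ring
      _ ≤ _ := by
          gcongr
          have : 0 ≤ 16 * κ ^ 2 * K ^ 3 := by positivity
          linarith
  · have hpt : ∀ x ∈ Ω, J.potential x ^ 4
        ≤ E * (4 * κ * K) ^ 2 * ∑ e, J.jump e ^ 2 * η e x ^ 4 := fun x hx => by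
      have h1 : J.potential x ^ 2
          ≤ (∑ e, J.jump e ^ 2 * η e x ^ 2) * ∑ e, J.d e ^ 2 * η e x ^ 4 := by
        have := Finset.sum_mul_sq_le_sq_mul_sq Finset.univ (fun e => J.jump e * η e x)
          fun e => J.d e * η e x ^ 2
        simp only [mul_pow, ← pow_mul] at this
        norm_num at this
        refine (le_of_eq ?_).trans this
        rw [hpot]
        congr 1
        exact Finset.sum_congr rfl fun e _ => by ring
      have h2 : (∑ e, J.jump e ^ 2 * η e x ^ 2) ^ 2
          ≤ E * ∑ e, J.jump e ^ 2 * η e x ^ 4 := by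
        have := Finset.sum_mul_sq_le_sq_mul_sq Finset.univ (fun e => J.jump e)
          fun e => J.jump e * η e x ^ 2
        simp only [mul_pow, ← pow_mul] at this
        norm_num at this
        refine (le_of_eq ?_).trans this
        congr 1
        exact Finset.sum_congr rfl fun e _ => by ring
      have h3 := hsum4 x hx
      have h4 : 0 ≤ ∑ e, J.d e ^ 2 * η e x ^ 4 := Finset.sum_nonneg fun e _ => by positivity
      calc J.potential x ^ 4 = (J.potential x ^ 2) ^ 2 := by ring
        _ ≤ ((∑ e, J.jump e ^ 2 * η e x ^ 2) * ∑ e, J.d e ^ 2 * η e x ^ 4) ^ 2 := by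
            gcongr
        _ = (∑ e, J.jump e ^ 2 * η e x ^ 2) ^ 2 * (∑ e, J.d e ^ 2 * η e x ^ 4) ^ 2 := by ring
        _ ≤ (E * ∑ e, J.jump e ^ 2 * η e x ^ 4) * (4 * κ * K) ^ 2 := by
            gcongr
        _ = _ := by ring
    have hI : ∀ e, IntegrableOn (fun x => J.jump e ^ 2 * η e x ^ 4) Ω := fun e =>
      (((hηc e).pow 4).integrableOn_of_isBounded hΩ).const_mul _
    calc ∫ x in Ω, J.potential x ^ 4
        ≤ ∫ x in Ω, E * (4 * κ * K) ^ 2 * ∑ e, J.jump e ^ 2 * η e x ^ 4 :=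
          setIntegral_mono_on ((J.continuous_potential.pow 4).integrableOn_of_isBounded hΩ)
            ((integrable_finsetSum _ fun e _ => hI e).const_mul _) hm hpt
      _ = E * (4 * κ * K) ^ 2 * ∑ e, J.jump e ^ 2 * ∫ x in Ω, η e x ^ 4 := by
          rw [integral_const_mul, integral_finsetSum _ fun e _ => hI e]
          simp only [integral_const_mul]
      _ ≤ E * (4 * κ * K) ^ 2 * ∑ e, J.jump e ^ 2 * K := by
          gcongr with e; exact hint4 e
      _ = 16 * κ ^ 2 * K ^ 3 * E ^ 2 := by
          rw [← Finset.sum_mul]; change _ * (E * K) = _; ring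
      _ ≤ _ := by
          gcongr
          have : 0 ≤ (volume.real Ω + K) * √(κ * V) := by positivity
          linarith

/-! ### From the Riesz potential to an entropy bound on a polygonal domain -/

/-- Averaging the jump condition over the end point of the segment. -/
theorem exists_average_jump_bound {Ω : Set Plane} (hΩ : Bornology.IsBounded Ω) (κ : ℝ) :
    ∃ A : ℝ, 0 < A ∧ ∀ J : JumpSystem Ω κ, ∀ C W : Set Plane, IsOpen C → Convex ℝ C → C ⊆ Ω →
      MeasurableSet W → W ⊆ C → ∀ᵐ x ∂(volume.restrict C), ∃ g : Plane → ℝ,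
        IntegrableOn g W ∧ (∀ᵐ y ∂(volume.restrict W), |J.f x - J.f y| ≤ g y) ∧
          ∫ y in W, g y ≤ A * J.potential x := by
  obtain ⟨A, hA, hsh⟩ := exists_shadow_bound hΩ κ
  refine ⟨A, hA, fun J C W hCo hC hCΩ hW hWC => ?_⟩
  filter_upwards [ae_restrict_of_ae_restrict_of_subset hCΩ J.jump_bound,
    ae_restrict_mem hCo.measurableSet] with x hx hxC
  have hfin : ∀ e, volume (J.shadow x e) ≠ ⊤ := fun e =>
    ne_top_of_le_ne_top ENNReal.ofReal_ne_top (hsh J x (hCΩ hxC) e)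
  set T : J.ι → Set Plane := fun e => toMeasurable volume (J.shadow x e)
  have hT : ∀ e, MeasurableSet (T e) := fun e => measurableSet_toMeasurable _ _
  have hTfin : ∀ e, volume (T e) ≠ ⊤ := fun e => by
    rw [measure_toMeasurable]; exact hfin e
  have hint : ∀ e, IntegrableOn ((T e).indicator fun _ => J.jump e) W := fun e =>
    ((integrable_indicator_iff (hT e)).2 (integrableOn_const (hTfin e))).integrableOn
  refine ⟨fun y => ∑ e, (T e).indicator (fun _ => J.jump e) y,
    integrable_finsetSum _ fun e _ => hint e, ?_, ?_⟩
  · filter_upwards [ae_restrict_of_ae_restrict_of_subset (hWC.trans hCΩ) hx,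
      ae_restrict_mem hW] with y hy hyW
    refine (hy ((hC.segment_subset hxC (hWC hyW)).trans hCΩ)).trans
      (Finset.sum_le_sum fun e _ => ?_)
    by_cases hye : (segment ℝ x y ∩ J.D e).Nonempty
    · have h1 : y ∈ {z : Plane | (segment ℝ x z ∩ J.D e).Nonempty} := hye
      have h2 : y ∈ T e := subset_toMeasurable _ _ ⟨hCΩ (hWC hyW), hye⟩
      rw [indicator_of_mem h1, indicator_of_mem h2]
    · have h1 : y ∉ {z : Plane | (segment ℝ x z ∩ J.D e).Nonempty} := hye
      rw [indicator_of_notMem h1]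
      exact indicator_nonneg (fun _ _ => J.jump_nonneg e) _
  · rw [integral_finsetSum _ fun e _ => hint e, JumpSystem.potential, Finset.mul_sum]
    refine Finset.sum_le_sum fun e _ => ?_
    rw [integral_indicator_const _ (hT e), smul_eq_mul]
    have h1 : (volume.restrict W).real (T e) ≤ A * (J.d e * riesz (J.c e) (J.d e) x) := by
      have h2 : (volume.restrict W) (T e) ≤ ENNReal.ofReal _ :=
        (Measure.restrict_apply_le W (T e)).trans
          ((measure_toMeasurable _).le.trans (hsh J x (hCΩ hxC) e))
      refine ENNReal.toReal_le_of_le_ofReal ?_ h2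
      have := (riesz_pos (J.d_pos e) (J.c e) x).le
      have := (J.d_pos e).le
      positivity
    calc _ ≤ A * (J.d e * riesz (J.c e) (J.d e) x) * J.jump e := by
          gcongr; exact J.jump_nonneg e
      _ = _ := by ring

/-- `f` is pointwise close to its mean value over an open convex set. -/
theorem exists_average_bound {Ω : Set Plane} (hΩ : Bornology.IsBounded Ω) (κ : ℝ)
    {C : Set Plane} (hCo : IsOpen C) (hC : Convex ℝ C) (hCΩ : C ⊆ Ω) (hne : C.Nonempty) :
    ∃ A : ℝ, 0 ≤ A ∧ ∀ J : JumpSystem Ω κ, ∀ᵐ x ∂(volume.restrict C),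
      |J.f x - (volume.real C)⁻¹ * ∫ y in C, J.f y| ≤ A * (J.potential x + √J.energy) := by
  obtain ⟨A, hA, h⟩ := exists_average_jump_bound hΩ κ
  have hfin : volume C ≠ ⊤ := (hΩ.subset hCΩ).measure_lt_top.ne
  have hpos : 0 < volume.real C := ENNReal.toReal_pos (hCo.measure_pos volume hne).ne' hfin
  refine ⟨A / volume.real C, by positivity, fun J => ?_⟩
  filter_upwards [h J C C hCo hC hCΩ hCo.measurableSet subset_rfl] with x ⟨g, hg, hfg, hgA⟩
  have hJ : IntegrableOn J.f C := (J.integrableOn_f hΩ).mono_set hCΩ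
  have h1 : volume.real C * J.f x - ∫ y in C, J.f y = ∫ y in C, (J.f x - J.f y) := by
    have hI : Integrable (fun _ : Plane => J.f x) (volume.restrict C) := integrableOn_const hfin
    rw [integral_sub hI hJ, setIntegral_const, smul_eq_mul]
  have h2 : |volume.real C * J.f x - ∫ y in C, J.f y| ≤ A * J.potential x := by
    rw [h1]
    exact (norm_integral_le_of_norm_le (f := fun y => J.f x - J.f y) hg hfg).trans hgA
  have h3 : J.f x - (volume.real C)⁻¹ * ∫ y in C, J.f y
      = (volume.real C)⁻¹ * (volume.real C * J.f x - ∫ y in C, J.f y) := by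
    field_simp
  rw [h3, abs_mul, abs_of_pos (inv_pos.2 hpos), div_mul_eq_mul_div, inv_mul_eq_div]
  gcongr
  exact h2.trans (by gcongr; linarith [Real.sqrt_nonneg J.energy])

/-- The distance of `f` to a constant is transferred from a subset of positive measure to an open
convex set. -/
theorem exists_transfer_bound {Ω : Set Plane} (hΩ : Bornology.IsBounded Ω)
    (hm : MeasurableSet Ω) {κ : ℝ} (hκ : 0 < κ)
    {C W : Set Plane} (hCo : IsOpen C) (hC : Convex ℝ C) (hCΩ : C ⊆ Ω)
    (hWo : IsOpen W) (hWC : W ⊆ C) (hne : W.Nonempty) {A : ℝ} (hA : 0 ≤ A) :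
    ∃ A' : ℝ, 0 ≤ A' ∧ ∀ J : JumpSystem Ω κ, ∀ c : ℝ,
      (∀ᵐ y ∂(volume.restrict W), |J.f y - c| ≤ A * (J.potential y + √J.energy)) →
      ∀ᵐ x ∂(volume.restrict C), |J.f x - c| ≤ A' * (J.potential x + √J.energy) := by
  obtain ⟨A₁, hA₁, h⟩ := exists_average_jump_bound hΩ κ
  obtain ⟨A₂, hA₂, hpot⟩ := exists_potential_bound hΩ hm hκ
  have hfin : volume W ≠ ⊤ := (hΩ.subset (hWC.trans hCΩ)).measure_lt_top.ne
  have hpos : 0 < volume.real W := ENNReal.toReal_pos (hWo.measure_pos volume hne).ne' hfin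
  refine ⟨(A₁ + A * (A₂ + volume.real W)) / volume.real W, by positivity, fun J c hc => ?_⟩
  filter_upwards [h J C W hCo hC hCΩ hWo.measurableSet hWC] with x ⟨g, hg, hfg, hgA⟩
  set s := √J.energy
  have hs : 0 ≤ s := Real.sqrt_nonneg _
  have hI : IntegrableOn J.potential W :=
    J.continuous_potential.integrableOn_of_isBounded (hΩ.subset (hWC.trans hCΩ))
  have hIs : IntegrableOn (fun y => A * (J.potential y + s)) W :=
    (hI.add (integrableOn_const hfin)).const_mul A
  have h1 : volume.real W * |J.f x - c| ≤ ∫ y in W, (g y + A * (J.potential y + s)) := by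
    rw [← smul_eq_mul, ← setIntegral_const]
    refine integral_mono_ae (integrableOn_const hfin) (hg.add hIs) ?_
    filter_upwards [hfg, hc] with y h2 h3
    change |J.f x - c| ≤ g y + A * (J.potential y + s)
    calc |J.f x - c| = |(J.f x - J.f y) + (J.f y - c)| := by ring_nf
      _ ≤ _ := (abs_add_le _ _).trans (add_le_add h2 h3)
  have h2 : ∫ y in W, (g y + A * (J.potential y + s))
      = (∫ y in W, g y) + A * ((∫ y in W, J.potential y) + volume.real W * s) := by
    rw [integral_add hg hIs, integral_const_mul, integral_add hI (integrableOn_const hfin),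
      setIntegral_const, smul_eq_mul]
  have h3 : ∫ y in W, J.potential y ≤ A₂ * s :=
    (setIntegral_mono_set (J.continuous_potential.integrableOn_of_isBounded hΩ)
      (Filter.Eventually.of_forall J.potential_nonneg)
      (hWC.trans hCΩ).eventuallyLE).trans (hpot J).1
  rw [div_mul_eq_mul_div, le_div_iff₀ hpos, mul_comm]
  calc volume.real W * |J.f x - c|
      ≤ A₁ * J.potential x + A * (A₂ * s + volume.real W * s) := by
        rw [h2] at h1
        refine h1.trans ?_
        gcongr
    _ = A₁ * J.potential x + A * (A₂ + volume.real W) * s := by ring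
    _ ≤ _ := by
        have := J.potential_nonneg x
        have h5 : 0 ≤ A * (A₂ + volume.real W) := by positivity
        nlinarith [mul_nonneg hA₁.le hs, mul_nonneg h5 this]

/-- In a preconnected set covered by finitely many closed sets, two of these sets that meet it are
linked by any transitive relation that links the sets having a common point in it. -/
theorem reflTransGen_of_isPreconnected {X ι : Type*} [TopologicalSpace X] [Finite ι]
    {S : Set X} (hS : IsPreconnected S) {F : ι → Set X} (hF : ∀ i, IsClosed (F i))
    (hcov : S ⊆ ⋃ i, F i) {R : ι → ι → Prop}
    (hR : ∀ z ∈ S, ∀ i j, z ∈ F i → z ∈ F j → Relation.ReflTransGen R i j)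
    {i j : ι} {x y : X} (hx : x ∈ S) (hxi : x ∈ F i) (hy : y ∈ S) (hyj : y ∈ F j) :
    Relation.ReflTransGen R i j := by
  by_contra hij
  have h := isPreconnected_closed_iff.1 hS
    (⋃ k ∈ {k | Relation.ReflTransGen R i k}, F k)
    (⋃ k ∈ {k | ¬Relation.ReflTransGen R i k}, F k)
    ((toFinite _).isClosed_biUnion fun k _ => hF k)
    ((toFinite _).isClosed_biUnion fun k _ => hF k)
    (fun z hz => by
      obtain ⟨k, hk⟩ := mem_iUnion.1 (hcov hz)
      by_cases hik : Relation.ReflTransGen R i k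
      · exact Or.inl (mem_biUnion (show k ∈ {k | Relation.ReflTransGen R i k} from hik) hk)
      · exact Or.inr (mem_biUnion (show k ∈ {k | ¬Relation.ReflTransGen R i k} from hik) hk))
    ⟨x, hx, mem_biUnion (show i ∈ {k | Relation.ReflTransGen R i k} from .refl) hxi⟩
    ⟨y, hy, mem_biUnion (show j ∈ {k | ¬Relation.ReflTransGen R i k} from hij) hyj⟩
  obtain ⟨z, hz, h1, h2⟩ := h
  obtain ⟨k, hk, hzk⟩ := mem_iUnion₂.1 h1
  obtain ⟨l, hl, hzl⟩ := mem_iUnion₂.1 h2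
  exact hl (Relation.ReflTransGen.trans hk (hR z hz k l hzk hzl))

/-- A preconnected set that meets an open set, but not its frontier, lies in this open set. -/
theorem IsPreconnected.subset_of_disjoint_frontier {X : Type*} [TopologicalSpace X] {t u : Set X}
    (ht : IsPreconnected t) (hu : IsOpen u) (hd : Disjoint t (frontier u))
    (hne : (t ∩ u).Nonempty) : t ⊆ u := by
  refine ht.subset_left_of_subset_union hu isClosed_closure.isOpen_compl
    (disjoint_compl_right.mono_left subset_closure) (fun z hz => ?_) hne
  by_cases h : z ∈ closure u
  · left
    by_contra h'
    exact hd.ne_of_mem hz ⟨h, by rwa [hu.interior_eq]⟩ rfl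
  · exact Or.inr h

/-- A polygonal domain is, up to a null set, a finite union of open convex sets: the regions cut
out by the lines that carry its boundary. -/
theorem IsPolygonalDomain.exists_convex_cells {Ω : Set Plane} (hΩ : IsPolygonalDomain Ω) :
    ∃ (N : Type) (_ : Finite N) (C : N → Set Plane),
      (∀ i, IsOpen (C i) ∧ Convex ℝ (C i) ∧ C i ⊆ Ω ∧ (C i).Nonempty) ∧
        volume (Ω \ ⋃ i, C i) = 0 := by
  obtain ⟨S, hS⟩ := hΩ.polygonal
  choose n hn hline using fun s : Plane × Plane => exists_line_of_segment s.1 s.2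
  let H : (S → Bool) → Set Plane := fun ε => {z | ∀ s : S,
    if ε s then inner ℝ (n s) z < inner ℝ (n s) s.1.1 else inner ℝ (n s) s.1.1 < inner ℝ (n s) z}
  have hH : ∀ ε, H ε = ⋂ s : S, if ε s then {z | inner ℝ (n s) z < inner ℝ (n s) s.1.1}
      else {z | inner ℝ (n s) s.1.1 < inner ℝ (n s) z} := fun ε => by
    ext z
    simp only [H, mem_iInter]
    refine forall_congr' fun s => ?_
    split_ifs <;> rfl
  have hHo : ∀ ε, IsOpen (H ε) := fun ε => by
    rw [hH]
    refine isOpen_iInter_of_finite fun s => ?_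
    split_ifs
    · exact isOpen_lt (by fun_prop) (by fun_prop)
    · exact isOpen_lt (by fun_prop) (by fun_prop)
  have hHc : ∀ ε, Convex ℝ (H ε) := fun ε => by
    rw [hH]
    refine convex_iInter fun s => ?_
    split_ifs
    · exact convex_halfSpace_lt (innerₛₗ ℝ (n s)).isLinear _
    · exact convex_halfSpace_gt (innerₛₗ ℝ (n s)).isLinear _
  -- an open convex region that does not meet the frontier lies inside or outside `Ω`
  have hHf : ∀ ε, H ε ⊆ (frontier Ω)ᶜ := fun ε z hz hzf => by
    rw [hS] at hzf
    obtain ⟨s, hs, hzs⟩ := mem_iUnion₂.1 hzf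
    have h1 := hz ⟨s, hs⟩
    have h2 := hline s z hzs
    simp only [h2, lt_self_iff_false, ite_self] at h1
  refine ⟨{ε : S → Bool // (H ε ∩ Ω).Nonempty}, inferInstance, fun ε => H ε.1,
    fun ε => ⟨hHo _, hHc _, ?_, ε.2.mono inter_subset_left⟩, ?_⟩
  · exact (hHc ε.1).isPreconnected.subset_of_disjoint_frontier hΩ.isOpen
      (Set.disjoint_left.2 fun z hz => hHf _ hz) ε.2
  · refine measure_mono_null (t := ⋃ s : S, {z | inner ℝ (n s) z = inner ℝ (n s) s.1.1}) ?_
      (measure_iUnion_null fun s => volume_line_eq_zero (hn _) _)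
    rintro z ⟨hz, hz'⟩
    by_contra hcon
    simp only [mem_iUnion, not_exists] at hcon
    apply hz'
    have hmem : z ∈ H fun s => decide (inner ℝ (n s) z < inner ℝ (n s) s.1.1) := fun s => by
      by_cases h : inner ℝ (n s) z < inner ℝ (n s) s.1.1
      · simp only [h, decide_true, if_true]
      · simp only [h, decide_false]
        exact lt_of_le_of_ne (not_lt.1 h) (Ne.symm (hcon s))
    exact mem_iUnion.2 ⟨⟨_, z, hmem, hz⟩, hmem⟩

/-- The Poincaré-Sobolev inequality in `L⁴`, uniform over jump systems. -/
theorem IsPolygonalDomain.exists_poincare_sobolev {Ω : Set Plane} (hΩ : IsPolygonalDomain Ω)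
    {κ : ℝ} (hκ : 0 < κ) :
    ∃ A : ℝ, 0 < A ∧ ∀ J : JumpSystem Ω κ, ∃ c : ℝ,
      ∫ x in Ω, (J.f x - c) ^ 4 ≤ A * J.energy ^ 2 := by
  have hb := hΩ.isBounded
  have hm := hΩ.isOpen.measurableSet
  obtain ⟨N, _, C, hC, hnull⟩ := hΩ.exists_convex_cells
  have hdense : Ω ⊆ ⋃ i, closure (C i) := by
    intro z hz
    rw [← closure_iUnion_of_finite, mem_closure_iff]
    intro U hU hzU
    by_contra hcon
    have h1 : U ∩ Ω ⊆ Ω \ ⋃ i, C i := fun y hy =>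
      ⟨hy.2, fun hy' => hcon ⟨y, hy.1, hy'⟩⟩
    exact ((hU.inter hΩ.isOpen).measure_pos volume ⟨z, hzU, hz⟩).ne'
      (measure_mono_null h1 hnull)
  obtain ⟨z₀, hz₀⟩ := hΩ.isConnected.nonempty
  obtain ⟨i₀, hi₀⟩ := mem_iUnion.1 (hdense hz₀)
  let c : JumpSystem Ω κ → ℝ := fun J => (volume.real (C i₀))⁻¹ * ∫ y in C i₀, J.f y
  have hall : ∀ i, ∃ A : ℝ, 0 ≤ A ∧ ∀ J : JumpSystem Ω κ, ∀ᵐ x ∂(volume.restrict (C i)),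
      |J.f x - c J| ≤ A * (J.potential x + √J.energy) := by
    intro i
    have hpath : Relation.ReflTransGen
        (fun i j => ∃ z ∈ Ω, z ∈ closure (C i) ∧ z ∈ closure (C j)) i₀ i := by
      obtain ⟨y, hy⟩ := (hC i).2.2.2
      exact reflTransGen_of_isPreconnected hΩ.isConnected.isPreconnected
        (F := fun i => closure (C i)) (fun _ => isClosed_closure) hdense
        (fun z hz i j hzi hzj => .single ⟨z, hz, hzi, hzj⟩) hz₀ hi₀ ((hC i).2.2.1 hy)
        (subset_closure hy)
    induction hpath with
    | refl => exact exists_average_bound hb κ (hC i₀).1 (hC i₀).2.1 (hC i₀).2.2.1 (hC i₀).2.2.2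
    | @tail j k _ hjk ih =>
      obtain ⟨z, hz, hzj, hzk⟩ := hjk
      obtain ⟨A, hA, h⟩ := ih
      -- the two regions are linked by a small ball around a common point of their closures
      obtain ⟨r, hr, hball⟩ := Metric.isOpen_iff.1 hΩ.isOpen z hz
      have hopen := Metric.isOpen_ball (x := z) (ε := r)
      have hzr := Metric.mem_ball_self (x := z) hr
      obtain ⟨A₁, hA₁, h₁⟩ := exists_transfer_bound hb hm hκ hopen (convex_ball z r) hball
        (hopen.inter (hC j).1) inter_subset_left (mem_closure_iff.1 hzj _ hopen hzr) hA
      obtain ⟨A₂, hA₂, h₂⟩ := exists_transfer_bound hb hm hκ (hC k).1 (hC k).2.1 (hC k).2.2.1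
        (hopen.inter (hC k).1) inter_subset_right (mem_closure_iff.1 hzk _ hopen hzr) hA₁
      exact ⟨A₂, hA₂, fun J => h₂ J (c J) (ae_restrict_of_ae_restrict_of_subset inter_subset_left
        (h₁ J (c J) (ae_restrict_of_ae_restrict_of_subset inter_subset_right (h J))))⟩
  choose A hA0 hA using hall
  have := Fintype.ofFinite N
  set a := ∑ i, A i
  have ha : 0 ≤ a := Finset.sum_nonneg fun i _ => hA0 i
  obtain ⟨A₂, hA₂, hpot⟩ := exists_potential_bound hb hm hκ
  refine ⟨a ^ 4 * (8 * (A₂ + volume.real Ω)) + 1, by positivity, fun J => ⟨c J, ?_⟩⟩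
  have hae : ∀ᵐ x ∂(volume.restrict Ω), |J.f x - c J| ≤ a * (J.potential x + √J.energy) := by
    have h1 : ∀ᵐ x ∂(volume.restrict (⋃ i, C i)),
        |J.f x - c J| ≤ a * (J.potential x + √J.energy) := by
      rw [ae_restrict_iUnion_iff]
      intro i
      filter_upwards [hA i J] with x hx
      have h2 : 0 ≤ J.potential x + √J.energy :=
        add_nonneg (J.potential_nonneg x) (Real.sqrt_nonneg _)
      refine hx.trans ?_
      gcongr
      exact Finset.single_le_sum (f := A) (fun i _ => hA0 i) (Finset.mem_univ i)
    have h2 : (volume.restrict Ω : Measure Plane) ≪ volume.restrict (⋃ i, C i) := by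
      refine Measure.absolutelyContinuous_of_le (Measure.restrict_mono' ?_ le_rfl)
      exact ae_le_set.2 hnull
    exact h2.ae_le h1
  have hE := J.energy_nonneg
  have hint : IntegrableOn (fun x => J.potential x ^ 4) Ω :=
    (J.continuous_potential.pow 4).integrableOn_of_isBounded hb
  have hfin : volume Ω ≠ ⊤ := hb.measure_lt_top.ne
  calc ∫ x in Ω, (J.f x - c J) ^ 4
      ≤ ∫ x in Ω, a ^ 4 * (8 * (J.potential x ^ 4 + J.energy ^ 2)) := by
        refine integral_mono_of_nonneg (Filter.Eventually.of_forall fun x => by positivity)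
          (((hint.add (integrableOn_const hfin)).const_mul 8).const_mul (a ^ 4)) ?_
        filter_upwards [hae] with x hx
        have h3 := J.potential_nonneg x
        have h4 : √J.energy ^ 4 = J.energy ^ 2 := by
          rw [show (4 : ℕ) = 2 * 2 by norm_num, pow_mul, Real.sq_sqrt hE]
        calc (J.f x - c J) ^ 4 = |J.f x - c J| ^ 4 := by
              rw [show (4 : ℕ) = 2 * 2 by norm_num, pow_mul, pow_mul, sq_abs]
          _ ≤ (a * (J.potential x + √J.energy)) ^ 4 := by gcongr
          _ = a ^ 4 * (J.potential x + √J.energy) ^ 4 := by ring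
          _ ≤ a ^ 4 * (8 * (J.potential x ^ 4 + √J.energy ^ 4)) := by
              gcongr
              have := add_pow_le h3 (Real.sqrt_nonneg J.energy) 4
              norm_num at this
              linarith
          _ = _ := by rw [h4]
    _ = a ^ 4 * (8 * ((∫ x in Ω, J.potential x ^ 4) + volume.real Ω * J.energy ^ 2)) := by
        rw [integral_const_mul, integral_const_mul, integral_add hint (integrableOn_const hfin),
          setIntegral_const, smul_eq_mul]
    _ ≤ a ^ 4 * (8 * (A₂ * J.energy ^ 2 + volume.real Ω * J.energy ^ 2)) := by
        gcongr; exact (hpot J).2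
    _ = a ^ 4 * (8 * (A₂ + volume.real Ω)) * J.energy ^ 2 := by ring
    _ ≤ _ := by gcongr; linarith

/-- A `χ²` bound on `f²`, which controls the entropy of `f²` through `log s ≤ s - 1`. The parameter
`ε` avoids a degenerate reference value `t` when all the jumps vanish. -/
theorem IsPolygonalDomain.exists_chi_square_bound {Ω : Set Plane} (hΩ : IsPolygonalDomain Ω)
    {κ : ℝ} (hκ : 0 < κ) :
    ∃ A : ℝ, 0 < A ∧ ∀ J : JumpSystem Ω κ, ∀ ε : ℝ, 0 < ε → ∃ t : ℝ, 0 < t ∧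
      ∫ x in Ω, (J.f x ^ 2 - t) ^ 2 / t ≤ A * (J.energy + ε) := by
  obtain ⟨A, hA, h⟩ := hΩ.exists_poincare_sobolev hκ
  refine ⟨9 * (A + volume.real Ω), by positivity, fun J ε hε => ?_⟩
  obtain ⟨c, hc⟩ := h J
  have hE := J.energy_nonneg
  set B := J.energy + ε with hB
  have hB0 : 0 < B := by positivity
  have hfin : volume Ω ≠ ⊤ := hΩ.isBounded.measure_lt_top.ne
  obtain ⟨b, hb⟩ := J.bounded
  have hint : IntegrableOn (fun x => (J.f x - c) ^ 4) Ω := by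
    refine Measure.integrableOn_of_bounded (M := (b + |c|) ^ 4) hfin
      ((J.measurable.sub_const c).pow_const 4).aestronglyMeasurable
      (Filter.Eventually.of_forall fun x => ?_)
    rw [Real.norm_eq_abs, abs_pow]
    gcongr
    exact (abs_sub _ _).trans (by gcongr; exact hb x)
  refine ⟨c ^ 2 + B, by positivity, ?_⟩
  calc ∫ x in Ω, (J.f x ^ 2 - (c ^ 2 + B)) ^ 2 / (c ^ 2 + B)
      ≤ ∫ x in Ω, 9 * ((J.f x - c) ^ 4 / B + B) := by
        refine integral_mono_of_nonneg (Filter.Eventually.of_forall fun x => by positivity)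
          (((hint.div_const B).add (integrableOn_const hfin)).const_mul 9)
          (Filter.Eventually.of_forall fun x => ?_)
        change (J.f x ^ 2 - (c ^ 2 + B)) ^ 2 / (c ^ 2 + B) ≤ 9 * ((J.f x - c) ^ 4 / B + B)
        set g := J.f x - c with hg
        have hf : J.f x = g + c := by ring
        rw [hf, div_le_iff₀ (by positivity)]
        have h1 : g ^ 4 / B * B = g ^ 4 := by field_simp
        set q := g ^ 4 / B
        have hq : 0 ≤ q := by positivity
        have h2 : g ^ 2 * 2 ≤ q + B := by
          have h3 : (g ^ 2 * 2) ^ 2 ≤ (q + B) ^ 2 := by nlinarith [sq_nonneg (q - B)]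
          exact abs_le_of_sq_le_sq' h3 (by positivity) |>.2
        have h4 : ((g + c) ^ 2 - (c ^ 2 + B)) ^ 2
            ≤ 3 * (4 * c ^ 2 * g ^ 2 + g ^ 4 + B ^ 2) := by
          nlinarith [sq_nonneg (2 * c * g - g ^ 2), sq_nonneg (2 * c * g + B),
            sq_nonneg (g ^ 2 + B)]
        nlinarith [mul_nonneg (sq_nonneg c) hq, mul_nonneg (sq_nonneg c) hB0.le,
          mul_le_mul_of_nonneg_left h2 (sq_nonneg c), mul_nonneg hq hB0.le]
    _ = 9 * ((∫ x in Ω, (J.f x - c) ^ 4) / B + volume.real Ω * B) := by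
        rw [integral_const_mul, integral_add (hint.div_const B) (integrableOn_const hfin),
          integral_div, setIntegral_const, smul_eq_mul]
    _ ≤ 9 * (A * J.energy ^ 2 / B + volume.real Ω * B) := by gcongr
    _ ≤ 9 * (A * B + volume.real Ω * B) := by
        gcongr
        rw [div_le_iff₀ hB0, mul_assoc]
        gcongr
        nlinarith
    _ = _ := by ring

/-! ### Triangles and quadrilaterals -/

theorem mem_convexHull_triple {x a b z : Plane} :
    z ∈ convexHull ℝ {x, a, b} ↔ ∃ α β γ : ℝ, 0 ≤ α ∧ 0 ≤ β ∧ 0 ≤ γ ∧ α + β + γ = 1 ∧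
      z = α • x + β • a + γ • b := by
  constructor
  · intro hz
    refine convexHull_min (t := {z | ∃ α β γ : ℝ, 0 ≤ α ∧ 0 ≤ β ∧ 0 ≤ γ ∧ α + β + γ = 1 ∧
      z = α • x + β • a + γ • b}) ?_ ?_ hz
    · rintro y (rfl | rfl | rfl)
      · exact ⟨1, 0, 0, by simp⟩
      · exact ⟨0, 1, 0, by simp⟩
      · exact ⟨0, 0, 1, by simp⟩
    · rintro _ ⟨α, β, γ, h1, h2, h3, h4, rfl⟩ _ ⟨α', β', γ', h1', h2', h3', h4', rfl⟩ s t hs ht hst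
      refine ⟨s * α + t * α', s * β + t * β', s * γ + t * γ', by positivity, by positivity,
        by positivity, ?_, by module⟩
      linear_combination s * h4 + t * h4' + hst
  · rintro ⟨α, β, γ, h1, h2, h3, h4, rfl⟩
    have hc := convex_convexHull ℝ ({x, a, b} : Set Plane)
    have hsub := subset_convexHull ℝ ({x, a, b} : Set Plane)
    have := hc.sum_mem (t := Finset.univ) (w := ![α, β, γ]) (z := ![x, a, b])
      (by simp [Fin.forall_fin_succ, h1, h2, h3]) (by simp [Fin.sum_univ_three, h4])
      (by
        intro i _
        fin_cases i
        · exact hsub (by simp)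
        · exact hsub (by simp)
        · exact hsub (by simp))
    simpa [Fin.sum_univ_three] using this

/-- A convex quadrilateral is the union of the two triangles cut out by a diagonal. -/
theorem convexHull_quadrilateral_subset {k a l b p : Plane} (hp : p ∈ segment ℝ a b)
    (hp' : p ∈ segment ℝ k l) :
    convexHull ℝ {k, a, l, b} ⊆ convexHull ℝ {k, a, b} ∪ convexHull ℝ {l, a, b} := by
  obtain ⟨s, ⟨hs0, hs1⟩, rfl⟩ := (segment_eq_image ℝ a b).subset hp
  obtain ⟨t, ⟨ht0, ht1⟩, hpt⟩ := (segment_eq_image ℝ k l).subset hp'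
  simp only at hpt
  intro z hz
  have hz' : z ∈ convexJoin ℝ {k} (convexHull ℝ {a, l, b}) := by
    rwa [convexHull_insert ⟨a, by simp⟩] at hz
  rw [mem_convexJoin] at hz'
  obtain ⟨k', hk', y, hy, hzy⟩ := hz'
  rw [mem_singleton_iff] at hk'
  subst hk'
  obtain ⟨α, μ, β, hα, hμ, hβ, hsum, rfl⟩ := mem_convexHull_triple.1 hy
  obtain ⟨c, d, hc, hd, hcd, rfl⟩ := hzy
  simp only [union_def, mem_ofPred_eq, mem_convexHull_triple]
  by_cases h : d * μ * (1 - t) ≤ c * t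
  · left
    rcases ht0.eq_or_lt with rfl | ht
    · have hdm : d * μ = 0 := le_antisymm (by simpa using h) (by positivity)
      refine ⟨c, d * α, d * β, hc, by positivity, by positivity, ?_, ?_⟩
      · linear_combination d * hsum + hcd - hdm
      · rw [smul_add, smul_add, smul_smul, smul_smul, smul_smul, hdm]; module
    · refine ⟨c - d * μ * (1 - t) / t, d * α + d * μ * (1 - s) / t, d * β + d * μ * s / t, ?_, ?_,
        ?_, ?_, ?_⟩
      · rw [sub_nonneg, div_le_iff₀ ht]; exact h
      · have : 0 ≤ 1 - s := by linarith
        positivity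
      · positivity
      · field_simp
        linear_combination t * d * hsum + t * hcd
      · have hl : l = (1 / t) • ((1 - s) • a + s • b) - ((1 - t) / t) • k' := by
          rw [← hpt, smul_add, smul_smul, smul_smul, one_div, inv_mul_cancel₀ ht.ne', one_smul,
            inv_mul_eq_div]
          abel
        rw [hl]
        match_scalars <;> field_simp <;> ring
  · right
    push Not at h
    have ht : t < 1 := by
      by_contra h1
      have : t = 1 := le_antisymm ht1 (not_lt.1 h1)
      subst this
      simp only [sub_self, mul_zero, mul_one] at h
      linarith
    have ht' : 0 < 1 - t := by linarith
    refine ⟨d * μ - c * t / (1 - t), d * α + c * (1 - s) / (1 - t), d * β + c * s / (1 - t), ?_,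
      ?_, ?_, ?_, ?_⟩
    · rw [sub_nonneg, div_le_iff₀ ht']; exact h.le
    · have : 0 ≤ 1 - s := by linarith
      positivity
    · positivity
    · field_simp
      linear_combination (1 - t) * d * hsum + (1 - t) * hcd
    · have hk : k' = (1 / (1 - t)) • ((1 - s) • a + s • b) - (t / (1 - t)) • l := by
        rw [← hpt, smul_add, smul_smul, smul_smul, one_div, inv_mul_cancel₀ ht'.ne', one_smul,
          inv_mul_eq_div]
        abel
      have hk2 : c • k' = c • ((1 / (1 - t)) • ((1 - s) • a + s • b) - (t / (1 - t)) • l) := by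
        rw [← hk]
      rw [hk2]
      match_scalars <;> field_simp <;> ring

/-- The open triangle with apex `x` and base `[a, b]`, in barycentric coordinates. -/
def openTriangle (x a b : Plane) : Set Plane :=
  {z | ∃ α β : ℝ, 0 < α ∧ 0 < β ∧ α + β < 1 ∧ z = x + α • (a - x) + β • (b - x)}

theorem coord_eq {x a b z : Plane} (h : pcross (a - x) (b - x) ≠ 0) :
    z = x + (pcross (z - x) (b - x) / pcross (a - x) (b - x)) • (a - x)
      + (pcross (a - x) (z - x) / pcross (a - x) (b - x)) • (b - x) := by
  have h1 := pcross_smul_eq (a - x) (b - x) (z - x)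
  have h2 : z - x = (pcross (a - x) (b - x))⁻¹ • (pcross (a - x) (b - x) • (z - x)) := by
    rw [smul_smul, inv_mul_cancel₀ h, one_smul]
  rw [h1, smul_add, smul_smul, smul_smul, inv_mul_eq_div, inv_mul_eq_div] at h2
  rw [add_assoc, ← h2]; abel

theorem isOpen_openTriangle {x a b : Plane} (h : pcross (a - x) (b - x) ≠ 0) :
    IsOpen (openTriangle x a b) := by
  have heq : openTriangle x a b = {z | 0 < pcross (z - x) (b - x) / pcross (a - x) (b - x) ∧
      0 < pcross (a - x) (z - x) / pcross (a - x) (b - x) ∧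
      pcross (z - x) (b - x) / pcross (a - x) (b - x)
        + pcross (a - x) (z - x) / pcross (a - x) (b - x) < 1} := by
    ext z
    constructor
    · rintro ⟨α, β, hα, hβ, hαβ, rfl⟩
      have h1 : pcross (x + α • (a - x) + β • (b - x) - x) (b - x)
          = α * pcross (a - x) (b - x) := by
        simp [pcross]; ring
      have h2 : pcross (a - x) (x + α • (a - x) + β • (b - x) - x)
          = β * pcross (a - x) (b - x) := by
        simp [pcross]; ring
      simp only [mem_ofPred_eq, h1, h2, mul_div_assoc, div_self h, mul_one]
      exact ⟨hα, hβ, hαβ⟩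
    · rintro ⟨h1, h2, h3⟩
      exact ⟨_, _, h1, h2, h3, coord_eq h⟩
  have hc1 : Continuous fun z : Plane => pcross (z - x) (b - x) / pcross (a - x) (b - x) := by
    unfold pcross; fun_prop
  have hc2 : Continuous fun z : Plane => pcross (a - x) (z - x) / pcross (a - x) (b - x) := by
    unfold pcross; fun_prop
  rw [heq]
  exact (isOpen_lt continuous_const hc1).inter
    ((isOpen_lt continuous_const hc2).inter (isOpen_lt (hc1.add hc2) continuous_const))

theorem convex_openTriangle (x a b : Plane) : Convex ℝ (openTriangle x a b) := by
  rintro _ ⟨α, β, h1, h2, h3, rfl⟩ _ ⟨α', β', h1', h2', h3', rfl⟩ s t hs ht hst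
  have hpos : ∀ u v : ℝ, 0 < u → 0 < v → 0 < s * u + t * v := fun u v hu hv => by
    rcases hs.eq_or_lt with rfl | hs'
    · have : t = 1 := by linarith
      subst this; linarith
    · have := mul_pos hs' hu
      have := mul_nonneg ht hv.le
      linarith
  have h4 := hpos (1 - α - β) (1 - α' - β') (by linarith) (by linarith)
  refine ⟨s * α + t * α', s * β + t * β', hpos _ _ h1 h1', hpos _ _ h2 h2', by nlinarith, ?_⟩
  have : s = 1 - t := by linarith
  subst this
  module

theorem openTriangle_subset_convexHull (x a b : Plane) :
    openTriangle x a b ⊆ convexHull ℝ {x, a, b} := by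
  rintro _ ⟨α, β, h1, h2, h3, rfl⟩
  exact mem_convexHull_triple.2 ⟨1 - α - β, α, β, by linarith, h1.le, h2.le, by ring, by module⟩

theorem convexHull_subset_closure_openTriangle (x a b : Plane) :
    convexHull ℝ {x, a, b} ⊆ closure (openTriangle x a b) := by
  intro z hz
  obtain ⟨α, β, γ, hα, hβ, hγ, hsum, rfl⟩ := mem_convexHull_triple.1 hz
  -- move the point slightly towards the barycenter
  let c : ℝ → Plane := fun t => x + ((1 - t) * β + t / 3) • (a - x)
    + ((1 - t) * γ + t / 3) • (b - x)
  have hc : Continuous c := by fun_prop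
  have h0 : c 0 = α • x + β • a + γ • b := by
    have : α = 1 - β - γ := by linarith
    subst this
    simp only [c]
    module
  rw [← h0]
  have hlim : Filter.Tendsto c (nhdsWithin 0 (Ioo 0 1)) (nhds (c 0)) :=
    hc.continuousAt.tendsto.mono_left nhdsWithin_le_nhds
  have hne : (nhdsWithin (0 : ℝ) (Ioo 0 1)).NeBot := by
    rw [nhdsWithin_Ioo_eq_nhdsGT one_pos]; infer_instance
  refine mem_closure_of_tendsto hlim ?_
  filter_upwards [self_mem_nhdsWithin] with t ⟨ht0, ht1⟩
  have h1 := mul_nonneg (sub_nonneg.2 ht1.le) hβ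
  have h2 := mul_nonneg (sub_nonneg.2 ht1.le) hγ
  have h3 := mul_nonneg (sub_nonneg.2 ht1.le) hα
  refine ⟨(1 - t) * β + t / 3, (1 - t) * γ + t / 3, by linarith, by linarith, ?_, rfl⟩
  nlinarith

theorem openTriangle_homothety {x a b z : Plane} (hz : z ∈ openTriangle x a b) {t : ℝ}
    (ht0 : 0 < t) (ht1 : t ≤ 1) : x + t • (z - x) ∈ openTriangle x a b := by
  obtain ⟨α, β, h1, h2, h3, rfl⟩ := hz
  refine ⟨t * α, t * β, by positivity, by positivity, by nlinarith, by module⟩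

theorem openSegment_subset_openTriangle {x a b p : Plane} (hp : p ∈ openSegment ℝ a b) :
    openSegment ℝ x p ⊆ openTriangle x a b := by
  obtain ⟨s, t, hs, ht, hst, rfl⟩ := hp
  rintro _ ⟨c, d, hc, hd, hcd, rfl⟩
  refine ⟨d * s, d * t, by positivity, by positivity, by nlinarith, ?_⟩
  have h1 : c = 1 - d := by linarith
  have h2 : s = 1 - t := by linarith
  subst h1 h2
  module

theorem mem_openSegment_of_mem_segment {a b z : Plane} (hz : z ∈ segment ℝ a b) (ha : z ≠ a)
    (hb : z ≠ b) : z ∈ openSegment ℝ a b := by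
  rcases (insert_endpoints_openSegment ℝ a b).symm.subset hz with h | h | h
  · exact absurd h ha
  · exact absurd h hb
  · exact h

/-- The cross product with the direction of a segment vanishes along it. -/
theorem pcross_eq_zero_of_mem_segment {a b z : Plane} (hz : z ∈ segment ℝ a b) :
    pcross (b - a) (z - a) = 0 := by
  rw [segment_eq_image'] at hz
  obtain ⟨t, -, rfl⟩ := hz
  simp [pcross]; ring

theorem openTriangle_nonempty (x a b : Plane) : (openTriangle x a b).Nonempty :=
  ⟨_, 1 / 3, 1 / 3, by norm_num, by norm_num, by norm_num, rfl⟩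

/-! ### Geometry of a DDFV mesh -/

namespace DDFVData

variable {M : DDFVData} {Ω : Set Plane}

theorem convex_diamond (e : M.Edge) : Convex ℝ (M.diamond e) := convex_convexHull _ _

theorem isCompact_diamond (e : M.Edge) : IsCompact (M.diamond e) :=
  (toFinite _).isCompact_convexHull (𝕜 := ℝ)

theorem isClosed_diamond (e : M.Edge) : IsClosed (M.diamond e) := (isCompact_diamond e).isClosed

theorem xK_mem_diamond (e : M.Edge) : M.xK e ∈ M.diamond e := subset_convexHull _ _ (by simp)

theorem xL_mem_diamond (e : M.Edge) : M.xL e ∈ M.diamond e := subset_convexHull _ _ (by simp)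

theorem xa_mem_diamond (e : M.Edge) : M.xa e ∈ M.diamond e := subset_convexHull _ _ (by simp)

theorem xb_mem_diamond (e : M.Edge) : M.xb e ∈ M.diamond e := subset_convexHull _ _ (by simp)

theorem seg_subset_diamond (e : M.Edge) : M.seg e ⊆ M.diamond e :=
  (convex_diamond e).segment_subset (xa_mem_diamond e) (xb_mem_diamond e)

theorem isCompact_dualCell (v : M.Vtx) : IsCompact (M.dualCell v) :=
  isCompact_iUnion fun _ => (toFinite _).isCompact_convexHull (𝕜 := ℝ)

theorem isClosed_dualCell (v : M.Vtx) : IsClosed (M.dualCell v) := (isCompact_dualCell v).isClosed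

theorem isEdgeOf_left (e : M.Edge) : M.IsEdgeOf (M.left e) e := Or.inl rfl

theorem dualTriangle_subset_diamond {e : M.Edge} {v : M.Vtx} (hv : M.src e = v ∨ M.tgt e = v) :
    convexHull ℝ {M.vertex v, M.xK e, M.xL e} ⊆ M.diamond e := by
  refine convexHull_min ?_ (convex_diamond e)
  rintro z (rfl | rfl | rfl)
  · rcases hv with rfl | rfl
    · exact xa_mem_diamond e
    · exact xb_mem_diamond e
  · exact xK_mem_diamond e
  · exact xL_mem_diamond e

theorem vertex_mem_seg {e : M.Edge} {v : M.Vtx} (hv : M.src e = v ∨ M.tgt e = v) :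
    M.vertex v ∈ M.seg e := by
  rcases hv with rfl | rfl
  · exact left_mem_segment ℝ _ _
  · exact right_mem_segment ℝ _ _

theorem xL_mem_seg_of_boundary (b : M.BdEdge) : M.xL (.inr b) ∈ M.seg (.inr b) :=
  midpoint_mem_segment _ _

theorem center_mem_diamond {K : M.PCell} {e : M.Edge} (h : M.IsEdgeOf K e) :
    M.center K ∈ M.diamond e := by
  rcases h with h | h
  · have := xK_mem_diamond e
    rwa [xK, h] at this
  · have := xL_mem_diamond e
    rwa [xL, h] at this

theorem primalTriangle_subset_diamond {K : M.PCell} {e : M.Edge} (h : M.IsEdgeOf K e) :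
    convexHull ℝ {M.center K, M.xa e, M.xb e} ⊆ M.diamond e := by
  refine convexHull_min ?_ (convex_diamond e)
  rintro z (rfl | rfl | rfl)
  · exact center_mem_diamond h
  · exact xa_mem_diamond e
  · exact xb_mem_diamond e

namespace IsMesh

/-- The orientation of the diagonals of a diamond. -/
theorem pcross_pos (hM : M.IsMesh Ω) (e : M.Edge) :
    0 < pcross (M.xb e - M.xa e) (M.xL e - M.xK e) := by
  have := hM.orient e
  rwa [inner_perp] at this

theorem seg_subset_frontier (hM : M.IsMesh Ω) {K : M.PCell} {e : M.Edge} (h : M.IsEdgeOf K e) :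
    M.seg e ⊆ frontier (M.cell K) := by
  rw [hM.cell_frontier]
  exact subset_iUnion (fun e : {e : M.Edge // M.IsEdgeOf K e} => M.seg e.1) ⟨e, h⟩

theorem disjoint_cell_frontier (hM : M.IsMesh Ω) (K : M.PCell) {z : Plane}
    (hz : z ∈ frontier (M.cell K)) : z ∉ M.cell K := by
  rw [(hM.cell_open K).frontier_eq] at hz
  exact hz.2

theorem exists_edge_of_mem_closure (hM : M.IsMesh Ω) {K : M.PCell} {z : Plane}
    (hz : z ∈ closure (M.cell K)) (hz' : z ∉ M.cell K) : ∃ e, M.IsEdgeOf K e ∧ z ∈ M.seg e := by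
  have : z ∈ frontier (M.cell K) := by
    rw [(hM.cell_open K).frontier_eq]; exact ⟨hz, hz'⟩
  rw [hM.cell_frontier] at this
  obtain ⟨⟨e, he⟩, hze⟩ := mem_iUnion.1 this
  exact ⟨e, he, hze⟩

/-- The triangle with apex the center of a cell and base an edge of the cell is not flat. -/
theorem primalTriangle_nondegenerate (hM : M.IsMesh Ω) {K : M.PCell} {e : M.Edge}
    (h : M.IsEdgeOf K e) : pcross (M.xb e - M.xa e) (M.center K - M.xa e) ≠ 0 := by
  have hnot : M.center K ∉ M.seg e := fun hc =>
    hM.disjoint_cell_frontier K (hM.seg_subset_frontier h hc) (hM.center_mem K)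
  obtain ⟨p, hp, hp'⟩ := hM.diag_cross e
  have hp0 := pcross_eq_zero_of_mem_segment (openSegment_subset_segment ℝ _ _ hp)
  have hpos := hM.pcross_pos e
  rw [dualSeg, segment_eq_image'] at hp'
  obtain ⟨t, ⟨ht0, ht1⟩, rfl⟩ := hp'
  simp only at hp hp0
  intro hcon
  apply hnot
  have hexp : pcross (M.xb e - M.xa e) (M.xK e + t • (M.xL e - M.xK e) - M.xa e)
      = pcross (M.xb e - M.xa e) (M.xK e - M.xa e)
        + t * pcross (M.xb e - M.xa e) (M.xL e - M.xK e) := by simp [pcross]; ring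
  have hpseg := openSegment_subset_segment ℝ _ _ hp
  rcases h with h | h
  · have hc : M.xK e = M.center K := by rw [xK, h]; rfl
    rw [hexp, hc, hcon, zero_add] at hp0
    have ht : t = 0 := by
      rw [← hc] at hp0
      rcases mul_eq_zero.1 hp0 with h0 | h0
      · exact h0
      · exact absurd h0 hpos.ne'
    rw [ht, zero_smul, add_zero, hc] at hpseg
    exact hpseg
  · have hc : M.xL e = M.center K := by rw [xL, h]; rfl
    have hexp2 : pcross (M.xb e - M.xa e) (M.xK e - M.xa e)
        = pcross (M.xb e - M.xa e) (M.center K - M.xa e)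
          - pcross (M.xb e - M.xa e) (M.xL e - M.xK e) := by
      rw [← hc]; simp [pcross]; ring
    rw [hexp, hexp2, hcon] at hp0
    have ht : t = 1 := by
      have h0 : (t - 1) * pcross (M.xb e - M.xa e) (M.xL e - M.xK e) = 0 := by linarith
      rcases mul_eq_zero.1 h0 with h0 | h0
      · linarith
      · exact absurd h0 hpos.ne'
    rw [ht, one_smul, add_sub_cancel, hc] at hpseg
    exact hpseg

theorem primalTriangle_nondegenerate' (hM : M.IsMesh Ω) {K : M.PCell} {e : M.Edge}
    (h : M.IsEdgeOf K e) : pcross (M.xa e - M.center K) (M.xb e - M.center K) ≠ 0 := by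
  have h1 := hM.primalTriangle_nondegenerate h
  have h2 : pcross (M.xa e - M.center K) (M.xb e - M.center K)
      = pcross (M.xb e - M.xa e) (M.center K - M.xa e) := by simp [pcross]; ring
  rwa [h2]

/-- The end points of an edge lie strictly on both sides of the dual edge. -/
theorem pcross_dual_pos (hM : M.IsMesh Ω) (e : M.Edge) :
    0 < pcross (M.xL e - M.xK e) (M.xa e - M.xK e) ∧
      pcross (M.xL e - M.xK e) (M.xb e - M.xK e) < 0 := by
  obtain ⟨p, hp, hp'⟩ := hM.diag_cross e
  have hp0 := pcross_eq_zero_of_mem_segment hp'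
  have hpos := hM.pcross_pos e
  obtain ⟨s, t, hs, ht, hst, rfl⟩ := hp
  have hs' : s = 1 - t := by linarith
  subst hs'
  have h1 : pcross (M.xL e - M.xK e) ((1 - t) • M.xa e + t • M.xb e - M.xK e)
      = pcross (M.xL e - M.xK e) (M.xa e - M.xK e)
        - t * pcross (M.xb e - M.xa e) (M.xL e - M.xK e) := by simp [pcross]; ring
  have h2 : pcross (M.xL e - M.xK e) (M.xb e - M.xK e)
      = pcross (M.xL e - M.xK e) (M.xa e - M.xK e)
        - pcross (M.xb e - M.xa e) (M.xL e - M.xK e) := by simp [pcross]; ring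
  rw [h1] at hp0
  rw [h2]
  constructor <;> nlinarith

theorem isOpen_primalTriangle (hM : M.IsMesh Ω) {K : M.PCell} {e : M.Edge} (h : M.IsEdgeOf K e) :
    IsOpen (openTriangle (M.center K) (M.xa e) (M.xb e)) :=
  isOpen_openTriangle (hM.primalTriangle_nondegenerate' h)

theorem openTriangle_subset_interior (hM : M.IsMesh Ω) {K : M.PCell} {e : M.Edge}
    (h : M.IsEdgeOf K e) :
    openTriangle (M.center K) (M.xa e) (M.xb e) ⊆ interior (M.diamond e) :=
  interior_maximal ((openTriangle_subset_convexHull _ _ _).trans (primalTriangle_subset_diamond h))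
    (hM.isOpen_primalTriangle h)

theorem disjoint_diamond_interior (hM : M.IsMesh Ω) {e e' : M.Edge} (h : e ≠ e') :
    Disjoint (M.diamond e') (interior (M.diamond e)) := by
  have hne : (interior (M.diamond e')).Nonempty :=
    (openTriangle_nonempty _ _ _).mono (hM.openTriangle_subset_interior (isEdgeOf_left e'))
  have hcl : M.diamond e' = closure (interior (M.diamond e')) := by
    rw [(convex_diamond e').closure_interior_eq_closure_of_nonempty_interior hne,
      (isClosed_diamond e').closure_eq]
  rw [hcl]
  exact (hM.diamond_disjoint h.symm).closure_left isOpen_interior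

theorem disjoint_openTriangle_seg (hM : M.IsMesh Ω) {K : M.PCell} {e : M.Edge}
    (h : M.IsEdgeOf K e) (e' : M.Edge) :
    Disjoint (openTriangle (M.center K) (M.xa e) (M.xb e)) (M.seg e') := by
  by_cases he : e = e'
  · subst he
    rw [Set.disjoint_left]
    rintro z ⟨α, β, h1, h2, h3, rfl⟩ hz
    have h0 := pcross_eq_zero_of_mem_segment hz
    have hnd := hM.primalTriangle_nondegenerate h
    have : pcross (M.xb e - M.xa e) (M.center K + α • (M.xa e - M.center K)
        + β • (M.xb e - M.center K) - M.xa e)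
        = (1 - α - β) * pcross (M.xb e - M.xa e) (M.center K - M.xa e) := by
      simp [pcross]; ring
    rw [this] at h0
    rcases mul_eq_zero.1 h0 with h0 | h0
    · linarith
    · exact hnd h0
  · exact ((hM.disjoint_diamond_interior he).mono_left (seg_subset_diamond e')).symm.mono_left
      (hM.openTriangle_subset_interior h)

theorem openTriangle_subset_cell (hM : M.IsMesh Ω) {K : M.PCell} {e : M.Edge}
    (h : M.IsEdgeOf K e) : openTriangle (M.center K) (M.xa e) (M.xb e) ⊆ M.cell K := by
  refine (convex_openTriangle _ _ _).isPreconnected.subset_of_disjoint_frontier (hM.cell_open K)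
    ?_ ?_
  · rw [hM.cell_frontier, disjoint_iUnion_right]
    exact fun e' => hM.disjoint_openTriangle_seg h e'.1
  · have h1 : M.center K ∈ closure (openTriangle (M.center K) (M.xa e) (M.xb e)) :=
      convexHull_subset_closure_openTriangle _ _ _ (subset_convexHull _ _ (by simp))
    rw [inter_comm]
    exact mem_closure_iff.1 h1 _ (hM.cell_open K) (hM.center_mem K)

theorem primalTriangle_subset_closure (hM : M.IsMesh Ω) {K : M.PCell} {e : M.Edge}
    (h : M.IsEdgeOf K e) :
    convexHull ℝ {M.center K, M.xa e, M.xb e} ⊆ closure (M.cell K) :=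
  (convexHull_subset_closure_openTriangle _ _ _).trans
    (closure_mono (hM.openTriangle_subset_cell h))

theorem exists_primalTriangle (hM : M.IsMesh Ω) {e : M.Edge} {z : Plane} (hz : z ∈ M.diamond e) :
    ∃ K, M.IsEdgeOf K e ∧ z ∈ convexHull ℝ {M.center K, M.xa e, M.xb e} := by
  obtain ⟨p, hp, hp'⟩ := hM.diag_cross e
  rcases convexHull_quadrilateral_subset (openSegment_subset_segment ℝ _ _ hp) hp' hz with h | h
  · exact ⟨M.left e, isEdgeOf_left e, h⟩
  · rcases e with i | b
    · exact ⟨M.right i, Or.inr rfl, h⟩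
    · refine ⟨M.left (.inr b), isEdgeOf_left _, ?_⟩
      refine convexHull_min ?_ (convex_convexHull _ _) h
      have hsub := subset_convexHull ℝ
        ({M.center (M.left (.inr b)), M.xa (.inr b), M.xb (.inr b)} : Set Plane)
      rintro y (rfl | rfl | rfl)
      · exact (convex_convexHull _ _).segment_subset (hsub (by simp)) (hsub (by simp))
          (xL_mem_seg_of_boundary b)
      · exact hsub (by simp)
      · exact hsub (by simp)

theorem exists_openTriangle_inter (hM : M.IsMesh Ω) {W : Set Plane} (hW : IsOpen W)
    (hWΩ : W ⊆ Ω) (hne : W.Nonempty) :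
    ∃ K e, M.IsEdgeOf K e ∧ (W ∩ openTriangle (M.center K) (M.xa e) (M.xb e)).Nonempty := by
  obtain ⟨z, hz⟩ := hne
  obtain ⟨e, he⟩ := mem_iUnion.1 (hM.diamond_cover (hWΩ hz))
  obtain ⟨K, hK, hzK⟩ := hM.exists_primalTriangle he
  exact ⟨K, e, hK, mem_closure_iff.1 (convexHull_subset_closure_openTriangle _ _ _ hzK) W hW hz⟩

/-- A cell does not reach beyond its edges, as seen from its center: a point of the cell behind an
edge would give an open triangle of the mesh, with the same apex, that crosses this edge. -/
theorem notMem_cell_of_behind (hM : M.IsMesh Ω) {K : M.PCell} {e : M.Edge} (h : M.IsEdgeOf K e)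
    {p : Plane} (hp : p ∈ M.seg e) {s : ℝ} (hs : 1 ≤ s) :
    M.center K + s • (p - M.center K) ∉ M.cell K := by
  intro hz
  set k := M.center K with hk
  set a := M.xa e with ha
  set b := M.xb e with hb
  rw [seg, segment_eq_image] at hp
  obtain ⟨τ, ⟨hτ0, hτ1⟩, rfl⟩ := hp
  simp only at hz
  set α₀ := s * (1 - τ) with hα₀
  set β₀ := s * τ with hβ₀
  have hα₀0 : 0 ≤ α₀ := mul_nonneg (by linarith) (by linarith)
  have hβ₀0 : 0 ≤ β₀ := mul_nonneg (by linarith) (by linarith)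
  have hsum : 1 ≤ α₀ + β₀ := by rw [hα₀, hβ₀]; linarith
  -- a point of the cell strictly behind the edge
  let c : ℝ → Plane := fun ε => k + (α₀ + ε) • (a - k) + (β₀ + ε) • (b - k)
  have hc : Continuous c := by fun_prop
  have hc0 : c 0 ∈ M.cell K := by
    convert hz using 1
    simp only [c, hα₀, hβ₀, ← ha, ← hb]; module
  have hopen : c ⁻¹' M.cell K ∈ nhds (0 : ℝ) := ((hM.cell_open K).preimage hc).mem_nhds hc0
  obtain ⟨ε, hε, hεc⟩ : ∃ ε : ℝ, 0 < ε ∧ c ε ∈ M.cell K := by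
    obtain ⟨r, hr, hball⟩ := Metric.mem_nhds_iff.1 hopen
    exact ⟨r / 2, by positivity, hball (by simp [abs_of_pos hr, hr])⟩
  have hdet := hM.primalTriangle_nondegenerate' h
  let A : Plane → ℝ := fun z => pcross (z - k) (b - k) / pcross (a - k) (b - k)
  let B : Plane → ℝ := fun z => pcross (a - k) (z - k) / pcross (a - k) (b - k)
  have hA : Continuous A := by simp only [A]; unfold pcross; fun_prop
  have hB : Continuous B := by simp only [B]; unfold pcross; fun_prop
  have hUo : IsOpen {z | 0 < A z ∧ 0 < B z ∧ 1 < A z + B z} :=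
    (isOpen_lt continuous_const hA).inter
      ((isOpen_lt continuous_const hB).inter (isOpen_lt continuous_const (hA.add hB)))
  have hAc : A (c ε) = α₀ + ε := by
    simp only [A, c]
    rw [div_eq_iff hdet]; simp [pcross]; ring
  have hBc : B (c ε) = β₀ + ε := by
    simp only [B, c]
    rw [div_eq_iff hdet]; simp [pcross]; ring
  obtain ⟨K', e', he', w, ⟨hwK, hA0, hB0, hAB⟩, hw⟩ := hM.exists_openTriangle_inter
    ((hM.cell_open K).inter hUo) (inter_subset_left.trans (hM.cell_subset K))
    ⟨c ε, hεc, by rw [hAc]; positivity, by rw [hBc]; positivity, by rw [hAc, hBc]; linarith⟩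
  have hKK : K' = K := by
    by_contra hne
    exact (hM.cell_disjoint hne).ne_of_mem (hM.openTriangle_subset_cell he' hw) hwK rfl
  subst hKK
  -- the segment from the center to this point crosses the edge
  have ht : 0 < 1 / (A w + B w) := by positivity
  have ht1 : 1 / (A w + B w) ≤ 1 := by
    rw [div_le_one (by positivity)]; exact hAB.le
  have hmem := openTriangle_homothety hw ht ht1
  refine (hM.disjoint_openTriangle_seg he' e).ne_of_mem hmem ?_ rfl
  have hsum0 : A w + B w ≠ 0 := by positivity
  refine ⟨A w / (A w + B w), B w / (A w + B w), by positivity, by positivity, by field_simp, ?_⟩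
  have hwc : w = k + A w • (a - k) + B w • (b - k) := coord_eq hdet
  have h5 : w - k = A w • (a - k) + B w • (b - k) := by
    nth_rewrite 1 [hwc]; abel
  rw [← hk, h5, ← ha, ← hb]
  match_scalars <;> field_simp
  ring

/-- A cell is star-shaped with respect to its center, up to its vertices. -/
theorem openSegment_subset_cell (hM : M.IsMesh Ω) {K : M.PCell} {e : M.Edge}
    (h : M.IsEdgeOf K e) {v : M.Vtx} (hv : M.src e = v ∨ M.tgt e = v) :
    openSegment ℝ (M.center K) (M.vertex v) ⊆ M.cell K := by
  have hcl : openSegment ℝ (M.center K) (M.vertex v) ⊆ closure (M.cell K) := by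
    refine Subset.trans ?_ (hM.primalTriangle_subset_closure h)
    have hsub := subset_convexHull ℝ ({M.center K, M.xa e, M.xb e} : Set Plane)
    refine (convex_convexHull _ _).openSegment_subset (hsub (by simp)) ?_
    rcases hv with rfl | rfl
    · exact hsub (by simp [xa])
    · exact hsub (by simp [xb])
  intro y hy
  by_contra hyK
  obtain ⟨e', he', hye'⟩ := hM.exists_edge_of_mem_closure (hcl hy) hyK
  rw [openSegment_eq_image'] at hy
  obtain ⟨s₀, ⟨hs0, hs1⟩, rfl⟩ := hy
  set k := M.center K with hk
  set w := M.vertex v - k with hw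
  -- all the points beyond `y` on the open segment lie on edges of the cell
  have hedge : ∀ s : Ioo s₀ 1, ∃ e : M.Edge, M.IsEdgeOf K e ∧ k + s.1 • w ∈ M.seg e := by
    rintro ⟨s, hs⟩
    have hmem : k + s • w ∈ openSegment ℝ k (M.vertex v) := by
      rw [openSegment_eq_image']; exact ⟨s, ⟨hs0.trans hs.1, hs.2⟩, rfl⟩
    refine hM.exists_edge_of_mem_closure (hcl hmem) ?_
    have := hM.notMem_cell_of_behind he' hye' (s := s / s₀) (by rw [le_div_iff₀ hs0]; linarith [hs.1])
    rw [← hk, add_sub_cancel_left, smul_smul, div_mul_cancel₀ _ hs0.ne'] at this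
    exact this
  choose E hE hEmem using hedge
  have : Infinite (Ioo s₀ (1 : ℝ)) := (Ioo_infinite hs1).to_subtype
  obtain ⟨s, t, hst, hEst⟩ := Finite.exists_ne_map_eq_of_infinite E
  have h1 := pcross_eq_zero_of_mem_segment (hEmem s)
  have h2 := pcross_eq_zero_of_mem_segment (hEmem t)
  rw [← hEst] at h2
  have hnd := hM.primalTriangle_nondegenerate (hE s)
  rw [← hk] at hnd
  have hexp : ∀ r : ℝ, pcross (M.xb (E s) - M.xa (E s)) (k + r • w - M.xa (E s))
      = pcross (M.xb (E s) - M.xa (E s)) (k - M.xa (E s))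
        + r * pcross (M.xb (E s) - M.xa (E s)) w := fun r => by
    simp [pcross]; ring
  rw [hexp] at h1 h2
  have hst' : (s : ℝ) - t ≠ 0 := sub_ne_zero.2 fun hcon => hst (Subtype.ext hcon)
  have h3 : ((s : ℝ) - t) * pcross (M.xb (E s) - M.xa (E s)) w = 0 := by linarith
  rcases mul_eq_zero.1 h3 with h3 | h3
  · exact hst' h3
  · rw [h3, mul_zero, add_zero] at h1
    exact hnd h1

theorem boundarySeg_disjoint (hM : M.IsMesh Ω) (hΩ : IsOpen Ω) (b : M.BdEdge) {z : Plane}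
    (hz : z ∈ M.seg (.inr b)) : z ∉ Ω := by
  have := hM.bdEdge_subset b hz
  rw [hΩ.frontier_eq] at this
  exact this.2

/-- The crossing point of the diagonals of a diamond. -/
def crossing (hM : M.IsMesh Ω) (e : M.Edge) : Plane := (hM.diag_cross e).choose

theorem crossing_mem (hM : M.IsMesh Ω) (e : M.Edge) :
    hM.crossing e ∈ openSegment ℝ (M.xa e) (M.xb e) := (hM.diag_cross e).choose_spec.1

theorem crossing_mem_dual (hM : M.IsMesh Ω) (e : M.Edge) : hM.crossing e ∈ M.dualSeg e :=
  (hM.diag_cross e).choose_spec.2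

/-- The vertices, centers and crossing points of the mesh. -/
def nodes (hM : M.IsMesh Ω) : Set Plane := range M.vertex ∪ range M.center ∪ range hM.crossing

theorem finite_nodes (hM : M.IsMesh Ω) : hM.nodes.Finite :=
  ((finite_range _).union (finite_range _)).union (finite_range _)

/-- A point of a triangle of a dual cell, other than a node, is interior to the diamond or lies on
a side of the diamond which links a center to the vertex of the dual cell. -/
theorem mem_interior_or_mem_side (hM : M.IsMesh Ω) (hΩ : IsOpen Ω) {e : M.Edge} {v : M.Vtx}
    (hv : M.src e = v ∨ M.tgt e = v) {z : Plane} (hzΩ : z ∈ Ω) (hzn : z ∉ hM.nodes)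
    (hz : z ∈ convexHull ℝ {M.vertex v, M.xK e, M.xL e}) :
    z ∈ interior (M.diamond e) ∨
      ∃ K, M.IsEdgeOf K e ∧ z ∈ openSegment ℝ (M.center K) (M.vertex v) := by
  simp only [nodes, mem_union, mem_range, not_or, not_exists] at hzn
  obtain ⟨⟨hzv, hzc⟩, hzp⟩ := hzn
  have hzK : ∀ K, z ≠ M.center K := fun K h => hzc K h.symm
  have hxK : M.xK e = M.center (M.left e) := rfl
  -- on the dual edge, the point lies in one of the two primal triangles
  have hdual : z ∈ segment ℝ (M.xK e) (M.xL e) → z ∈ interior (M.diamond e) := by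
    intro hzs
    have hcover : z ∈ segment ℝ (M.xK e) (hM.crossing e) ∨
        z ∈ segment ℝ (hM.crossing e) (M.xL e) := by
      have hc := hM.crossing_mem_dual e
      rw [dualSeg, segment_eq_image'] at hc
      rw [segment_eq_image'] at hzs
      obtain ⟨t, ⟨ht0, ht1⟩, ht⟩ := hc
      obtain ⟨s, ⟨hs0, hs1⟩, rfl⟩ := hzs
      simp only at ht ⊢
      rw [← ht]
      rcases le_total s t with hst | hst
      · left
        rcases ht0.eq_or_lt with h0 | h0
        · have : s = 0 := by linarith
          subst this
          rw [zero_smul, add_zero]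
          exact left_mem_segment ℝ _ _
        · rw [segment_eq_image']
          refine ⟨s / t, ⟨by positivity, (div_le_one h0).2 hst⟩, ?_⟩
          match_scalars <;> field_simp
          ring
      · right
        rcases ht1.eq_or_lt with h0 | h0
        · have : s = 1 := by linarith
          subst this
          rw [one_smul, add_sub_cancel]
          exact right_mem_segment ℝ _ _
        · have h0' : 0 < 1 - t := by linarith
          have h0'' : 1 - t ≠ 0 := h0'.ne'
          rw [segment_eq_image']
          refine ⟨(s - t) / (1 - t), ⟨div_nonneg (by linarith) h0'.le,
            (div_le_one h0').2 (by linarith)⟩, ?_⟩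
          match_scalars <;> field_simp <;> ring
    rcases hcover with h | h
    · have h1 := mem_openSegment_of_mem_segment h (hzK _) fun h => hzp e h.symm
      exact hM.openTriangle_subset_interior (isEdgeOf_left e)
        (openSegment_subset_openTriangle (hM.crossing_mem e) h1)
    · rcases e with i | b
      · have h1 := mem_openSegment_of_mem_segment h (fun h => hzp _ h.symm) (hzK (M.right i))
        rw [openSegment_symm] at h1
        exact hM.openTriangle_subset_interior (K := M.right i) (Or.inr rfl)
          (openSegment_subset_openTriangle (hM.crossing_mem _) h1)
      · exact absurd hzΩ (hM.boundarySeg_disjoint hΩ b ((convex_segment _ _).segment_subset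
          (openSegment_subset_segment ℝ _ _ (hM.crossing_mem _)) (xL_mem_seg_of_boundary b) h))
  obtain ⟨α, β, γ, hα, hβ, hγ, hsum, hzeq⟩ := mem_convexHull_triple.1 hz
  rcases hα.eq_or_lt with hα0 | hα0
  · left
    refine hdual ⟨β, γ, hβ, hγ, by linarith, ?_⟩
    rw [hzeq, ← hα0, zero_smul, zero_add]
  rcases hγ.eq_or_lt with hγ0 | hγ0
  · right
    refine ⟨M.left e, isEdgeOf_left e, mem_openSegment_of_mem_segment ⟨β, α, hβ, hα, by linarith, ?_⟩
      (hzK _) fun h => hzv v h.symm⟩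
    rw [hzeq, ← hγ0, zero_smul, add_zero, add_comm, hxK]
  rcases hβ.eq_or_lt with hβ0 | hβ0
  · have hseg : z ∈ segment ℝ (M.xL e) (M.vertex v) := by
      refine ⟨γ, α, hγ, hα, by linarith, ?_⟩
      rw [hzeq, ← hβ0, zero_smul, add_zero, add_comm]
    rcases e with i | b
    · right
      exact ⟨M.right i, Or.inr rfl, mem_openSegment_of_mem_segment hseg (hzK _)
        fun h => hzv v h.symm⟩
    · exact absurd hzΩ (hM.boundarySeg_disjoint hΩ b ((convex_segment _ _).segment_subset
        (xL_mem_seg_of_boundary b) (vertex_mem_seg hv) hseg))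
  · left
    have hnd : pcross (M.xK e - M.vertex v) (M.xL e - M.vertex v) ≠ 0 := by
      have hexp : pcross (M.xK e - M.vertex v) (M.xL e - M.vertex v)
          = pcross (M.xL e - M.xK e) (M.vertex v - M.xK e) := by simp [pcross]; ring
      rw [hexp]
      rcases hv with rfl | rfl
      · exact (hM.pcross_dual_pos e).1.ne'
      · exact (hM.pcross_dual_pos e).2.ne
    refine interior_maximal ((openTriangle_subset_convexHull _ _ _).trans
      (dualTriangle_subset_diamond hv)) (isOpen_openTriangle hnd) ⟨β, γ, hβ0, hγ0, by linarith, ?_⟩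
    have : α = 1 - β - γ := by linarith
    rw [hzeq, this]
    module

/-- Two dual cells that meet at a point of `Ω`, other than a node, are the two dual cells of a
diamond containing this point. -/
theorem dualCell_inter (hM : M.IsMesh Ω) (hΩ : IsOpen Ω) {v w : M.Vtx} {z : Plane} (hzΩ : z ∈ Ω)
    (hzn : z ∉ hM.nodes) (hzv : z ∈ M.dualCell v) (hzw : z ∈ M.dualCell w) :
    v = w ∨ ∃ e, z ∈ M.diamond e ∧ ((M.src e = v ∧ M.tgt e = w) ∨ (M.src e = w ∧ M.tgt e = v)) := by
  obtain ⟨⟨e, hev⟩, hze⟩ := mem_iUnion.1 hzv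
  obtain ⟨⟨e', hew⟩, hze'⟩ := mem_iUnion.1 hzw
  simp only at hze hze'
  have hD := dualTriangle_subset_diamond hev hze
  have hD' := dualTriangle_subset_diamond hew hze'
  by_cases hee : e = e'
  · subst hee
    rcases hev with h1 | h1 <;> rcases hew with h2 | h2
    · exact Or.inl (h1.symm.trans h2)
    · exact Or.inr ⟨e, hD, Or.inl ⟨h1, h2⟩⟩
    · exact Or.inr ⟨e, hD, Or.inr ⟨h2, h1⟩⟩
    · exact Or.inl (h1.symm.trans h2)
  left
  rcases hM.mem_interior_or_mem_side hΩ hev hzΩ hzn hze with h | ⟨K, hK, hzK⟩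
  · exact absurd rfl ((hM.disjoint_diamond_interior hee).ne_of_mem hD' h)
  rcases hM.mem_interior_or_mem_side hΩ hew hzΩ hzn hze' with h | ⟨K', hK', hzK'⟩
  · exact absurd rfl ((hM.disjoint_diamond_interior (Ne.symm hee)).ne_of_mem hD h)
  have hKK : K = K' := by
    by_contra hne
    exact (hM.cell_disjoint hne).ne_of_mem (hM.openSegment_subset_cell hK hev hzK)
      (hM.openSegment_subset_cell hK' hew hzK') rfl
  subst hKK
  -- both vertices lie on the ray from the center through `z`, none of them strictly behind the other
  have hray : ∀ {e₁ e₂ : M.Edge} {v₁ v₂ : M.Vtx} {s t : ℝ}, M.IsEdgeOf K e₁ → M.IsEdgeOf K e₂ →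
      (M.src e₁ = v₁ ∨ M.tgt e₁ = v₁) → (M.src e₂ = v₂ ∨ M.tgt e₂ = v₂) → 0 < s → s < t →
      s • (M.vertex v₁ - M.center K) = t • (M.vertex v₂ - M.center K) → False := by
    intro e₁ e₂ v₁ v₂ s t h₁ h₂ hv₁ hv₂ hs hst heq
    refine hM.disjoint_cell_frontier K (hM.seg_subset_frontier h₂ (vertex_mem_seg hv₂))
      (hM.openSegment_subset_cell h₁ hv₁ ?_)
    have ht : 0 < t := hs.trans hst
    rw [openSegment_eq_image']
    refine ⟨s / t, ⟨by positivity, (div_lt_one ht).2 hst⟩, ?_⟩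
    have : (s / t) • (M.vertex v₁ - M.center K) = M.vertex v₂ - M.center K := by
      rw [div_eq_inv_mul, mul_smul, heq, smul_smul, inv_mul_cancel₀ ht.ne', one_smul]
    simp only [this, add_sub_cancel]
  rw [openSegment_eq_image'] at hzK hzK'
  obtain ⟨s, ⟨hs0, -⟩, hs⟩ := hzK
  obtain ⟨t, ⟨ht0, -⟩, ht⟩ := hzK'
  have heq : s • (M.vertex v - M.center K) = t • (M.vertex w - M.center K) :=
    add_left_cancel (hs.trans ht.symm)
  rcases lt_trichotomy s t with hst | hst | hst
  · exact (hray hK hK' hev hew hs0 hst heq).elim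
  · subst hst
    have := smul_right_injective Plane hs0.ne' heq
    exact hM.vertex_injective (sub_left_injective this)
  · exact (hray hK' hK hew hev ht0 hst heq.symm).elim

/-- Two primal cells whose closures meet at a point other than a node are the two cells of a
diamond containing this point. -/
theorem closure_cell_inter (hM : M.IsMesh Ω) {K L : M.PCell} {z : Plane}
    (hzn : z ∉ hM.nodes) (hzK : z ∈ closure (M.cell K)) (hzL : z ∈ closure (M.cell L)) :
    K = L ∨ ∃ e, z ∈ M.diamond e ∧ ((M.cellK e = .inl K ∧ M.cellL e = .inl L) ∨
      (M.cellK e = .inl L ∧ M.cellL e = .inl K)) := by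
  by_cases hKL : K = L
  · exact Or.inl hKL
  right
  have hzK' : z ∉ M.cell K := fun h =>
    ((hM.cell_disjoint hKL).closure_right (hM.cell_open K)).ne_of_mem h hzL rfl
  have hzL' : z ∉ M.cell L := fun h =>
    ((hM.cell_disjoint (Ne.symm hKL)).closure_right (hM.cell_open L)).ne_of_mem h hzK rfl
  obtain ⟨e, he, hze⟩ := hM.exists_edge_of_mem_closure hzK hzK'
  obtain ⟨e', he', hze'⟩ := hM.exists_edge_of_mem_closure hzL hzL'
  have hv : ∀ v, z ≠ M.vertex v := fun v h => hzn (Or.inl (Or.inl ⟨v, h.symm⟩))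
  have hee : e = e' := by
    by_contra hne
    exact (hM.edge_inter e e' hne).ne_of_mem
      (mem_openSegment_of_mem_segment hze (hv _) (hv _)) hze' rfl
  subst hee
  refine ⟨e, seg_subset_diamond e hze, ?_⟩
  rcases he with h1 | h1 <;> rcases he' with h2 | h2
  · exact absurd (Sum.inl_injective (h1.symm.trans h2)) hKL
  · exact Or.inl ⟨h1, h2⟩
  · exact Or.inr ⟨h2, h1⟩
  · exact absurd (Sum.inl_injective (h1.symm.trans h2)) hKL

/-! ### The primal and the dual partition -/

theorem aedisjoint_diamond (hM : M.IsMesh Ω) :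
    Pairwise fun e e' => AEDisjoint volume (M.diamond e) (M.diamond e') := by
  intro e e' h
  refine measure_mono_null ?_ ((convex_diamond e).addHaar_frontier volume)
  intro z hz
  exact ⟨subset_closure hz.1, fun hz' => (hM.disjoint_diamond_interior h).ne_of_mem hz.2 hz' rfl⟩

theorem aedisjoint_dualCell (hM : M.IsMesh Ω) :
    Pairwise fun v w => AEDisjoint volume (M.dualCell v) (M.dualCell w) := by
  intro v w hvw
  rw [dualCell, AEDisjoint.iUnion_left_iff]
  rintro ⟨e, he⟩
  rw [dualCell, AEDisjoint.iUnion_right_iff]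
  rintro ⟨e', he'⟩
  by_cases hee : e = e'
  · subst hee
    have hne : M.xL e - M.xK e ≠ 0 := fun h => by
      have := hM.pcross_pos e
      rw [h] at this
      simp [pcross] at this
    refine measure_mono_null ?_ (volume_pcross_eq_zero hne (M.xK e))
    have hsign : ∀ {u : M.Vtx} {z : Plane}, z ∈ convexHull ℝ {M.vertex u, M.xK e, M.xL e} →
        ∃ α : ℝ, 0 ≤ α ∧ pcross (M.xL e - M.xK e) (z - M.xK e)
          = α * pcross (M.xL e - M.xK e) (M.vertex u - M.xK e) := by
      intro u z hz
      obtain ⟨α, β, γ, hα, -, -, hsum, rfl⟩ := mem_convexHull_triple.1 hz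
      refine ⟨α, hα, ?_⟩
      have : β = 1 - α - γ := by linarith
      subst this
      simp [pcross]; ring
    rintro z ⟨hz, hz'⟩
    obtain ⟨α, hα, h1⟩ := hsign hz
    obtain ⟨β, hβ, h2⟩ := hsign hz'
    obtain ⟨ha, hb⟩ := hM.pcross_dual_pos e
    change pcross (M.xL e - M.xK e) (z - M.xK e) = 0
    rcases he with rfl | rfl <;> rcases he' with rfl | rfl
    · exact absurd rfl hvw
    · exact le_antisymm (h2 ▸ mul_nonpos_of_nonneg_of_nonpos hβ hb.le) (h1 ▸ mul_nonneg hα ha.le)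
    · exact le_antisymm (h1 ▸ mul_nonpos_of_nonneg_of_nonpos hα hb.le) (h2 ▸ mul_nonneg hβ ha.le)
    · exact absurd rfl hvw
  · exact (hM.aedisjoint_diamond hee).mono (dualTriangle_subset_diamond he)
      (dualTriangle_subset_diamond he')

theorem dualCell_subset (hM : M.IsMesh Ω) (v : M.Vtx) : M.dualCell v ⊆ closure Ω :=
  iUnion_subset fun e => (dualTriangle_subset_diamond e.2).trans (hM.diamond_subset e.1)

theorem dualCell_cover (hM : M.IsMesh Ω) : Ω ⊆ ⋃ v, M.dualCell v := by
  intro z hz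
  obtain ⟨e, he⟩ := mem_iUnion.1 (hM.diamond_cover hz)
  have heq : M.diamond e = convexHull ℝ {M.xa e, M.xK e, M.xb e, M.xL e} := by
    rw [diamond]
    congr 1
    ext y
    simp only [mem_insert_iff, mem_singleton_iff]
    tauto
  rw [heq] at he
  rcases convexHull_quadrilateral_subset (hM.crossing_mem_dual e)
    (openSegment_subset_segment ℝ _ _ (hM.crossing_mem e)) he with h | h
  · exact mem_iUnion.2 ⟨M.src e, mem_iUnion.2 ⟨⟨e, Or.inl rfl⟩, h⟩⟩
  · exact mem_iUnion.2 ⟨M.tgt e, mem_iUnion.2 ⟨⟨e, Or.inr rfl⟩, h⟩⟩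

theorem volume_diff_cells (hM : M.IsMesh Ω) : volume (Ω \ ⋃ K, M.cell K) = 0 := by
  refine measure_mono_null (t := ⋃ e, M.seg e) ?_
    (measure_iUnion_null fun e => volume_segment_eq_zero _ _)
  rintro z ⟨hz, hz'⟩
  obtain ⟨K, hK⟩ := mem_iUnion.1 (hM.cell_cover hz)
  obtain ⟨e, -, he⟩ := hM.exists_edge_of_mem_closure hK fun h => hz' (mem_iUnion.2 ⟨K, h⟩)
  exact mem_iUnion.2 ⟨e, he⟩

theorem volume_cell_pos (hM : M.IsMesh Ω) (hb : Bornology.IsBounded Ω) (K : M.PCell) :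
    0 < volume.real (M.cell K) :=
  ENNReal.toReal_pos ((hM.cell_open K).measure_pos volume ⟨_, hM.center_mem K⟩).ne'
    (hb.subset (hM.cell_subset K)).measure_lt_top.ne

theorem volume_dualCell_pos (hM : M.IsMesh Ω) (v : M.Vtx) :
    0 < volume.real (M.dualCell v) := by
  obtain ⟨e, he⟩ := hM.vertex_used v
  have hnd : pcross (M.xK e - M.vertex v) (M.xL e - M.vertex v) ≠ 0 := by
    have hexp : pcross (M.xK e - M.vertex v) (M.xL e - M.vertex v)
        = pcross (M.xL e - M.xK e) (M.vertex v - M.xK e) := by simp [pcross]; ring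
    rw [hexp]
    rcases he with rfl | rfl
    · exact (hM.pcross_dual_pos e).1.ne'
    · exact (hM.pcross_dual_pos e).2.ne
  refine ENNReal.toReal_pos (fun h0 => ?_) (isCompact_dualCell v).measure_lt_top.ne
  refine ((isOpen_openTriangle hnd).measure_pos volume (openTriangle_nonempty _ _ _)).ne'
    (measure_mono_null ?_ h0)
  exact (openTriangle_subset_convexHull _ _ _).trans
    (subset_iUnion (fun e : {e : M.Edge // M.src e = v ∨ M.tgt e = v} =>
      convexHull ℝ {M.vertex v, M.xK e.1, M.xL e.1}) ⟨e, he⟩)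

end IsMesh

end DDFVData

/-! ### Jumps of the discrete functions on a regular mesh -/

/-- Two values linked by a chain differ by at most the total length of the intervals crossed, each
interval being counted once even if the chain crosses it repeatedly. -/
theorem abs_sub_le_sum_of_reflTransGen {ι E : Type*} (Q : Finset E) (h : ι → ℝ) (p q : E → ℝ)
    {R : ι → ι → Prop} (hR : ∀ i j, R i j → ∃ e ∈ Q, uIcc (h i) (h j) ⊆ uIcc (p e) (q e))
    {i j : ι} (hij : Relation.ReflTransGen R i j) :
    |h i - h j| ≤ ∑ e ∈ Q, |p e - q e| := by
  have hcover : uIcc (h i) (h j) ⊆ {h i} ∪ ⋃ e ∈ Q, uIcc (p e) (q e) := by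
    induction hij with
    | refl => simp
    | @tail k l _ hkl ih =>
      obtain ⟨e, he, hsub⟩ := hR k l hkl
      refine uIcc_subset_uIcc_union_uIcc.trans (union_subset ih ?_)
      exact hsub.trans ((subset_biUnion_of_mem (u := fun e => uIcc (p e) (q e)) he).trans
        subset_union_right)
  have h1 := (measure_mono (μ := volume) hcover).trans (measure_union_le _ _)
  rw [Real.volume_singleton, zero_add, Real.volume_interval] at h1
  have h2 := h1.trans (measure_biUnion_finset_le Q _)
  simp only [Real.volume_interval] at h2
  rw [← ENNReal.ofReal_sum_of_nonneg fun _ _ => abs_nonneg _,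
    ENNReal.ofReal_le_ofReal_iff (Finset.sum_nonneg fun _ _ => abs_nonneg _)] at h2
  simpa only [abs_sub_comm] using h2

/-- Almost every segment avoids a given finite set. -/
theorem ae_disjoint_segment {B : Set Plane} (hB : B.Finite) (μ : Measure Plane)
    (hμ : μ ≪ volume) : ∀ᵐ x ∂μ, ∀ᵐ y ∂μ, Disjoint (segment ℝ x y) B := by
  filter_upwards [hμ.ae_le (measure_eq_zero_iff_ae_notMem.1 (hB.measure_zero volume))] with x hx
  have h1 : ∀ᵐ y ∂μ, ∀ b ∈ B, pcross (b - x) (y - x) ≠ 0 := by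
    rw [ae_ball_iff hB.countable]
    intro b hb
    have hbx : b - x ≠ 0 := fun h => hx (by rwa [← sub_eq_zero.1 h])
    exact hμ.ae_le (measure_eq_zero_iff_ae_notMem.1 (volume_pcross_eq_zero hbx x))
  filter_upwards [h1] with y hy
  rw [Set.disjoint_left]
  intro b hb hbB
  apply hy b hbB
  rw [segment_eq_image'] at hb
  obtain ⟨t, -, rfl⟩ := hb
  simp [pcross]; ring

theorem IsPolygonalDomain.volume_frontier {Ω : Set Plane} (hΩ : IsPolygonalDomain Ω) :
    volume (frontier Ω) = 0 := by
  obtain ⟨S, hS⟩ := hΩ.polygonal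
  rw [hS]
  exact (measure_biUnion_null_iff S.countable_toSet).2 fun s _ => volume_segment_eq_zero _ _

theorem IsPolygonalDomain.ae_le_of_subset_closure {Ω : Set Plane} (hΩ : IsPolygonalDomain Ω)
    {s : Set Plane} (hs : s ⊆ closure Ω) : s ≤ᵐ[volume] Ω := by
  refine ae_le_set.2 (measure_mono_null ?_ hΩ.volume_frontier)
  rw [hΩ.isOpen.frontier_eq]
  exact sdiff_subset_sdiff_left hs

namespace DDFVData

variable {M : DDFVData} {Ω : Set Plane} {Θ : ℝ}

theorem mσ_eq_norm (e : M.Edge) : M.mσ e = ‖M.xb e - M.xa e‖ := by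
  rw [mσ, dist_comm, dist_eq_norm]

theorem mσs_eq_norm (e : M.Edge) : M.mσs e = ‖M.xL e - M.xK e‖ := by
  rw [mσs, dist_comm, dist_eq_norm]

namespace IsMesh

theorem mσ_pos (hM : M.IsMesh Ω) (e : M.Edge) : 0 < M.mσ e := by
  rw [mσ_eq_norm, norm_pos_iff]
  intro h
  have := hM.pcross_pos e
  rw [h] at this
  simp [pcross] at this

theorem mσs_pos (hM : M.IsMesh Ω) (e : M.Edge) : 0 < M.mσs e := by
  rw [mσs_eq_norm, norm_pos_iff]
  intro h
  have := hM.pcross_pos e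
  rw [h] at this
  simp [pcross] at this

theorem sin_angleD (hM : M.IsMesh Ω) (e : M.Edge) :
    Real.sin (M.angleD e) * (M.mσs e * M.mσ e) = pcross (M.xb e - M.xa e) (M.xL e - M.xK e) := by
  rw [mσ_eq_norm, mσs_eq_norm, angleD, InnerProductGeometry.sin_angle_mul_norm_mul_norm,
    ← Real.sqrt_sq (hM.pcross_pos e).le]
  congr 1
  have h1 := pcross_sq_add_inner_sq (M.xb e - M.xa e) (M.xL e - M.xK e)
  rw [real_inner_self_eq_norm_sq, real_inner_self_eq_norm_sq,
    real_inner_comm (M.xb e - M.xa e) (M.xL e - M.xK e)]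
  nlinarith

/-- On a regular mesh, the angle of the diagonals of a diamond is bounded away from zero and their
lengths are comparable. -/
theorem regular_bounds (hM : M.IsMesh Ω) (hreg : M.IsRegular Ω Θ) (hΘ : 1 ≤ Θ) (e : M.Edge) :
    M.mσ e * M.mσs e ≤ Θ * pcross (M.xb e - M.xa e) (M.xL e - M.xK e) ∧
      M.mσ e ≤ 2 * Θ * M.mσs e ∧ M.mσs e ≤ 2 * Θ * M.mσ e := by
  have hs := hM.mσ_pos e
  have ht := hM.mσs_pos e
  have hsin := hM.sin_angleD e
  have hpos := hM.pcross_pos e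
  have hθ := hreg.theta_le e
  rw [thetaD] at hθ
  set s := M.mσ e
  set t := M.mσs e
  set S := Real.sin (M.angleD e)
  have hS : 0 < S := by
    by_contra h
    have : S * (t * s) ≤ 0 := mul_nonpos_of_nonpos_of_nonneg (not_lt.1 h) (by positivity)
    linarith
  have hS1 : S ≤ 1 := Real.sin_le_one _
  have h1 : s / t + t / s ≤ Θ * (2 * S) := by
    rwa [one_div, inv_mul_le_iff₀ (by positivity), mul_comm (2 * S)] at hθ
  have h2 : s ^ 2 + t ^ 2 ≤ Θ * (2 * S) * (s * t) := by
    have h3 : s ^ 2 + t ^ 2 = (s / t + t / s) * (s * t) := by field_simp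
    rw [h3]
    gcongr
  have hst : 0 < s * t := mul_pos hs ht
  have h4 : Θ * (2 * S) * (s * t) ≤ 2 * Θ * (s * t) := by
    have : Θ * (2 * S) ≤ 2 * Θ := by nlinarith
    gcongr
  refine ⟨?_, ?_, ?_⟩
  · rw [← hsin]
    nlinarith [sq_nonneg (s - t)]
  · by_contra hlt
    push Not at hlt
    nlinarith [mul_lt_mul_of_pos_left hlt hs, sq_nonneg t]
  · by_contra hlt
    push Not at hlt
    nlinarith [mul_lt_mul_of_pos_left hlt ht, sq_nonneg s]

/-- The square of the size of a diamond is controlled by the product of its diagonals. -/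
theorem sq_diam_le (hM : M.IsMesh Ω) (hreg : M.IsRegular Ω Θ) (hΘ : 1 ≤ Θ) (e : M.Edge) :
    (M.mσ e + M.mσs e) ^ 2 ≤ (4 * Θ + 2) * (M.mσ e * M.mσs e) := by
  obtain ⟨-, h2, h3⟩ := hM.regular_bounds hreg hΘ e
  nlinarith [mul_le_mul_of_nonneg_left h2 (hM.mσ_pos e).le,
    mul_le_mul_of_nonneg_left h3 (hM.mσs_pos e).le]

theorem area_diamond (hM : M.IsMesh Ω) (hreg : M.IsRegular Ω Θ) (hΘ : 1 ≤ Θ) (e : M.Edge) :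
    (M.mσ e + M.mσs e) ^ 2 ≤ 4 * Θ * (4 * Θ + 2) * M.mD e := by
  obtain ⟨h1, -, -⟩ := hM.regular_bounds hreg hΘ e
  have h2 := hM.sq_diam_le hreg hΘ e
  have h3 := pcross_le_volume_of_convex (convex_diamond e) (isCompact_diamond e).measure_lt_top.ne
    (xa_mem_diamond e) (xb_mem_diamond e) (xK_mem_diamond e) (xL_mem_diamond e)
  rw [abs_of_pos (hM.pcross_pos e)] at h3
  calc (M.mσ e + M.mσs e) ^ 2 ≤ (4 * Θ + 2) * (M.mσ e * M.mσs e) := h2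
    _ ≤ (4 * Θ + 2) * (Θ * pcross (M.xb e - M.xa e) (M.xL e - M.xK e)) := by gcongr
    _ ≤ (4 * Θ + 2) * (Θ * (4 * M.mD e)) := by
        gcongr
        exact h3
    _ = _ := by ring

theorem diamond_subset_closedBall (hM : M.IsMesh Ω) (e : M.Edge) :
    M.diamond e ⊆ Metric.closedBall (M.xK e) (M.mσ e + M.mσs e) := by
  have hs := hM.mσ_pos e
  have ht := hM.mσs_pos e
  have hpa : ∀ p ∈ M.seg e, dist (M.xa e) p ≤ M.mσ e ∧ dist (M.xb e) p ≤ M.mσ e := by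
    intro p hp
    rw [seg, segment_eq_image_lineMap] at hp
    obtain ⟨r, ⟨hr0, hr1⟩, rfl⟩ := hp
    rw [dist_left_lineMap, dist_right_lineMap, Real.norm_of_nonneg hr0,
      Real.norm_of_nonneg (by linarith : 0 ≤ 1 - r)]
    change r * M.mσ e ≤ M.mσ e ∧ (1 - r) * M.mσ e ≤ M.mσ e
    constructor <;> nlinarith
  have hpk : dist (hM.crossing e) (M.xK e) ≤ M.mσs e := by
    have := hM.crossing_mem_dual e
    rw [dualSeg, segment_eq_image_lineMap] at this
    obtain ⟨r, ⟨hr0, hr1⟩, hr⟩ := this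
    rw [← hr, dist_lineMap_left, Real.norm_of_nonneg hr0]
    change r * M.mσs e ≤ M.mσs e
    nlinarith
  obtain ⟨h1, h2⟩ := hpa _ (openSegment_subset_segment ℝ _ _ (hM.crossing_mem e))
  refine convexHull_min ?_ (convex_closedBall _ _)
  rintro z (rfl | rfl | rfl | rfl)
  · exact Metric.mem_closedBall_self (by positivity)
  · exact (dist_triangle _ _ _).trans (add_le_add h1 hpk)
  · rw [Metric.mem_closedBall, dist_comm]
    change M.mσs e ≤ _
    linarith
  · exact (dist_triangle _ _ _).trans (add_le_add h2 hpk)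

end IsMesh

/-- A partition of `Ω`, up to a null set, with a value `h i` on each piece `F i`, such that the
difference of two values is controlled by the jumps `jump e` through the diamonds met by a segment
that links the two pieces. -/
structure IsControlledPartition (hM : M.IsMesh Ω) {ι : Type} (F : ι → Set Plane) (h : ι → ℝ)
    (jump : M.Edge → ℝ) : Prop where
  measurableSet : ∀ i, MeasurableSet (F i)
  aedisjoint : Pairwise fun i j => AEDisjoint volume (F i) (F j)
  cover : (⋃ i, F i) =ᵐ[volume] Ω
  jump_nonneg : ∀ e, 0 ≤ jump e
  jump_bound : ∀ x y : Plane, segment ℝ x y ⊆ Ω → Disjoint (segment ℝ x y) hM.nodes →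
    ∀ i j, x ∈ F i → y ∈ F j → |h i - h j|
      ≤ ∑ e, {z : Plane | (segment ℝ x z ∩ M.diamond e).Nonempty}.indicator (fun _ => jump e) y

namespace IsControlledPartition

variable {hM : M.IsMesh Ω} {ι : Type} {F : ι → Set Plane} {h : ι → ℝ} {jump : M.Edge → ℝ}

variable [Fintype ι]

/-- The piecewise constant function with value `h i` on `F i`. -/
def stepFun (F : ι → Set Plane) (h : ι → ℝ) (x : Plane) : ℝ :=
  ∑ i, (F i).indicator (fun _ => h i) x

theorem ae_stepFun_eq (hP : IsControlledPartition hM F h jump) :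
    ∀ᵐ x, ∀ i, x ∈ F i → stepFun F h x = h i := by
  have h1 : ∀ᵐ x, ∀ i j, i ≠ j → ¬(x ∈ F i ∧ x ∈ F j) := by
    rw [ae_all_iff]; intro i
    rw [ae_all_iff]; intro j
    by_cases hij : i = j
    · simp [hij]
    · filter_upwards [measure_eq_zero_iff_ae_notMem.1 (hP.aedisjoint hij)] with x hx _
      exact hx
  filter_upwards [h1] with x hx i hi
  rw [stepFun, Finset.sum_eq_single i]
  · exact indicator_of_mem hi _
  · intro j _ hji
    exact indicator_of_notMem (fun hj => hx j i hji ⟨hj, hi⟩) _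
  · simp

/-- The jump system carried by the diamonds of a regular mesh. -/
def jumpSystem (hP : IsControlledPartition hM F h jump) (hreg : M.IsRegular Ω Θ) (hΘ : 1 ≤ Θ) :
    JumpSystem Ω (4 * Θ * (4 * Θ + 2)) where
  ι := M.Edge
  D := M.diamond
  c := M.xK
  d e := M.mσ e + M.mσs e
  d_pos e := add_pos (hM.mσ_pos e) (hM.mσs_pos e)
  c_mem e := hM.diamond_subset e (xK_mem_diamond e)
  subset_ball := hM.diamond_subset_closedBall
  subset_closure := hM.diamond_subset
  measurableSet e := (isClosed_diamond e).measurableSet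
  aedisjoint := hM.aedisjoint_diamond
  area := hM.area_diamond hreg hΘ
  f := stepFun F h
  measurable := Finset.measurable_sum _ fun i _ => measurable_const.indicator (hP.measurableSet i)
  bounded := by
    refine ⟨∑ i, |h i|, fun x => (Finset.abs_sum_le_sum_abs _ _).trans
      (Finset.sum_le_sum fun i _ => ?_)⟩
    by_cases hx : x ∈ F i
    · rw [indicator_of_mem hx]
    · rw [indicator_of_notMem hx, abs_zero]; positivity
  jump := jump
  jump_nonneg := hP.jump_nonneg
  jump_bound := by
    have hval : ∀ᵐ x ∂(volume.restrict Ω), ∃ i, x ∈ F i ∧ stepFun F h x = h i := by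
      have h1 : ∀ᵐ x ∂(volume.restrict Ω), x ∈ ⋃ i, F i := by
        rw [← Measure.restrict_congr_set hP.cover]
        exact ae_restrict_mem (MeasurableSet.iUnion hP.measurableSet)
      filter_upwards [h1, ae_restrict_of_ae hP.ae_stepFun_eq] with x hx hx'
      obtain ⟨i, hi⟩ := mem_iUnion.1 hx
      exact ⟨i, hi, hx' i hi⟩
    filter_upwards [hval, ae_disjoint_segment hM.finite_nodes (volume.restrict Ω)
      Measure.restrict_le_self.absolutelyContinuous] with x ⟨i, hi, hxi⟩ hx
    filter_upwards [hval, hx] with y ⟨j, hj, hyj⟩ hy hseg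
    rw [hxi, hyj]
    exact hP.jump_bound x y hseg hy i j hi hj

theorem setIntegral_eq_sum (hP : IsControlledPartition hM F h jump) {g : Plane → ℝ}
    (hg : IntegrableOn g Ω) : ∫ x in Ω, g x = ∑ i, ∫ x in F i, g x := by
  rw [← setIntegral_congr_set hP.cover, integral_iUnion_ae
    (fun i => (hP.measurableSet i).nullMeasurableSet) hP.aedisjoint, tsum_fintype]
  exact hg.congr_set_ae hP.cover

theorem sum_volume (hP : IsControlledPartition hM F h jump) (hb : Bornology.IsBounded Ω) :
    ∑ i, volume.real (F i) = volume.real Ω := by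
  have h1 := hP.setIntegral_eq_sum (g := fun _ => (1 : ℝ))
    (integrableOn_const hb.measure_lt_top.ne)
  simpa only [setIntegral_const, smul_eq_mul, mul_one] using h1.symm

end IsControlledPartition

/-- The `χ²` bound for the discrete functions: the constant depends on the domain and on the
regularity of the mesh only. -/
theorem exists_discrete_chi_square_bound (hΩ : IsPolygonalDomain Ω) (hΘ : 1 ≤ Θ) :
    ∃ A : ℝ, 0 < A ∧ ∀ (M : DDFVData) (hM : M.IsMesh Ω), M.IsRegular Ω Θ →
      ∀ (ι : Type) [Fintype ι] (F : ι → Set Plane) (h : ι → ℝ) (jump : M.Edge → ℝ),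
      IsControlledPartition hM F h jump → ∀ ε : ℝ, 0 < ε → ∃ t : ℝ, 0 < t ∧
        ∑ i, volume.real (F i) * ((h i ^ 2 - t) ^ 2 / t) ≤ A * (∑ e, jump e ^ 2 + ε) := by
  have hκ : 0 < 4 * Θ * (4 * Θ + 2) := by positivity
  obtain ⟨A, hA, hchi⟩ := hΩ.exists_chi_square_bound hκ
  refine ⟨A, hA, fun M hM hreg ι _ F h jump hP ε hε => ?_⟩
  obtain ⟨t, ht, hle⟩ := hchi (hP.jumpSystem hreg hΘ) ε hε
  refine ⟨t, ht, le_trans (le_of_eq ?_) hle⟩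
  change _ = ∫ x in Ω, (IsControlledPartition.stepFun F h x ^ 2 - t) ^ 2 / t
  obtain ⟨B, hB⟩ := (hP.jumpSystem hreg hΘ).bounded
  have hint : IntegrableOn (fun x => (IsControlledPartition.stepFun F h x ^ 2 - t) ^ 2 / t) Ω := by
    refine Measure.integrableOn_of_bounded (M := (B ^ 2 + t) ^ 2 / t)
      hΩ.isBounded.measure_lt_top.ne ?_ (Filter.Eventually.of_forall fun x => ?_)
    · exact ((((hP.jumpSystem hreg hΘ).measurable.pow_const 2).sub_const t).pow_const 2
        |>.div_const t).aestronglyMeasurable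
    · have h1 : IsControlledPartition.stepFun F h x ^ 2 ≤ B ^ 2 := sq_le_sq' (by
        linarith [neg_abs_le (IsControlledPartition.stepFun F h x),
          show |IsControlledPartition.stepFun F h x| ≤ B from hB x]) ((le_abs_self _).trans (hB x))
      have h2 := sq_nonneg (IsControlledPartition.stepFun F h x)
      rw [Real.norm_of_nonneg (by positivity)]
      refine div_le_div_of_nonneg_right (sq_le_sq' ?_ ?_) ht.le <;> linarith
  rw [hP.setIntegral_eq_sum hint]
  refine Finset.sum_congr rfl fun i _ => ?_
  rw [← smul_eq_mul, ← setIntegral_const]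
  refine integral_congr_ae ?_
  filter_upwards [ae_restrict_of_ae hP.ae_stepFun_eq, ae_restrict_mem (hP.measurableSet i)]
    with x hx hxi
  rw [hx i hxi]

/-- The jumps of a function of the unknowns through the diamonds, on the primal cells. -/
def primalJump (h : M.Unk → ℝ) (e : M.Edge) : ℝ :=
  |h (.inl (M.cellK e)) - h (.inl (M.cellL e))|

/-- The jumps of a function of the unknowns through the diamonds, on the dual cells. -/
def dualJump (h : M.Unk → ℝ) (e : M.Edge) : ℝ := |h (.inr (M.src e)) - h (.inr (M.tgt e))|

open Classical in
theorem sum_indicator_eq (S : Plane → M.Edge → Prop) (jump : M.Edge → ℝ) (y : Plane) :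
    ∑ e, {z : Plane | S z e}.indicator (fun _ => jump e) y
      = ∑ e ∈ Finset.univ.filter (S y), jump e := by
  rw [Finset.sum_filter]
  refine Finset.sum_congr rfl fun e _ => ?_
  simp only [indicator, mem_ofPred_eq]

/-- A segment passes from a primal cell to another one through an edge, hence through the diamond of
this edge. -/
theorem IsMesh.primalPartition (hM : M.IsMesh Ω) (h : M.Unk → ℝ) :
    IsControlledPartition hM M.cell (fun K => h (.inl (.inl K))) (primalJump h) where
  measurableSet K := (hM.cell_open K).measurableSet
  aedisjoint _ _ hKL := (hM.cell_disjoint hKL).aedisjoint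
  cover := (iUnion_subset hM.cell_subset).eventuallyLE.antisymm (ae_le_set.2 hM.volume_diff_cells)
  jump_nonneg _ := abs_nonneg _
  jump_bound x y hseg hn K L hx hy := by
    classical
    rw [sum_indicator_eq fun z e => (segment ℝ x z ∩ M.diamond e).Nonempty]
    refine abs_sub_le_sum_of_reflTransGen _ (fun K => h (.inl (.inl K)))
      (fun e => h (.inl (M.cellK e))) (fun e => h (.inl (M.cellL e)))
      (R := fun K L => ∃ e, (segment ℝ x y ∩ M.diamond e).Nonempty ∧
        ((M.cellK e = .inl K ∧ M.cellL e = .inl L) ∨ (M.cellK e = .inl L ∧ M.cellL e = .inl K)))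
      ?_ ?_
    · rintro i j ⟨e, he, ⟨h1, h2⟩ | ⟨h1, h2⟩⟩
      · exact ⟨e, by simpa using he, by rw [h1, h2]⟩
      · exact ⟨e, by simpa using he, by rw [h1, h2, uIcc_comm]⟩
    · refine reflTransGen_of_isPreconnected (convex_segment x y).isPreconnected
        (F := fun K => closure (M.cell K)) (fun _ => isClosed_closure)
        (hseg.trans hM.cell_cover) ?_ (left_mem_segment ℝ x y) (subset_closure hx)
        (right_mem_segment ℝ x y) (subset_closure hy)
      intro z hz i j hi hj
      rcases hM.closure_cell_inter (Set.disjoint_left.1 hn hz) hi hj with rfl | ⟨e, he, hij⟩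
      · exact .refl
      · exact .single ⟨e, ⟨z, hz, he⟩, hij⟩

/-- A segment passes from a dual cell to another one inside a diamond that the two cells share. -/
theorem IsMesh.dualPartition (hM : M.IsMesh Ω) (hΩ : IsPolygonalDomain Ω) (h : M.Unk → ℝ) :
    IsControlledPartition hM M.dualCell (fun v => h (.inr v)) (dualJump h) where
  measurableSet v := (isClosed_dualCell v).measurableSet
  aedisjoint := hM.aedisjoint_dualCell
  cover := (hΩ.ae_le_of_subset_closure (iUnion_subset hM.dualCell_subset)).antisymm
    hM.dualCell_cover.eventuallyLE
  jump_nonneg _ := abs_nonneg _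
  jump_bound x y hseg hn v w hx hy := by
    classical
    rw [sum_indicator_eq fun z e => (segment ℝ x z ∩ M.diamond e).Nonempty]
    refine abs_sub_le_sum_of_reflTransGen _ (fun v => h (.inr v))
      (fun e => h (.inr (M.src e))) (fun e => h (.inr (M.tgt e)))
      (R := fun v w => ∃ e, (segment ℝ x y ∩ M.diamond e).Nonempty ∧
        ((M.src e = v ∧ M.tgt e = w) ∨ (M.src e = w ∧ M.tgt e = v)))
      ?_ ?_
    · rintro i j ⟨e, he, ⟨h1, h2⟩ | ⟨h1, h2⟩⟩
      · exact ⟨e, by simpa using he, by rw [h1, h2]⟩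
      · exact ⟨e, by simpa using he, by rw [h1, h2, uIcc_comm]⟩
    · refine reflTransGen_of_isPreconnected (convex_segment x y).isPreconnected
        (F := M.dualCell) isClosed_dualCell
        (hseg.trans hM.dualCell_cover) ?_ (left_mem_segment ℝ x y) hx
        (right_mem_segment ℝ x y) hy
      intro z hz i j hi hj
      rcases hM.dualCell_inter hΩ.isOpen (hseg hz) (Set.disjoint_left.1 hn hz) hi hj with
        rfl | ⟨e, he, hij⟩
      · exact .refl
      · exact .single ⟨e, ⟨z, hz, he⟩, hij⟩

end DDFVData

/-! ### Coercivity of the scheme -/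

/-- The product of the jumps of a density and of its logarithm dominates the square of the jump of
its square root. -/
theorem two_mul_sq_sqrt_sub_le {x y : ℝ} (hx : 0 < x) (hy : 0 < y) :
    2 * (√x - √y) ^ 2 ≤ (x - y) * (Real.log x - Real.log y) := by
  wlog hxy : y ≤ x generalizing x y
  · have := this hy hx (le_of_not_ge hxy)
    nlinarith
  have ha : 0 < √x := Real.sqrt_pos.2 hx
  have hb : 0 < √y := Real.sqrt_pos.2 hy
  have hab : √y ≤ √x := Real.sqrt_le_sqrt hxy
  have hlog : Real.log x - Real.log y = 2 * Real.log (√x / √y) := by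
    rw [← Real.log_div hx.ne' hy.ne', ← Real.sqrt_div' _ hy.le, Real.log_sqrt (by positivity)]
    ring
  have h1 := Real.one_sub_inv_le_log_of_pos (div_pos ha hb)
  rw [inv_div] at h1
  have hxs : √x ^ 2 = x := Real.sq_sqrt hx.le
  have hys : √y ^ 2 = y := Real.sq_sqrt hy.le
  have h2 : (√x - √y) ^ 2 ≤ (x - y) * (1 - √y / √x) := by
    have h3 : (x - y) * (1 - √y / √x) = (√x - √y) ^ 2 * ((√x + √y) / √x) := by
      rw [← hxs, ← hys]
      simp only [Real.sqrt_sq ha.le, Real.sqrt_sq hb.le]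
      field_simp
      ring
    rw [h3]
    have h4 : 1 ≤ (√x + √y) / √x := by rw [le_div_iff₀ ha]; linarith
    nlinarith [sq_nonneg (√x - √y)]
  rw [hlog]
  nlinarith [mul_le_mul_of_nonneg_left h1 (sub_nonneg.2 hxy)]

/-- The mean `r` dominates the logarithmic mean, and by monotonicity and homogeneity the weights
`c₁, c₂` may be replaced by their lower bound `m`. -/
theorem IsMeanFunction.dissipation {r : ℝ → ℝ → ℝ} (hr : IsMeanFunction r) {m c₁ c₂ x y : ℝ}
    (hm : 0 < m) (h₁ : m ≤ c₁) (h₂ : m ≤ c₂) (hx : 0 < x) (hy : 0 < y) :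
    2 * m * (√x - √y) ^ 2 ≤ r (c₁ * x) (c₂ * y) * (Real.log x - Real.log y) ^ 2 := by
  by_cases hxy : x = y
  · subst hxy; simp
  have h1 : m * r x y ≤ r (c₁ * x) (c₂ * y) := by
    rw [← hr.homog m x y hm hx hy]
    exact hr.mono _ _ _ _ (by positivity) (by positivity) (by gcongr) (by gcongr)
  have hlog : Real.log x - Real.log y ≠ 0 := fun h =>
    hxy (Real.log_injOn_pos hx hy (sub_eq_zero.1 h))
  have h2 : (x - y) * (Real.log x - Real.log y) ≤ r x y * (Real.log x - Real.log y) ^ 2 := by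
    have := mul_le_mul_of_nonneg_right (hr.lower x y hx hy hxy)
      (sq_nonneg (Real.log x - Real.log y))
    calc _ = (x - y) / (Real.log x - Real.log y) * (Real.log x - Real.log y) ^ 2 := by
          field_simp
      _ ≤ _ := this
  have h3 := two_mul_sq_sqrt_sub_le hx hy
  calc 2 * m * (√x - √y) ^ 2 = m * (2 * (√x - √y) ^ 2) := by ring
    _ ≤ m * (r x y * (Real.log x - Real.log y) ^ 2) :=
        mul_le_mul_of_nonneg_left (h3.trans h2) hm.le
    _ = m * r x y * (Real.log x - Real.log y) ^ 2 := by ring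
    _ ≤ _ := by gcongr

theorem matForm_eq (A : Matrix (Fin 2) (Fin 2) ℝ) (v w : Plane) :
    matForm A v w = w 0 * A 0 0 * v 0 + w 0 * A 0 1 * v 1 + (w 1 * A 1 0 * v 0
      + w 1 * A 1 1 * v 1) := by
  simp [matForm, Fin.sum_univ_two]

namespace DDFVData

variable {M : DDFVData} {Ω : Set Plane} {Θ lamm lamM : ℝ}
  {Lam : Plane → Matrix (Fin 2) (Fin 2) ℝ}

theorem mD_pos (hM : M.IsMesh Ω) (hreg : M.IsRegular Ω Θ) (hΘ : 1 ≤ Θ) (e : M.Edge) :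
    0 < M.mD e := by
  have h1 := hM.area_diamond hreg hΘ e
  have h2 : 0 < (M.mσ e + M.mσs e) ^ 2 := by
    have := hM.mσ_pos e
    have := hM.mσs_pos e
    positivity
  by_contra h
  have : 4 * Θ * (4 * Θ + 2) * M.mD e ≤ 0 :=
    mul_nonpos_of_nonneg_of_nonpos (by positivity) (not_lt.1 h)
  linarith

theorem mD_le (hM : M.IsMesh Ω) (e : M.Edge) : M.mD e ≤ 4 * (M.mσ e + M.mσs e) ^ 2 := by
  have h0 : 0 ≤ M.mσ e + M.mσs e := add_nonneg (hM.mσ_pos e).le (hM.mσs_pos e).le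
  have h1 := measure_mono (μ := volume) (hM.diamond_subset_closedBall e)
  rw [EuclideanSpace.volume_closedBall_fin_two] at h1
  have h2 : M.mD e ≤ (M.mσ e + M.mσs e) ^ 2 * Real.pi := by
    refine ENNReal.toReal_le_of_le_ofReal (by positivity) (h1.trans (le_of_eq ?_))
    rw [ENNReal.ofReal_mul (by positivity), ← ENNReal.ofReal_pow h0,
      ← NNReal.coe_real_pi, ENNReal.ofReal_coe_nnreal]
  nlinarith [Real.pi_lt_four, sq_nonneg (M.mσ e + M.mσs e)]

theorem ae_diamond (hΩ : IsPolygonalDomain Ω) (hM : M.IsMesh Ω) (e : M.Edge) {p : Plane → Prop}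
    (h : ∀ᵐ x ∂(volume.restrict Ω), p x) : ∀ᵐ x ∂(volume.restrict (M.diamond e)), p x :=
  (Measure.absolutelyContinuous_of_le (Measure.restrict_mono'
    (hΩ.ae_le_of_subset_closure (hM.diamond_subset e)) le_rfl)).ae_le h

theorem integrableOn_Lam (hΩ : IsPolygonalDomain Ω) (hM : M.IsMesh Ω)
    (hLam : IsAnisotropyTensor Ω lamm lamM Lam) (e : M.Edge) (i j : Fin 2) :
    IntegrableOn (fun x => Lam x i j) (M.diamond e) := by
  have : IsFiniteMeasure (volume.restrict Ω) :=
    isFiniteMeasure_restrict.2 hΩ.isBounded.measure_lt_top.ne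
  have h1 : IntegrableOn (fun x => Lam x i j) Ω := (hLam.memLp i j).integrable le_top
  exact h1.mono_set_ae (hΩ.ae_le_of_subset_closure (hM.diamond_subset e))

theorem LamD_symm (hΩ : IsPolygonalDomain Ω) (hM : M.IsMesh Ω)
    (hLam : IsAnisotropyTensor Ω lamm lamM Lam) (e : M.Edge) :
    M.LamD Lam e 0 1 = M.LamD Lam e 1 0 := by
  simp only [LamD, Matrix.of_apply]
  congr 1
  refine integral_congr_ae ?_
  filter_upwards [ae_diamond hΩ hM e hLam.symm] with x hx
  exact hx.apply 1 0

theorem LamD_coercive (hΩ : IsPolygonalDomain Ω) (hM : M.IsMesh Ω) (hreg : M.IsRegular Ω Θ)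
    (hΘ : 1 ≤ Θ) (hLam : IsAnisotropyTensor Ω lamm lamM Lam) (e : M.Edge) (v : Plane) :
    lamm * ‖v‖ ^ 2 ≤ matForm (M.LamD Lam e) v v := by
  have hD := mD_pos hM hreg hΘ e
  have hfin := ((isCompact_diamond e).measure_lt_top (μ := volume)).ne
  have hI := integrableOn_Lam hΩ hM hLam e
  have h1 : matForm (M.LamD Lam e) v v
      = (M.mD e)⁻¹ * ∫ x in M.diamond e, matForm (Lam x) v v := by
    simp only [matForm_eq, LamD, Matrix.of_apply]
    have hc : ∀ i j : Fin 2, Integrable (fun x => v i * Lam x i j * v j)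
        (volume.restrict (M.diamond e)) := fun i j => ((hI i j).const_mul (v i)).mul_const (v j)
    have hs : ∀ i : Fin 2, Integrable (fun x => v i * Lam x i 0 * v 0 + v i * Lam x i 1 * v 1)
        (volume.restrict (M.diamond e)) := fun i => (hc i 0).add (hc i 1)
    rw [integral_add (hs 0) (hs 1), integral_add (hc 0 0) (hc 0 1), integral_add (hc 1 0) (hc 1 1)]
    simp only [integral_mul_const, integral_const_mul]
    ring
  have h2 : M.mD e * (lamm * ‖v‖ ^ 2) ≤ ∫ x in M.diamond e, matForm (Lam x) v v := by
    rw [mD, ← smul_eq_mul, ← setIntegral_const]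
    refine integral_mono_ae (integrableOn_const hfin) ?_ ?_
    · simp only [matForm_eq]
      have hc : ∀ i j : Fin 2, Integrable (fun x => v i * Lam x i j * v j)
        (volume.restrict (M.diamond e)) := fun i j => ((hI i j).const_mul (v i)).mul_const (v j)
      exact ((hc 0 0).add (hc 0 1)).add ((hc 1 0).add (hc 1 1))
    · filter_upwards [ae_diamond hΩ hM e hLam.elliptic] with x hx
      exact (hx v).1
  rw [h1, ← div_eq_inv_mul, le_div_iff₀ hD, mul_comm]
  exact h2

/-- The matrices `𝔸^D` of a regular mesh are uniformly coercive. -/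
theorem AD_coercive (hΩ : IsPolygonalDomain Ω) (hM : M.IsMesh Ω) (hreg : M.IsRegular Ω Θ)
    (hΘ : 1 ≤ Θ) (hlamm : 0 < lamm) (hLam : IsAnisotropyTensor Ω lamm lamM Lam) (e : M.Edge)
    (v : Plane) :
    lamm / (64 * Θ ^ 3 * (4 * Θ + 2)) * (v 0 ^ 2 + v 1 ^ 2) ≤ matForm (M.AD Lam e) v v := by
  have hs := hM.mσ_pos e
  have ht := hM.mσs_pos e
  have hD := mD_pos hM hreg hΘ e
  obtain ⟨hr1, hr2, hr3⟩ := hM.regular_bounds hreg hΘ e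
  set b : Plane := M.xb e - M.xa e with hb
  set l : Plane := M.xL e - M.xK e with hl
  set s := M.mσ e with hsdef
  set t := M.mσs e with htdef
  have hbn : ‖b‖ = s := (mσ_eq_norm e).symm
  have hln : ‖l‖ = t := (mσs_eq_norm e).symm
  set w : Plane := v 0 • perp b - v 1 • perp l with hw
  -- the quadratic form is that of the mean tensor at the discrete gradient
  have hform : matForm (M.AD Lam e) v v = 1 / (4 * M.mD e) * matForm (M.LamD Lam e) w w := by
    have hsym := LamD_symm hΩ hM hLam e
    have hn : M.nσK e = s⁻¹ • perp b := rfl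
    have hns : M.nσsKs e = -(t⁻¹ • perp l) := rfl
    simp only [AD, matForm_eq, hn, hns, hsym, hw, ← hsdef, ← htdef]
    simp only [Matrix.smul_apply, Matrix.of_apply, Matrix.cons_val_zero, Matrix.cons_val_one,
      Matrix.cons_val', Matrix.cons_val_fin_one, smul_eq_mul, PiLp.smul_apply, PiLp.neg_apply,
      PiLp.sub_apply]
    field_simp
    ring
  have hwn : ‖w‖ ^ 2 = (v 0 * s) ^ 2 + (v 1 * t) ^ 2 - 2 * v 0 * v 1 * inner ℝ b l := by
    have h1 := plane_norm_sq b
    have h2 := plane_norm_sq l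
    rw [hbn] at h1
    rw [hln] at h2
    rw [plane_norm_sq, mul_pow, mul_pow, h1, h2, plane_inner]
    simp only [hw, PiLp.sub_apply, PiLp.smul_apply, smul_eq_mul, perp_zero_apply, perp_one_apply]
    ring
  -- the angle of the diagonals is bounded away from zero
  have hinner : |inner ℝ b l| ≤ (1 - 1 / (2 * Θ ^ 2)) * (s * t) := by
    have h1 := pcross_sq_add_inner_sq b l
    rw [hbn, hln] at h1
    have h2 : (s * t) ^ 2 ≤ Θ ^ 2 * pcross b l ^ 2 := by
      rw [← mul_pow]
      gcongr
    have hΘ2 : 1 / (2 * Θ ^ 2) ≤ 1 / 2 := by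
      apply one_div_le_one_div_of_le (by norm_num)
      nlinarith
    apply abs_le_of_sq_le_sq _ (mul_nonneg (by linarith) (by positivity))
    have h3 : (s * t) ^ 2 / Θ ^ 2 ≤ pcross b l ^ 2 := by
      rw [div_le_iff₀ (by positivity)]; linarith
    have h4 : ((1 - 1 / (2 * Θ ^ 2)) * (s * t)) ^ 2
        = (s * t) ^ 2 - (s * t) ^ 2 / Θ ^ 2 + (1 / (2 * Θ ^ 2) * (s * t)) ^ 2 := by
      field_simp; ring
    rw [h4]
    nlinarith [sq_nonneg (1 / (2 * Θ ^ 2) * (s * t))]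
  have hwlow : 1 / (2 * Θ ^ 2) * ((v 0 * s) ^ 2 + (v 1 * t) ^ 2) ≤ ‖w‖ ^ 2 := by
    rw [hwn]
    have h1 : 2 * v 0 * v 1 * inner ℝ b l
        ≤ (1 - 1 / (2 * Θ ^ 2)) * ((v 0 * s) ^ 2 + (v 1 * t) ^ 2) := by
      have hc : 0 ≤ 1 - 1 / (2 * Θ ^ 2) := by
        by_contra hneg
        have : (1 - 1 / (2 * Θ ^ 2)) * (s * t) < 0 :=
          mul_neg_of_neg_of_pos (not_le.1 hneg) (by positivity)
        linarith [abs_nonneg (inner ℝ b l)]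
      calc 2 * v 0 * v 1 * inner ℝ b l ≤ |2 * v 0 * v 1 * inner ℝ b l| := le_abs_self _
        _ = 2 * |v 0| * |v 1| * |inner ℝ b l| := by simp [abs_mul]
        _ ≤ 2 * |v 0| * |v 1| * ((1 - 1 / (2 * Θ ^ 2)) * (s * t)) := by gcongr
        _ = (1 - 1 / (2 * Θ ^ 2)) * (2 * (|v 0| * s) * (|v 1| * t)) := by ring
        _ ≤ (1 - 1 / (2 * Θ ^ 2)) * ((v 0 * s) ^ 2 + (v 1 * t) ^ 2) := by
            gcongr
            have := two_mul_le_add_sq (|v 0| * s) (|v 1| * t)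
            rwa [mul_pow, mul_pow, sq_abs, sq_abs, ← mul_pow, ← mul_pow] at this
    linarith
  have hst : s * t / (2 * Θ) * (v 0 ^ 2 + v 1 ^ 2) ≤ (v 0 * s) ^ 2 + (v 1 * t) ^ 2 := by
    have h1 : s * t / (2 * Θ) ≤ s ^ 2 := by
      rw [div_le_iff₀ (by positivity)]; nlinarith
    have h2 : s * t / (2 * Θ) ≤ t ^ 2 := by
      rw [div_le_iff₀ (by positivity)]; nlinarith
    nlinarith [mul_le_mul_of_nonneg_right h1 (sq_nonneg (v 0)),
      mul_le_mul_of_nonneg_right h2 (sq_nonneg (v 1))]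
  have hDle : M.mD e ≤ 4 * ((4 * Θ + 2) * (s * t)) :=
    (mD_le hM e).trans (by gcongr; exact hM.sq_diam_le hreg hΘ e)
  have hvv : 0 ≤ v 0 ^ 2 + v 1 ^ 2 := by positivity
  calc lamm / (64 * Θ ^ 3 * (4 * Θ + 2)) * (v 0 ^ 2 + v 1 ^ 2)
      = 1 / (4 * (4 * ((4 * Θ + 2) * (s * t)))) * (lamm * (1 / (2 * Θ ^ 2)
          * (s * t / (2 * Θ) * (v 0 ^ 2 + v 1 ^ 2)))) := by
        field_simp; ring
    _ ≤ 1 / (4 * M.mD e) * (lamm * (1 / (2 * Θ ^ 2)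
          * (s * t / (2 * Θ) * (v 0 ^ 2 + v 1 ^ 2)))) := by gcongr
    _ ≤ 1 / (4 * M.mD e) * (lamm * (1 / (2 * Θ ^ 2) * ((v 0 * s) ^ 2 + (v 1 * t) ^ 2))) := by
        gcongr
    _ ≤ 1 / (4 * M.mD e) * (lamm * ‖w‖ ^ 2) := by gcongr
    _ ≤ 1 / (4 * M.mD e) * matForm (M.LamD Lam e) w w := by
        gcongr; exact LamD_coercive hΩ hM hreg hΘ hLam e w
    _ = _ := hform.symm

/-- The dissipation of the scheme controls the Dirichlet energy of `√w`, for the densities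
`u i = c i * w i` with `c i ≥ m`. -/
theorem dissipation_lower_bound (hΩ : IsPolygonalDomain Ω) (hM : M.IsMesh Ω)
    (hreg : M.IsRegular Ω Θ) (hΘ : 1 ≤ Θ) (hlamm : 0 < lamm)
    (hLam : IsAnisotropyTensor Ω lamm lamM Lam) {r f : ℝ → ℝ → ℝ} (hr : IsMeanFunction r)
    (hf : IsAdmissibleCombination f) {m : ℝ} (hm : 0 < m) {c w : M.Unk → ℝ} (hc : ∀ i, m ≤ c i)
    (hw : ∀ i, 0 < w i) :
    lamm / (64 * Θ ^ 3 * (4 * Θ + 2)) * m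
        * (∑ e, primalJump (fun i => √(w i)) e ^ 2 + ∑ e, dualJump (fun i => √(w i)) e ^ 2)
      ≤ M.TD Lam f r (fun i => c i * w i) (fun i => Real.log (w i)) fun i => Real.log (w i) := by
  rw [TD, ← Finset.sum_add_distrib, Finset.mul_sum]
  refine Finset.sum_le_sum fun e _ => ?_
  have hA := AD_coercive hΩ hM hreg hΘ hlamm hLam e (M.deltaD (fun i => Real.log (w i)) e)
  set C := lamm / (64 * Θ ^ 3 * (4 * Θ + 2))
  have hC : 0 < C := by positivity
  have hcw : ∀ i, 0 < c i * w i := fun i => mul_pos (hm.trans_le (hc i)) (hw i)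
  have h1 := hr.dissipation hm (hc (.inl (M.cellK e))) (hc (.inl (M.cellL e)))
    (hw (.inl (M.cellK e))) (hw (.inl (M.cellL e)))
  have h2 := hr.dissipation hm (hc (.inr (M.src e))) (hc (.inr (M.tgt e)))
    (hw (.inr (M.src e))) (hw (.inr (M.tgt e)))
  have hr1 := hr.pos _ _ (hcw (.inl (M.cellK e))) (hcw (.inl (M.cellL e)))
  have hr2 := hr.pos _ _ (hcw (.inr (M.src e))) (hcw (.inr (M.tgt e)))
  have hrec : ∀ x y : ℝ, 0 < x → 0 < y → x ≤ 2 * f x y ∧ y ≤ 2 * f x y := by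
    intro x y hx hy
    rcases hf with rfl | rfl
    · constructor
      · linarith [le_max_left x y]
      · linarith [le_max_right x y]
    · constructor <;> simp only <;> linarith
  obtain ⟨h3, h4⟩ := hrec _ _ hr1 hr2
  rw [show M.recD f r (fun i => c i * w i) e = f (r (c (.inl (M.cellK e)) * w (.inl (M.cellK e)))
    (c (.inl (M.cellL e)) * w (.inl (M.cellL e)))) (r (c (.inr (M.src e)) * w (.inr (M.src e)))
    (c (.inr (M.tgt e)) * w (.inr (M.tgt e)))) from rfl]
  set R := f _ _
  have hR : 0 < R := by linarith
  have hd0 : M.deltaD (fun i => Real.log (w i)) e 0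
      = Real.log (w (.inl (M.cellK e))) - Real.log (w (.inl (M.cellL e))) := by
    simp [deltaD]
  have hd1 : M.deltaD (fun i => Real.log (w i)) e 1
      = Real.log (w (.inr (M.src e))) - Real.log (w (.inr (M.tgt e))) := by
    simp [deltaD]
  rw [hd0, hd1] at hA
  simp only [primalJump, dualJump, sq_abs]
  set x := Real.log (w (.inl (M.cellK e))) - Real.log (w (.inl (M.cellL e)))
  set y := Real.log (w (.inr (M.src e))) - Real.log (w (.inr (M.tgt e)))
  have h5 := h1.trans (mul_le_mul_of_nonneg_right h3 (sq_nonneg x))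
  have h6 := h2.trans (mul_le_mul_of_nonneg_right h4 (sq_nonneg y))
  calc C * m * _ ≤ C * (R * (x ^ 2 + y ^ 2)) := by
        rw [mul_assoc]
        refine mul_le_mul_of_nonneg_left ?_ hC.le
        linarith
    _ = R * (C * (x ^ 2 + y ^ 2)) := by ring
    _ ≤ _ := by gcongr

end DDFVData

/-! ### The relative entropy -/

theorem Phi1_nonneg {s : ℝ} (hs : 0 ≤ s) : 0 ≤ Phi1 s := by
  rcases hs.eq_or_lt with rfl | hs
  · simp [Phi1]
  · have h1 := Real.one_sub_inv_le_log_of_pos hs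
    have h2 := mul_le_mul_of_nonneg_left h1 hs.le
    rw [mul_sub, mul_inv_cancel₀ hs.ne', mul_one] at h2
    rw [Phi1]
    linarith

/-- Convexity of `Φ₁`, in the form used to bound the variation of the entropy in a time step. -/
theorem Phi1_sub_le {c s s' : ℝ} (hc : 0 < c) (hs : 0 ≤ s) (hs' : 0 < s') :
    c * Phi1 (s' / c) - c * Phi1 (s / c) ≤ (s' - s) * Real.log (s' / c) := by
  have key : ∀ x y : ℝ, 0 ≤ x → 0 < y → Phi1 y - Phi1 x ≤ (y - x) * Real.log y := by
    intro x y hx hy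
    rcases hx.eq_or_lt with rfl | hx
    · simp only [Phi1, Real.log_zero]; linarith
    · have h1 := Real.log_le_sub_one_of_pos (div_pos hy hx)
      rw [Real.log_div hy.ne' hx.ne'] at h1
      have h2 := mul_le_mul_of_nonneg_left h1 hx.le
      have h3 : x * (y / x - 1) = y - x := by field_simp
      rw [h3] at h2
      simp only [Phi1]
      linarith
  have h := mul_le_mul_of_nonneg_left (key (s / c) (s' / c) (by positivity) (by positivity)) hc.le
  calc _ = c * (Phi1 (s' / c) - Phi1 (s / c)) := by ring
    _ ≤ _ := h
    _ = _ := by field_simp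

/-- The entropy relative to an equilibrium of the same mass is bounded by the `χ²` divergence from
any multiple `t` of this equilibrium. -/
theorem sum_Phi1_le {ι : Type*} [Fintype ι] {m c w : ι → ℝ} {U t : ℝ} (hm : ∀ i, 0 ≤ m i)
    (hc : ∀ i, 0 ≤ c i) (hcU : ∀ i, c i ≤ U) (hw : ∀ i, 0 < w i)
    (hmass : ∑ i, m i * (c i * w i) = ∑ i, m i * c i) (ht : 0 < t) :
    ∑ i, m i * (c i * Phi1 (w i)) ≤ U * ∑ i, m i * ((w i - t) ^ 2 / t) := by
  have hpt : ∀ i, Phi1 (w i) ≤ (w i - t) ^ 2 / t + (w i - 1) * Real.log t := fun i => by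
    have h1 := Real.log_le_sub_one_of_pos (div_pos (hw i) ht)
    rw [Real.log_div (hw i).ne' ht.ne'] at h1
    have h2 := mul_le_mul_of_nonneg_left h1 (hw i).le
    have h3 := Real.one_sub_inv_le_log_of_pos ht
    have h4 := Real.log_le_sub_one_of_pos ht
    have h5 : (w i - t) ^ 2 / t = w i * (w i / t - 1) - w i + t := by field_simp; ring
    rw [h5, Phi1]
    linarith
  have h0 : ∑ i, m i * c i * ((w i - 1) * Real.log t) = 0 := by
    have : ∀ i, m i * c i * ((w i - 1) * Real.log t)
        = (m i * (c i * w i) - m i * c i) * Real.log t := fun i => by ring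
    simp only [this]
    rw [← Finset.sum_mul, Finset.sum_sub_distrib, hmass, sub_self, zero_mul]
  calc ∑ i, m i * (c i * Phi1 (w i))
      ≤ ∑ i, (U * (m i * ((w i - t) ^ 2 / t)) + m i * c i * ((w i - 1) * Real.log t)) := by
        refine Finset.sum_le_sum fun i _ => ?_
        have h6 : 0 ≤ m i * ((w i - t) ^ 2 / t) := mul_nonneg (hm i) (by positivity)
        have h7 := mul_le_mul_of_nonneg_left (hpt i) (mul_nonneg (hm i) (hc i))
        have h8 := mul_le_mul_of_nonneg_right (hcU i) h6
        nlinarith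
    _ = _ := by rw [Finset.sum_add_distrib, h0, add_zero, Finset.mul_sum]

/-! ### Decay of the entropy -/

theorem IsInitialDatum.integrableOn {Ω : Set Plane} {u₀ : Plane → ℝ} (hu₀ : IsInitialDatum Ω u₀)
    (hb : Bornology.IsBounded Ω) : IntegrableOn u₀ Ω := by
  have : IsFiniteMeasure (volume.restrict Ω) := isFiniteMeasure_restrict.2 hb.measure_lt_top.ne
  exact hu₀.memLp.integrable one_le_two

namespace DDFVData

variable {M : DDFVData} {Ω : Set Plane}

/-- Taking means over the pieces of a partition preserves the total mass. -/
theorem IsControlledPartition.mass_mean {hM : M.IsMesh Ω} {ι : Type} [Fintype ι]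
    {F : ι → Set Plane} {h : ι → ℝ} {jump : M.Edge → ℝ}
    (hP : IsControlledPartition hM F h jump) (hF : ∀ i, 0 < volume.real (F i)) {g : Plane → ℝ}
    (hg : IntegrableOn g Ω) :
    ∑ i, volume.real (F i) * ((volume.real (F i))⁻¹ * ∫ x in F i, g x) = ∫ x in Ω, g x := by
  rw [hP.setIntegral_eq_sum hg]
  exact Finset.sum_congr rfl fun i _ => mul_inv_cancel_left₀ (hF i).ne' _

/-- Bounds on the discrete equilibrium, from bounds on the potential at the nodes. -/
theorem IsControlledPartition.equilibrium_bounds {hM : M.IsMesh Ω} {ι : Type} [Fintype ι]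
    {F : ι → Set Plane} {h : ι → ℝ} {jump : M.Edge → ℝ}
    (hP : IsControlledPartition hM F h jump) (hb : Bornology.IsBounded Ω)
    (hΩ : 0 < volume.real Ω) {mass B : ℝ} (hmass : 0 < mass) {V : ι → ℝ} (hV : ∀ i, |V i| ≤ B) :
    0 < ∑ i, volume.real (F i) * Real.exp (-V i) ∧ ∀ v : ℝ, |v| ≤ B →
      mass * (volume.real Ω * Real.exp B)⁻¹ * Real.exp (-B)
          ≤ mass * (∑ i, volume.real (F i) * Real.exp (-V i))⁻¹ * Real.exp (-v) ∧
        mass * (∑ i, volume.real (F i) * Real.exp (-V i))⁻¹ * Real.exp (-v)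
          ≤ mass * (volume.real Ω * Real.exp (-B))⁻¹ * Real.exp B := by
  have h1 : volume.real Ω * Real.exp (-B) ≤ ∑ i, volume.real (F i) * Real.exp (-V i) := by
    rw [← hP.sum_volume hb, Finset.sum_mul]
    gcongr with i
    linarith [le_abs_self (V i), hV i]
  have h2 : ∑ i, volume.real (F i) * Real.exp (-V i) ≤ volume.real Ω * Real.exp B := by
    rw [← hP.sum_volume hb, Finset.sum_mul]
    gcongr with i
    linarith [neg_abs_le (V i), hV i]
  have h0 : 0 < volume.real Ω * Real.exp (-B) := by positivity
  have hS : 0 < ∑ i, volume.real (F i) * Real.exp (-V i) := h0.trans_le h1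
  refine ⟨hS, fun v hv => ⟨?_, ?_⟩⟩
  · gcongr
    linarith [le_abs_self v]
  · gcongr
    linarith [neg_abs_le v]

theorem TD_eq_zero_of_deltaD (Lam : Plane → Matrix (Fin 2) (Fin 2) ℝ) (f r : ℝ → ℝ → ℝ)
    (u g ψ : M.Unk → ℝ) (h : ∀ e, M.deltaD ψ e = 0) : M.TD Lam f r u g ψ = 0 := by
  refine Finset.sum_eq_zero fun e _ => ?_
  rw [h, matForm_eq]
  simp

/-- The indicator of the unknowns attached to the primal mesh, boundary edges included. -/
def primalOne : M.Unk → ℝ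
  | .inl _ => 1
  | .inr _ => 0

/-- The indicator of the unknowns attached to the dual mesh. -/
def dualOne : M.Unk → ℝ
  | .inl _ => 0
  | .inr _ => 1

variable {u₀ V : Plane → ℝ} {Lam : Plane → Matrix (Fin 2) (Fin 2) ℝ} {f r : ℝ → ℝ → ℝ} {dt : ℝ}
  {u : ℕ → M.Unk → ℝ}

/-- The scheme conserves the mass on the primal mesh. -/
theorem primal_mass (hΩ : IsPolygonalDomain Ω) (hM : M.IsMesh Ω) (hu₀ : IsInitialDatum Ω u₀)
    (hdt : 0 < dt) (hu : IsDDFVSolution M u₀ V Lam f r dt u) (n : ℕ) :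
    ∑ K, volume.real (M.cell K) * u n (.inl (.inl K)) = ∫ x in Ω, u₀ x := by
  induction n with
  | zero =>
    rw [hu.initial]
    exact (hM.primalPartition (fun _ => 0)).mass_mean (hM.volume_cell_pos hΩ.isBounded)
      (hu₀.integrableOn hΩ.isBounded)
  | succ n ih =>
    have h := hu.scheme n primalOne
    rw [TD_eq_zero_of_deltaD _ _ _ _ _ _ fun e => by
      apply plane_ext <;> simp [deltaD, primalOne], add_zero, bracket] at h
    simp only [primalOne, mul_one, mul_zero, zero_mul, Finset.sum_const_zero, add_zero] at h
    rw [← ih, ← sub_eq_zero, ← Finset.sum_sub_distrib]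
    have h2 : ∑ K, volume.real (M.cell K) * ((u (n + 1) (.inl (.inl K)) - u n (.inl (.inl K))) / dt)
        = (∑ K, (volume.real (M.cell K) * u (n + 1) (.inl (.inl K))
          - volume.real (M.cell K) * u n (.inl (.inl K)))) / dt := by
      rw [Finset.sum_div]
      exact Finset.sum_congr rfl fun K _ => by ring
    rw [h2] at h
    have h3 := (mul_eq_zero.1 h).resolve_left (by norm_num)
    exact (div_eq_zero_iff.1 h3).resolve_right hdt.ne'

/-- The scheme conserves the mass on the dual mesh. -/
theorem dual_mass (hΩ : IsPolygonalDomain Ω) (hM : M.IsMesh Ω) (hu₀ : IsInitialDatum Ω u₀)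
    (hdt : 0 < dt) (hu : IsDDFVSolution M u₀ V Lam f r dt u) (n : ℕ) :
    ∑ v, volume.real (M.dualCell v) * u n (.inr v) = ∫ x in Ω, u₀ x := by
  induction n with
  | zero =>
    rw [hu.initial]
    exact (hM.dualPartition hΩ (fun _ => 0)).mass_mean hM.volume_dualCell_pos
      (hu₀.integrableOn hΩ.isBounded)
  | succ n ih =>
    have h := hu.scheme n dualOne
    rw [TD_eq_zero_of_deltaD _ _ _ _ _ _ fun e => by
      apply plane_ext <;> simp [deltaD, dualOne], add_zero, bracket] at h
    simp only [dualOne, mul_one, mul_zero, zero_mul, Finset.sum_const_zero, zero_add] at h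
    rw [← ih, ← sub_eq_zero, ← Finset.sum_sub_distrib]
    have h2 : ∑ v, volume.real (M.dualCell v) * ((u (n + 1) (.inr v) - u n (.inr v)) / dt)
        = (∑ v, (volume.real (M.dualCell v) * u (n + 1) (.inr v)
          - volume.real (M.dualCell v) * u n (.inr v))) / dt := by
      rw [Finset.sum_div]
      exact Finset.sum_congr rfl fun v _ => by ring
    rw [h2] at h
    have h3 := (mul_eq_zero.1 h).resolve_left (by norm_num)
    exact (div_eq_zero_iff.1 h3).resolve_right hdt.ne'

theorem init_nonneg (hΩ : IsPolygonalDomain Ω) (hM : M.IsMesh Ω) (hu₀ : IsInitialDatum Ω u₀)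
    (i : M.Unk) : 0 ≤ M.init u₀ i := by
  have h : ∀ s : Set Plane, s ≤ᵐ[volume] Ω → 0 ≤ ∫ x in s, u₀ x := fun s hs =>
    integral_nonneg_of_ae ((Measure.absolutelyContinuous_of_le
      (Measure.restrict_mono' hs le_rfl)).ae_le hu₀.nonneg)
  rcases i with (K | b) | v
  · exact mul_nonneg (inv_nonneg.2 measureReal_nonneg) (h _ (hM.cell_subset K).eventuallyLE)
  · exact le_rfl
  · exact mul_nonneg (inv_nonneg.2 measureReal_nonneg)
      (h _ (hΩ.ae_le_of_subset_closure (hM.dualCell_subset v)))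

theorem solution_nonneg (hΩ : IsPolygonalDomain Ω) (hM : M.IsMesh Ω)
    (hu₀ : IsInitialDatum Ω u₀) (hu : IsDDFVSolution M u₀ V Lam f r dt u) (n : ℕ) (i : M.Unk) :
    0 ≤ u n i := by
  cases n with
  | zero => rw [hu.initial]; exact init_nonneg hΩ hM hu₀ i
  | succ n => exact (hu.pos n i).le

theorem node_mem (hM : M.IsMesh Ω) (i : M.Unk) : M.node i ∈ closure Ω := by
  rcases i with (K | b) | v
  · exact subset_closure (hM.cell_subset K (hM.center_mem K))
  · exact hM.diamond_subset (.inr b) (xL_mem_diamond (.inr b))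
  · obtain ⟨e, he⟩ := hM.vertex_used v
    exact hM.diamond_subset e (seg_subset_diamond e (vertex_mem_seg he))

/-- The chemical potential `log u + V` and the logarithm of the density `w = u / c` relative to the
steady state `c` differ by one constant on the primal mesh and another one on the dual mesh, hence
have the same discrete differences. -/
theorem deltaD_log_steady {c : M.Unk → ℝ} {ρ ρs : ℝ} (hρ : 0 < ρ) (hρs : 0 < ρs)
    (hc : ∀ K, c (.inl K) = ρ * Real.exp (-V (M.primalCenter K)))
    (hcs : ∀ v, c (.inr v) = ρs * Real.exp (-V (M.vertex v))) {w : M.Unk → ℝ}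
    (hw : ∀ i, 0 < w i) (e : M.Edge) :
    M.deltaD (fun i => Real.log (c i * w i) + V (M.node i)) e
      = M.deltaD (fun i => Real.log (w i)) e := by
  have h1 : ∀ K, Real.log (c (.inl K) * w (.inl K)) + V (M.node (.inl K))
      = Real.log ρ + Real.log (w (.inl K)) := fun K => by
    rw [hc, Real.log_mul (by positivity) (hw _).ne', Real.log_mul hρ.ne' (Real.exp_ne_zero _),
      Real.log_exp, node]
    ring
  have h2 : ∀ v, Real.log (c (.inr v) * w (.inr v)) + V (M.node (.inr v))
      = Real.log ρs + Real.log (w (.inr v)) := fun v => by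
    rw [hcs, Real.log_mul (by positivity) (hw _).ne', Real.log_mul hρs.ne' (Real.exp_ne_zero _),
      Real.log_exp, node]
    ring
  simp only [deltaD, h1, h2, add_sub_add_left_eq_sub]

end DDFVData

open DDFVData in
/-- Over a time step, the entropy decreases by at least `ν dt` times its value at the end of the
step. -/
theorem exists_entropy_step (Ω : Set Plane) (hΩ : IsPolygonalDomain Ω)
    (u₀ : Plane → ℝ) (hu₀ : IsInitialDatum Ω u₀)
    (V : Plane → ℝ) (hV : IsC1OnClosure Ω V) (lamm lamM : ℝ) (hlamm : 0 < lamm)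
    (Θ : ℝ) (hΘ : 1 ≤ Θ) :
    ∃ ν : ℝ, 0 < ν ∧
      ∀ (Lam : Plane → Matrix (Fin 2) (Fin 2) ℝ), IsAnisotropyTensor Ω lamm lamM Lam →
      ∀ (M : DDFVData), M.IsMesh Ω → M.IsRegular Ω Θ →
      ∀ (r f : ℝ → ℝ → ℝ), IsMeanFunction r → IsAdmissibleCombination f →
      ∀ (dt : ℝ), 0 < dt →
      ∀ (u : ℕ → M.Unk → ℝ), IsDDFVSolution M u₀ V Lam f r dt u →
        0 ≤ relEntropy M Ω u₀ V (u 0) ∧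
        ∀ n : ℕ, (1 + ν * dt) * relEntropy M Ω u₀ V (u (n + 1)) ≤ relEntropy M Ω u₀ V (u n) := by
  set M₁ := ∫ x in Ω, u₀ x with hM₁
  have hM₁pos : 0 < M₁ := hu₀.mass_pos
  obtain ⟨B, hB⟩ := hΩ.isBounded.isCompact_closure.exists_bound_of_continuousOn hV.continuousOn
  have hΩpos : 0 < volume.real Ω := ENNReal.toReal_pos
    (hΩ.isOpen.measure_pos volume hΩ.isConnected.nonempty).ne' hΩ.isBounded.measure_lt_top.ne
  set m := M₁ * (volume.real Ω * Real.exp B)⁻¹ * Real.exp (-B)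
  set U := M₁ * (volume.real Ω * Real.exp (-B))⁻¹ * Real.exp B
  have hm : 0 < m := by positivity
  have hU : 0 < U := by positivity
  obtain ⟨A, hA, hchi⟩ := exists_discrete_chi_square_bound hΩ hΘ
  set C := lamm / (64 * Θ ^ 3 * (4 * Θ + 2))
  have hC : 0 < C := by positivity
  refine ⟨2 * (C * m) / (U * A), by positivity, ?_⟩
  intro Lam hLam M hM hreg r f hr hf dt hdt u hu
  set c := M.steady Ω u₀ V with hc
  have hPp := hM.primalPartition fun _ => 0
  have hPd := hM.dualPartition hΩ fun _ => 0
  have hVnode : ∀ i, |V (M.node i)| ≤ B := fun i => hB _ (node_mem hM i)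
  obtain ⟨hSp, hbp⟩ := hPp.equilibrium_bounds hΩ.isBounded hΩpos hM₁pos
    (V := fun K => V (M.center K)) fun K => hVnode (.inl (.inl K))
  obtain ⟨hSd, hbd⟩ := hPd.equilibrium_bounds hΩ.isBounded hΩpos hM₁pos
    (V := fun v => V (M.vertex v)) fun v => hVnode (.inr v)
  have hcb : ∀ i, m ≤ c i ∧ c i ≤ U := by
    rintro (K | v)
    · exact hbp _ (hVnode (.inl K))
    · exact hbd _ (hVnode (.inr v))
  have hcpos : ∀ i, 0 < c i := fun i => hm.trans_le (hcb i).1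
  have hmassp : ∑ K, volume.real (M.cell K) * c (.inl (.inl K)) = M₁ := by
    have : ∀ K, volume.real (M.cell K) * c (.inl (.inl K))
        = M₁ * (∑ K' : M.PCell, volume.real (M.cell K') * Real.exp (-V (M.center K')))⁻¹
          * (volume.real (M.cell K) * Real.exp (-V (M.center K))) := fun K => by
      simp only [hc, steady, primalCenter, ← hM₁]; ring
    simp only [this]
    rw [← Finset.mul_sum, inv_mul_cancel_right₀ hSp.ne']
  have hmassd : ∑ v, volume.real (M.dualCell v) * c (.inr v) = M₁ := by
    have : ∀ v, volume.real (M.dualCell v) * c (.inr v)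
        = M₁ * (∑ w : M.Vtx, volume.real (M.dualCell w) * Real.exp (-V (M.vertex w)))⁻¹
          * (volume.real (M.dualCell v) * Real.exp (-V (M.vertex v))) := fun v => by
      simp only [hc, steady, ← hM₁]; ring
    simp only [this]
    rw [← Finset.mul_sum, inv_mul_cancel_right₀ hSd.ne']
  have hunn := solution_nonneg hΩ hM hu₀ hu
  have hvp : ∀ K, 0 ≤ volume.real (M.cell K) := fun _ => measureReal_nonneg
  have hvd : ∀ v, 0 ≤ volume.real (M.dualCell v) := fun _ => measureReal_nonneg
  have hent : ∀ n, relEntropy M Ω u₀ V (u n)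
      = 1 / 2 * (∑ K, volume.real (M.cell K)
          * (c (.inl (.inl K)) * Phi1 (u n (.inl (.inl K)) / c (.inl (.inl K))))
        + ∑ v, volume.real (M.dualCell v) * (c (.inr v) * Phi1 (u n (.inr v) / c (.inr v)))) :=
    fun n => by simp only [relEntropy, bracket, mul_one, ← hc]
  refine ⟨?_, fun n => ?_⟩
  · rw [hent]
    have hterm : ∀ i, 0 ≤ c i * Phi1 (u 0 i / c i) := fun i =>
      mul_nonneg (hcpos i).le (Phi1_nonneg (div_nonneg (hunn 0 i) (hcpos i).le))
    exact mul_nonneg (by norm_num) (add_nonneg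
      (Finset.sum_nonneg fun K _ => mul_nonneg (hvp K) (hterm _))
      (Finset.sum_nonneg fun v _ => mul_nonneg (hvd v) (hterm _)))
  set w : M.Unk → ℝ := fun i => u (n + 1) i / c i with hw
  have hwpos : ∀ i, 0 < w i := fun i => div_pos (hu.pos n i) (hcpos i)
  have hcw : ∀ i, c i * w i = u (n + 1) i := fun i => mul_div_cancel₀ _ (hcpos i).ne'
  set T := M.TD Lam f r (u (n + 1)) (fun i => Real.log (w i)) fun i => Real.log (w i) with hT
  set Q := ∑ e, primalJump (fun i => √(w i)) e ^ 2 + ∑ e, dualJump (fun i => √(w i)) e ^ 2 with hQ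
  -- the dissipation controls the Dirichlet energy
  have hdiss : C * m * Q ≤ T := by
    have := dissipation_lower_bound hΩ hM hreg hΘ hlamm hLam hr hf hm (fun i => (hcb i).1) hwpos
    simpa only [hcw] using this
  -- the Dirichlet energy controls the entropy
  have hlsi : relEntropy M Ω u₀ V (u (n + 1)) ≤ U * A / 2 * Q := by
    refine le_of_forall_pos_le_add fun ε hε => ?_
    have hε' : 0 < ε / (U * A) := by positivity
    have hsq : ∀ i, √(w i) ^ 2 = w i := fun i => Real.sq_sqrt (hwpos i).le
    obtain ⟨t, ht, h1⟩ := hchi M hM hreg M.PCell M.cell _ _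
      (hM.primalPartition fun i => √(w i)) _ hε'
    obtain ⟨t', ht', h2⟩ := hchi M hM hreg M.Vtx M.dualCell _ _
      (hM.dualPartition hΩ fun i => √(w i)) _ hε'
    simp only [hsq] at h1 h2
    have h3 := sum_Phi1_le (w := fun K => w (.inl (.inl K))) (c := fun K => c (.inl (.inl K)))
      hvp (fun K => (hcpos _).le) (fun K => (hcb _).2) (fun K => hwpos _)
      (by simp only [hcw, hmassp]; exact primal_mass hΩ hM hu₀ hdt hu (n + 1)) ht
    have h4 := sum_Phi1_le (w := fun v => w (.inr v)) (c := fun v => c (.inr v))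
      hvd (fun v => (hcpos _).le) (fun v => (hcb _).2) (fun v => hwpos _)
      (by simp only [hcw, hmassd]; exact dual_mass hΩ hM hu₀ hdt hu (n + 1)) ht'
    have h5 := h3.trans (mul_le_mul_of_nonneg_left h1 hU.le)
    have h6 := h4.trans (mul_le_mul_of_nonneg_left h2 hU.le)
    have h7 : U * (A * (ε / (U * A))) = ε := by field_simp
    rw [hent]
    rw [mul_add A, mul_add U, h7] at h5 h6
    simp only [hw] at h5 h6
    rw [hQ]
    linarith
  -- the entropy decreases by at least the dissipation
  have hstep : relEntropy M Ω u₀ V (u (n + 1)) - relEntropy M Ω u₀ V (u n) ≤ -(dt * T) := by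
    have h1 := hu.scheme n fun i => Real.log (w i)
    have hTeq : M.TD Lam f r (u (n + 1))
        (fun i => Real.log (u (n + 1) i) + V (M.node i)) (fun i => Real.log (w i)) = T := by
      rw [hT, TD, TD]
      refine Finset.sum_congr rfl fun e _ => ?_
      have h2 := deltaD_log_steady (M := M) (V := V) (c := c)
        (mul_pos hM₁pos (inv_pos.2 hSp)) (mul_pos hM₁pos (inv_pos.2 hSd))
        (fun K => rfl) (fun v => rfl) hwpos e
      simp only [hcw] at h2
      rw [h2]
    rw [hTeq] at h1
    have h3 : dt * M.bracket (fun i => (u (n + 1) i - u n i) / dt) (fun i => Real.log (w i))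
        = 1 / 2 * (∑ K, volume.real (M.cell K) * ((u (n + 1) (.inl (.inl K))
            - u n (.inl (.inl K))) * Real.log (w (.inl (.inl K))))
          + ∑ v, volume.real (M.dualCell v) * ((u (n + 1) (.inr v) - u n (.inr v))
            * Real.log (w (.inr v)))) := by
      rw [bracket, mul_left_comm, mul_add dt, Finset.mul_sum, Finset.mul_sum]
      congr 2
      · exact Finset.sum_congr rfl fun K _ => by field_simp
      · exact Finset.sum_congr rfl fun v _ => by field_simp
    have h4 : dt * M.bracket (fun i => (u (n + 1) i - u n i) / dt) (fun i => Real.log (w i))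
        = -(dt * T) := by
      rw [eq_neg_of_add_eq_zero_left h1]; ring
    rw [← h4, h3, hent, hent, ← mul_sub, add_sub_add_comm, ← Finset.sum_sub_distrib,
      ← Finset.sum_sub_distrib]
    refine mul_le_mul_of_nonneg_left (add_le_add (Finset.sum_le_sum fun K _ => ?_)
      (Finset.sum_le_sum fun v _ => ?_)) (by norm_num)
    · rw [← mul_sub]
      exact mul_le_mul_of_nonneg_left (Phi1_sub_le (hcpos _) (hunn n _) (hu.pos n _)) (hvp K)
    · rw [← mul_sub]
      exact mul_le_mul_of_nonneg_left (Phi1_sub_le (hcpos _) (hunn n _) (hu.pos n _)) (hvd v)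
  have hνT : 2 * (C * m) / (U * A) * relEntropy M Ω u₀ V (u (n + 1)) ≤ T := by
    calc 2 * (C * m) / (U * A) * relEntropy M Ω u₀ V (u (n + 1))
        ≤ 2 * (C * m) / (U * A) * (U * A / 2 * Q) := by gcongr
      _ = C * m * Q := by field_simp
      _ ≤ T := hdiss
  have := mul_le_mul_of_nonneg_left hνT hdt.le
  linarith

end

theorem theorem4p1 (Ω : Set Plane) (hΩ : IsPolygonalDomain Ω)
    (u₀ : Plane → ℝ) (hu₀ : IsInitialDatum Ω u₀)
    (V : Plane → ℝ) (hV : IsC1OnClosure Ω V)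
    (lamm lamM : ℝ) (hlamm : 0 < lamm) (hlam : lamm ≤ lamM)
    (Θ : ℝ) (hΘ : 1 ≤ Θ) :
    ∃ ν : ℝ, 0 < ν ∧
      ∀ (Lam : Plane → Matrix (Fin 2) (Fin 2) ℝ), IsAnisotropyTensor Ω lamm lamM Lam →
      ∀ (M : DDFVData), M.IsMesh Ω → M.IsRegular Ω Θ →
      ∀ (r f : ℝ → ℝ → ℝ), IsMeanFunction r → IsAdmissibleCombination f →
      ∀ (dt : ℝ), 0 < dt →
      ∀ (u : ℕ → M.Unk → ℝ), IsDDFVSolution M u₀ V Lam f r dt u →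
        (∀ n : ℕ, relEntropy M Ω u₀ V (u n)
          ≤ (1 + ν * dt) ^ (-(n : ℤ)) * relEntropy M Ω u₀ V (u 0)) ∧
        (∀ k : ℝ, 0 < k → dt ≤ k → ∀ n : ℕ, relEntropy M Ω u₀ V (u n)
          ≤ Real.exp (-(Real.log (1 + ν * k) / k) * (n * dt)) * relEntropy M Ω u₀ V (u 0)) := by
  obtain ⟨ν, hν, h⟩ := exists_entropy_step Ω hΩ u₀ hu₀ V hV lamm lamM hlamm Θ hΘ
  refine ⟨ν, hν, fun Lam hLam M hM hreg r f hr hf dt hdt u hu => ?_⟩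
  obtain ⟨h0, hstep⟩ := h Lam hLam M hM hreg r f hr hf dt hdt u hu
  have hq : 0 < 1 + ν * dt := by positivity
  have hdecay : ∀ n : ℕ, relEntropy M Ω u₀ V (u n)
      ≤ (1 + ν * dt) ^ (-(n : ℤ)) * relEntropy M Ω u₀ V (u 0) := by
    intro n
    rw [zpow_neg, zpow_natCast, ← div_eq_inv_mul, le_div_iff₀ (by positivity)]
    induction n with
    | zero => simp
    | succ n ih =>
      refine le_trans ?_ ih
      rw [pow_succ, ← mul_assoc, mul_right_comm]
      exact mul_le_mul_of_nonneg_right (by linarith [hstep n]) (by positivity)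
  refine ⟨hdecay, fun k hk hdtk n => (hdecay n).trans ?_⟩
  refine mul_le_mul_of_nonneg_right ?_ h0
  -- by concavity of the logarithm, `log (1 + ν s) / s` is nonincreasing in `s`
  have hbern : (1 + ν * k) ^ (dt / k) ≤ 1 + ν * dt := by
    have h1 := rpow_one_add_le_one_add_mul_self (s := ν * k) (by nlinarith [mul_pos hν hk])
      (p := dt / k) (by positivity) ((div_le_one hk).2 hdtk)
    calc _ ≤ 1 + dt / k * (ν * k) := h1
      _ = _ := by field_simp
  have hlog : Real.log (1 + ν * k) / k * dt ≤ Real.log (1 + ν * dt) := by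
    have h2 := Real.log_le_log (by positivity) hbern
    rw [Real.log_rpow (by positivity)] at h2
    calc _ = dt / k * Real.log (1 + ν * k) := by ring
      _ ≤ _ := h2
  rw [zpow_neg, zpow_natCast, ← Real.exp_log hq, ← Real.exp_nat_mul, ← Real.exp_neg,
    Real.exp_le_exp]
  nlinarith [mul_le_mul_of_nonneg_left hlog (Nat.cast_nonneg (α := ℝ) n)]
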